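/- Let $k$ be a field of characteristic $0$, let $n\ge N\ge 2$ be integers, and let $A$ be the quotient of the free associative algebra $k\langle x_1,\dots,x_n\rangle$ by the two-sided ideal generated by the antisymmetrizers of degree $N$, $$\sum_{\sigma\in \mathbf S_N}\operatorname{sgn}(\sigma)\,x_{i_{\sigma(1)}}\cdots x_{i_{\sigma(N)}},\qquad 1\le i_1<\cdots<i_N\le n ,$$ graded by $\deg x_i=1$; let $k$ also denote the trivial $A$-module, on which every $x_i$ acts by $0$. Then: 1. $A$ is (generalized) Koszul, i.e. for every $i\ge 3$ the graded vector space $\operatorname{Tor}^A_i(k,k)$ is concentrated in degree $n(i)$, where $n(2q)=qN$ and $n(2q+1)=qN+1$; and $A$ has finite global dimension. 2. $A$ is AS-Gorenstein if and only if either $N=2$, or $N>2$ and $n=Nq+1$ for some integer $q\ge 1$. Here $A$ is called AS-Gorenstein if it has finite global dimension $D$, $\operatorname{Ext}^i_A(k,A)=0$ for all $i\ne D$, and $\operatorname{Ext}^D_A(k,A)\cong k$ as right $A$-modules, where $\operatorname{Ext}$ is taken in the category of left $A$-modules and the right action on $\operatorname{Ext}^D_A(k,A)$ is induced by right multiplication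 on $A$. -/

import Mathlib

universe u

noncomputable section

open CategoryTheory

/-! ### Global dimension, trivial module and the Artin–Schelter Gorenstein property -/

/-- The left global dimension of a ring: the supremum of the projective dimensions of all
left modules. -/
def leftGlobalDimension (A : Type u) [Ring A] : WithBot ℕ∞ :=
  ⨆ M : ModuleCat.{u} A, projectiveDimension M

/-- `A` has finite left global dimension. -/
def HasFiniteGlobalDimension (A : Type u) [Ring A] : Prop :=
  ∃ D : ℕ, leftGlobalDimension A = (D : WithBot ℕ∞)

section Gorenstein

variable {k A : Type u} [Field k] [Ring A] [Algebra k A]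

/-- The trivial left `A`-module `k` of an algebra `A` with augmentation `ε`. -/
def trivialModule (ε : A →ₐ[k] k) : ModuleCat.{u} A :=
  (ModuleCat.restrictScalars (ε : A →+* k)).obj (ModuleCat.of k k)

/-- Right multiplication by `a`, as an endomorphism of the left `A`-module `A`. -/
def rightMul (a : A) : ModuleCat.of A A ⟶ ModuleCat.of A A :=
  ModuleCat.ofHom (LinearMap.toSpanSingleton A A a)

/-- The right action of `a : A` on `Ext^i_A(k, A)`, induced by right multiplication
on the second variable. -/
def extRightAct (ε : A →ₐ[k] k) {i : ℕ} (a : A)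
    (e : Abelian.Ext (trivialModule ε) (ModuleCat.of A A) i) :
    Abelian.Ext (trivialModule ε) (ModuleCat.of A A) i :=
  e.comp (Abelian.Ext.mk₀ (rightMul a)) (add_zero i)

/-- The augmented algebra `(A, ε)` is (left) AS-Gorenstein: it has finite global dimension `D`,
`Ext^i_A(k, A) = 0` for `i ≠ D`, and `Ext^D_A(k, A)` is isomorphic to the trivial module `k`
(as a right `A`-module, and in particular as a `k`-vector space, the scalars of `k` acting through
`k → A`). Here `Ext` is taken in the category of all left `A`-modules. -/
def IsASGorenstein (ε : A →ₐ[k] k) : Prop :=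
  ∃ D : ℕ, leftGlobalDimension A = (D : WithBot ℕ∞) ∧
    (∀ i : ℕ, i ≠ D → Subsingleton (Abelian.Ext (trivialModule ε) (ModuleCat.of A A) i)) ∧
    ∃ φ : Abelian.Ext (trivialModule ε) (ModuleCat.of A A) D ≃+ k,
      ∀ (a : A) (e : Abelian.Ext (trivialModule ε) (ModuleCat.of A A) D),
        φ (extRightAct ε a e) = φ e * ε a

end Gorenstein

/-! ### Graded Tor and the generalized Koszul property -/

section Koszul

variable {k A : Type u} [Field k] [Ring A] [Algebra k A]

/-- A resolution `⋯ → P₁ → P₀ → k → 0` of the trivial left module of `(A, ε)` by graded free left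
modules `P i = A^{(basis i)}`, the basis element `b` having degree `deg i b`, with differentials
and augmentation homogeneous of degree `0`. The algebra `A` is graded by `𝒜`. -/
structure GradedFreeResolution (𝒜 : ℕ → Submodule k A) (ε : A →ₐ[k] k) where
  basis : ℕ → Type u
  deg : ∀ i, basis i → ℕ
  d : ∀ i, (basis (i + 1) →₀ A) →ₗ[A] (basis i →₀ A)
  aug : (basis 0 →₀ A) →ₛₗ[(ε : A →+* k)] k
  /-- The coefficient of `d b` at `c` is homogeneous of degree `deg b - deg c`
  (and zero if this is negative). -/
  d_homogeneous : ∀ (i : ℕ) (b : basis (i + 1)) (c : basis i),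
    d i (Finsupp.single b 1) c = 0 ∨
      ∃ m : ℕ, deg i c + m = deg (i + 1) b ∧ d i (Finsupp.single b 1) c ∈ 𝒜 m
  aug_homogeneous : ∀ b : basis 0, aug (Finsupp.single b 1) = 0 ∨ deg 0 b = 0
  aug_surjective : Function.Surjective aug
  exact_zero : Function.Exact (d 0) aug
  exact_succ : ∀ i, Function.Exact (d (i + 1)) (d i)

namespace GradedFreeResolution

variable {𝒜 : ℕ → Submodule k A} {ε : A →ₐ[k] k} (P : GradedFreeResolution 𝒜 ε)

/-- The differential of the complex `k ⊗_A P`, where `k ⊗_A P i` is identified with the vector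
space `k^{(basis i)}` through `c ⊗ a b ↦ c ε(a) b`. -/
def reducedD (i : ℕ) : (P.basis (i + 1) →₀ k) →ₗ[k] (P.basis i →₀ k) :=
  Finsupp.linearCombination k fun b =>
    (P.d i (Finsupp.single b 1)).mapRange ε (map_zero ε)

/-- The cycles of `k ⊗_A P` in homological degree `i`. -/
def cycles : ∀ i : ℕ, Submodule k (P.basis i →₀ k)
  | 0 => ⊤
  | i + 1 => LinearMap.ker (P.reducedD i)

/-- The boundaries of `k ⊗_A P` in homological degree `i`. -/
def boundaries (i : ℕ) : Submodule k (P.basis i →₀ k) :=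
  LinearMap.range (P.reducedD i)

/-- The cycles in homological degree `i` which are homogeneous of internal degree `j`. -/
def gradedCycles (i j : ℕ) : Submodule k (P.basis i →₀ k) :=
  P.cycles i ⊓ Finsupp.supported k k {b | P.deg i b = j}

/-- The component of degree `j` of the graded vector space `Tor_i^A(k, k) = H_i(k ⊗_A P)`: the
space of homogeneous cycles of degree `j` modulo boundaries, realised as the image of the former in
the quotient of `k ⊗_A P i` by the boundaries. -/
def Tor (i j : ℕ) : Submodule k ((P.basis i →₀ k) ⧸ P.boundaries i) :=
  (P.gradedCycles i j).map (P.boundaries i).mkQ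

end GradedFreeResolution

/-- The jump map `n(2q) = qN`, `n(2q+1) = qN + 1`. -/
def jump (N i : ℕ) : ℕ := i / 2 * N + i % 2

/-- An `N`-homogeneous algebra `A`, with grading `𝒜` and augmentation `ε`, is generalized Koszul
if for all `i ≥ 3` the graded vector space `Tor_i^A(k, k)` is concentrated in degree `n(i)`.
The graded space `Tor_i^A(k, k)` may be computed from any graded free resolution of `k`, the choice
being irrelevant up to isomorphism. -/
def IsGeneralizedKoszul (N : ℕ) (𝒜 : ℕ → Submodule k A) (ε : A →ₐ[k] k) : Prop :=
  ∃ P : GradedFreeResolution 𝒜 ε, ∀ i : ℕ, 3 ≤ i → ∀ j : ℕ, j ≠ jump N i → P.Tor i j = ⊥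

end Koszul

/-! ### The algebra defined by the antisymmetrizers of degree `N` -/

/-- The antisymmetrizer `∑_σ sgn(σ) x_{i_{σ(1)}} ⋯ x_{i_{σ(N)}}` in the free algebra. -/
def antisymmetrizer (k : Type u) [Field k] {n N : ℕ} (i : Fin N → Fin n) :
    FreeAlgebra k (Fin n) :=
  ∑ σ : Equiv.Perm (Fin N),
    ((Equiv.Perm.sign σ : ℤ) : FreeAlgebra k (Fin n)) *
      (List.ofFn fun j => FreeAlgebra.ι k (i (σ j))).prod

/-- The relations: the antisymmetrizers for `i_1 < ⋯ < i_N` are zero. -/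
def antisymmetrizerRel (k : Type u) [Field k] (n N : ℕ) (a b : FreeAlgebra k (Fin n)) : Prop :=
  (∃ i : Fin N → Fin n, StrictMono i ∧ a = antisymmetrizer k i) ∧ b = 0

/-- The quotient of the free algebra on `x_1, …, x_n` by the two-sided ideal generated by all
antisymmetrizers of degree `N`. -/
abbrev AntisymmetrizerAlgebra (k : Type u) [Field k] (n N : ℕ) : Type u :=
  RingQuot (antisymmetrizerRel k n N)

namespace AntisymmetrizerAlgebra

variable (k : Type u) [Field k] (n N : ℕ)

/-- The generators `x_1, …, x_n`. -/
def gen (i : Fin n) : AntisymmetrizerAlgebra k n N :=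
  RingQuot.mkAlgHom k (antisymmetrizerRel k n N) (FreeAlgebra.ι k i)

/-- The component of degree `m`, spanned by the products of `m` generators. -/
def component (m : ℕ) : Submodule k (AntisymmetrizerAlgebra k n N) :=
  Submodule.span k (Set.range (gen k n N)) ^ m

variable {N}

/-- The augmentation, sending all the generators to `0`. -/
def augmentation (hN : 2 ≤ N) : AntisymmetrizerAlgebra k n N →ₐ[k] k :=
  RingQuot.liftAlgHom k ⟨FreeAlgebra.lift k fun _ => 0, by
    rintro a b ⟨⟨i, _, rfl⟩, rfl⟩
    obtain ⟨N, rfl⟩ : ∃ m, N = m + 1 := ⟨N - 1, by omega⟩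
    simp [antisymmetrizer, List.ofFn_succ]⟩

end AntisymmetrizerAlgebra

end

/-! Order words by length and then lexicographically. The antisymmetrizer of a set of `N` letters
is, up to a scalar, an element `rel` whose leading word lists the letters in descending order. These
elements form a Gröbner basis. Two overlapping descending words glue to a longer descending word,
and the overlap resolves because the antisymmetric element of degree `N + 1` can be expanded along
its first or its last letter (`sum_rel_eq`, `relWord_sub_shift`). Hence the words without `N`
consecutive descending letters form a basis of `A` (`irrBasis`).

For an `A`-module `M`, let `D` and `E` act on `A ⊗ Λ ⊗ M` by removing a letter from the exterior
factor and multiplying it into `A`, respectively into `M`. They commute, and `D ^ N = E ^ N = 0`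
because antisymmetrized products of length `N` vanish. Alternating `D - E` with `∑ D ^ a * E ^ (N -
1 - a)` therefore gives a complex on the exterior degrees `jump N i`. To leading order its
differential moves the largest letters of a set `S` to the end of a word `w`. If `w ⊗ S` leads a
cycle, the word so obtained must be reducible; then a suffix of `w` extends `S` to a longer
descending word, so `w ⊗ S` also leads a boundary. Induction on the order gives exactness
(`WordModule.exact_succ`).

For arbitrary `M` this bounds the global dimension by the last `T` with `jump N T ≤ n`. For the
trivial module, with `E = 0`, it is a graded free resolution with generators in degree `jump N i`,
which gives Koszulity.

Pairing a set with its complement turns the dual of that resolution into a complex of left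
multiplications (`dualPairing_contr_pow`). When `jump N i + jump N (D - i) = n` for all `i ≤ D`, it
is the Koszul complex of right modules, exact by reversal of words, so `A` is AS-Gorenstein.
Conversely, top coboundaries have values in the augmentation ideal, so each basis element in degree
`T` has a nonzero class; one-dimensionality of `Ext` forces `jump N T = n`. If `N > 2` and `T` is
even, the values of top coboundaries have no linear part either, as the morphism to the dual numbers
detects; but a generator must kill the top class, a contradiction (`eq_of_isASGorenstein`). -/

noncomputable section

open TensorProduct

/-! ### Words, ordered by length and then lexicographically -/

section Words

variable {n : ℕ}

/-- The key of a word for the degree-lexicographic order. -/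
def wordKey (u : List (Fin n)) : ℕ ×ₗ List (Fin n) := toLex (u.length, u)

lemma wordKey_injective : Function.Injective (wordKey (n := n)) := fun u v h => by
  have := congrArg (fun z => (ofLex z).2) h
  exact this

lemma wordKey_lt_iff {u v : List (Fin n)} :
    wordKey u < wordKey v ↔ u.length < v.length ∨ u.length = v.length ∧ u < v := by
  simp [wordKey, Prod.Lex.toLex_lt_toLex]

lemma wordKey_lt_of_length_lt {u v : List (Fin n)} (h : u.length < v.length) :
    wordKey u < wordKey v := wordKey_lt_iff.2 (Or.inl h)

lemma wordKey_lt_wf : WellFounded fun u v : List (Fin n) => wordKey u < wordKey v := by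
  have := List.Shortlex.wf (r := fun a b : Fin n => a < b) wellFounded_lt
  refine Subrelation.wf (fun {u v} h => ?_) this
  rw [List.shortlex_def]
  exact wordKey_lt_iff.1 h

lemma wordKey_append_left_lt {u v : List (Fin n)} (w : List (Fin n)) (h : wordKey u < wordKey v) :
    wordKey (w ++ u) < wordKey (w ++ v) := by
  rw [wordKey_lt_iff] at h ⊢
  rcases h with h | ⟨h, h'⟩
  · left; simpa using h
  · right
    exact ⟨by simpa using h, List.append_left_lt h'⟩

lemma List.append_lt_append_of_length_eq {u v : List (Fin n)} (w w' : List (Fin n))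
    (hl : u.length = v.length) (h : u < v) : u ++ w < v ++ w' := by
  induction u generalizing v with
  | nil =>
    cases v with
    | nil => exact absurd h (lt_irrefl _)
    | cons => simp at hl
  | cons a u ih =>
    cases v with
    | nil => simp at hl
    | cons b v =>
      rw [List.cons_append, List.cons_append, List.cons_lt_cons_iff]
      rw [List.cons_lt_cons_iff] at h
      rcases h with h | ⟨h, h'⟩
      · exact Or.inl h
      · exact Or.inr ⟨h, ih (by simpa using hl) h'⟩

lemma wordKey_append_right_lt {u v : List (Fin n)} (w : List (Fin n)) (h : wordKey u < wordKey v) :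
    wordKey (u ++ w) < wordKey (v ++ w) := by
  rw [wordKey_lt_iff] at h ⊢
  rcases h with h | ⟨h, h'⟩
  · left; simpa using h
  · right
    exact ⟨by simpa using h, List.append_lt_append_of_length_eq w w h h'⟩

lemma wordKey_append_right_le {u v : List (Fin n)} (w : List (Fin n)) (h : wordKey u ≤ wordKey v) :
    wordKey (u ++ w) ≤ wordKey (v ++ w) := by
  rcases h.eq_or_lt with h | h
  · rw [wordKey_injective h]
  · exact (wordKey_append_right_lt w h).le

lemma wordKey_cons_lt {a b : Fin n} {u v : List (Fin n)} (h : a < b) (hl : u.length = v.length) :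
    wordKey (a :: u) < wordKey (b :: v) := by
  rw [wordKey_lt_iff]
  right
  exact ⟨by simp [hl], by rw [List.cons_lt_cons_iff]; exact Or.inl h⟩

/-- A strictly descending word. -/
abbrev Descending (c : List (Fin n)) : Prop := c.Pairwise (· > ·)

/-- The elements of a finite set in descending order. -/
def descList (S : Finset (Fin n)) : List (Fin n) := S.sort (· ≥ ·)

lemma descending_descList (S : Finset (Fin n)) : Descending (descList S) :=
  (Finset.sortedGT_sort S).pairwise

@[simp] lemma toFinset_descList (S : Finset (Fin n)) : (descList S).toFinset = S :=
  Finset.sort_toFinset ..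

@[simp] lemma length_descList (S : Finset (Fin n)) : (descList S).length = S.card :=
  Finset.length_sort ..

lemma Descending.nodup {c : List (Fin n)} (h : Descending c) : c.Nodup :=
  h.imp fun h => ne_of_gt h

lemma descList_toFinset {c : List (Fin n)} (h : Descending c) : descList c.toFinset = c := by
  refine List.Perm.eq_of_pairwise' (r := (· > ·)) (descending_descList _) h ?_
  rw [List.perm_ext_iff_of_nodup (descending_descList _).nodup h.nodup]
  intro a
  rw [← List.mem_toFinset, toFinset_descList, List.mem_toFinset]

lemma Descending.card_toFinset {c : List (Fin n)} (h : Descending c) :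
    c.toFinset.card = c.length := List.toFinset_card_of_nodup h.nodup

/-- A word is reducible (for `N`) if it contains `N` consecutive strictly descending letters. -/
def Reducible (N : ℕ) (u : List (Fin n)) : Prop :=
  ∃ a q b, u = a ++ q ++ b ∧ q.length = N ∧ Descending q

/-- Two descending words glue along a common letter `a`, which lies below everything in `t` and
above everything in `c`. This is how overlapping leading words merge. -/
lemma descending_append_cons {t p c : List (Fin n)} {a : Fin n} (h : Descending (t ++ a :: p))
    (hc : Descending (a :: c)) : Descending (t ++ a :: c) := by
  rw [Descending, List.pairwise_append] at h ⊢
  refine ⟨h.1, hc, fun x hx y hy => ?_⟩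
  have hxa := h.2.2 x hx a (by simp)
  rcases List.mem_cons.1 hy with rfl | hy
  · exact hxa
  · exact lt_trans ((List.pairwise_cons.1 hc).1 y hy) hxa

/-- If `w` is irreducible, but `w` followed by the first `r` letters of the descending word `p ++ c`
is not, then a suffix of `w` of length `N - r` can be prepended to `p ++ c`. -/
lemma exists_descending_suffix {N r : ℕ} {w p c : List (Fin n)} (hr : r < N)
    (hp : p.length = r) (hpc : Descending (p ++ c)) (hw : ¬ Reducible N w)
    (h : Reducible N (w ++ p)) :
    ∃ w' t, w = w' ++ t ∧ t.length = N - r ∧ Descending (t ++ (p ++ c)) := by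
  obtain ⟨a, q, b, e, hq, hd⟩ := h
  rw [List.append_assoc] at e
  have e' := e
  rcases List.append_eq_append_iff.1 e with ⟨a', rfl, h2⟩ | ⟨t0, rfl, h2⟩
  · exfalso
    have := congrArg List.length h2
    simp at this
    omega
  · have h3 := h2
    rcases List.append_eq_append_iff.1 h2 with ⟨a', h4, h5⟩ | ⟨p', rfl, h5⟩
    · exfalso
      exact hw ⟨a, q, a', by rw [h4, List.append_assoc], hq, hd⟩
    · subst h5
      cases p' with
      | nil =>
        exfalso
        refine hw ⟨a, t0, [], by simp, ?_, ?_⟩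
        · simpa using hq
        · simpa using hd
      | cons x p' =>
        simp only [List.length_append, List.length_cons] at hq hp
        -- The descending factor `q` straddles the boundary between `w` and `p`, so it can be glued
        -- to `p ++ c` at its first letter `x` inside `p`.
        have hdd : Descending (t0 ++ (x :: p' ++ b ++ c)) := by
          have := descending_append_cons (t := t0) (p := p') (c := p' ++ b ++ c) hd
            (by simpa using hpc)
          simpa using this
        -- At most `r` letters of `q` lie in `p`, so `t0` has at least `N - r` letters; only the
        -- last `N - r` are kept.
        refine ⟨a ++ t0.take (t0.length - (N - r)), t0.drop (t0.length - (N - r)), ?_, ?_, ?_⟩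
        · rw [List.append_assoc, List.take_append_drop]
        · rw [List.length_drop]; omega
        · refine hdd.sublist ?_
          exact List.Sublist.append_right (List.drop_sublist _ _) _

end Words

/-! ### Contraction operators on functions of finite subsets -/

section Contraction

variable {n : ℕ} {R B : Type*} [Ring R] [AddCommGroup B] [Module R B]

/-- The sign of moving `s` in front of the elements `t` of `S` with `r s t`. -/
def moveSign (r : Fin n → Fin n → Prop) [DecidableRel r] (s : Fin n) (S : Finset (Fin n)) : ℤ :=
  (-1) ^ (S.filter (r s)).card

lemma moveSign_insert (r : Fin n → Fin n → Prop) [DecidableRel r] {s t : Fin n}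
    {S : Finset (Fin n)} (h : s ∉ S) :
    moveSign r t (insert s S) = (if r t s then -1 else 1) * moveSign r t S := by
  unfold moveSign
  rw [Finset.filter_insert]
  split_ifs with h'
  · rw [Finset.card_insert_of_notMem (by simp [h]), pow_succ]; ring
  · simp

variable (R B) in
/-- The contraction by the basis vector `s`, with signs determined by `r`. -/
def contr (r : Fin n → Fin n → Prop) [DecidableRel r] (s : Fin n) :
    Module.End R (Finset (Fin n) → B) where
  toFun f S := if s ∈ S then 0 else moveSign r s S • f (insert s S)
  map_add' f g := by ext S; by_cases h : s ∈ S <;> simp [h]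
  map_smul' a f := by
    ext S
    by_cases h : s ∈ S
    · simp [h]
    · simpa [h] using smul_comm _ _ _

lemma contr_apply (r : Fin n → Fin n → Prop) [DecidableRel r] (s : Fin n)
    (f : Finset (Fin n) → B) (S : Finset (Fin n)) :
    contr R B r s f S = if s ∈ S then 0 else moveSign r s S • f (insert s S) := rfl

/-- The sign depending on `r' t s` is the only asymmetry between the two orders of contraction; both
commutation rules below are read off from it. -/
lemma contr_contr_apply (r r' : Fin n → Fin n → Prop) [DecidableRel r] [DecidableRel r']
    (s t : Fin n) (f : Finset (Fin n) → B) (S : Finset (Fin n)) :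
    contr R B r s (contr R B r' t f) S = if s ∈ S ∨ t ∈ S ∨ s = t then 0 else
      ((if r' t s then -1 else 1) * (moveSign r s S * moveSign r' t S)) •
        f (insert s (insert t S)) := by
  rw [contr_apply, contr_apply]
  by_cases hs : s ∈ S
  · simp [hs]
  by_cases ht : t ∈ S
  · simp [ht]
  by_cases h : s = t
  · simp [h]
  rw [if_neg hs, if_neg (by simp [ht, Ne.symm h]), if_neg (by simp [hs, ht, h]),
    moveSign_insert r' hs, smul_smul, Finset.insert_comm]
  congr 1
  ring

/-- Exactly one of `r s t` and `r t s` holds, so exactly one of the two orders acquires an extra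
sign. -/
lemma contr_anticomm (r : Fin n → Fin n → Prop) [DecidableRel r]
    (hr : ∀ s t, s ≠ t → (r s t ↔ ¬ r t s)) (s t : Fin n) :
    contr R B r s * contr R B r t + contr R B r t * contr R B r s = 0 := by
  refine LinearMap.ext fun f => funext fun S => ?_
  simp only [LinearMap.add_apply, Module.End.mul_apply, Pi.add_apply, contr_contr_apply,
    LinearMap.zero_apply, Pi.zero_apply]
  by_cases hs : s ∈ S
  · simp [hs]
  by_cases ht : t ∈ S
  · simp [ht]
  by_cases h : s = t
  · simp [h]
  have hst : ¬ (s ∈ S ∨ t ∈ S ∨ s = t) := by simp [hs, ht, h]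
  have hts : ¬ (t ∈ S ∨ s ∈ S ∨ t = s) := by simp [hs, ht, Ne.symm h]
  rw [if_neg hst, if_neg hts, Finset.insert_comm,
    ← add_smul]
  have : r s t ↔ ¬ r t s := hr s t h
  by_cases h' : r t s
  · simp [h', this, mul_comm]
  · simp [h', this, mul_comm]

lemma contr_mul_self (r : Fin n → Fin n → Prop) [DecidableRel r] (s : Fin n) :
    contr R B r s * contr R B r s = 0 := by
  refine LinearMap.ext fun f => funext fun S => ?_
  simp [contr_contr_apply]

/-- Contraction from the left commutes, without sign, with contraction from the right: for opposite
relations both orders acquire the same sign. -/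
lemma contr_comm (r r' : Fin n → Fin n → Prop) [DecidableRel r] [DecidableRel r']
    (hr : ∀ s t, r s t ↔ r' t s) (s t : Fin n) :
    Commute (contr R B r s) (contr R B r' t) := by
  refine LinearMap.ext fun f => funext fun S => ?_
  simp only [Module.End.mul_apply, contr_contr_apply]
  by_cases hs : s ∈ S
  · simp [hs]
  by_cases ht : t ∈ S
  · simp [ht]
  by_cases h : s = t
  · simp [h]
  have hst : ¬ (s ∈ S ∨ t ∈ S ∨ s = t) := by simp [hs, ht, h]
  have hts : ¬ (t ∈ S ∨ s ∈ S ∨ t = s) := by simp [hs, ht, Ne.symm h]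
  rw [if_neg hst, if_neg hts, Finset.insert_comm]
  congr 2
  · simp [hr]
  · ring

lemma contr_compLeft (r : Fin n → Fin n → Prop) [DecidableRel r] (s : Fin n)
    (l : Module.End R B) : Commute (contr R B r s) (l.compLeft (Finset (Fin n))) := by
  refine LinearMap.ext fun f => funext fun S => ?_
  simp only [Module.End.mul_apply, contr_apply, LinearMap.compLeft_apply, Function.comp_apply]
  by_cases hs : s ∈ S <;> simp [hs]

lemma compLeft_mul (l l' : Module.End R B) :
    (l * l').compLeft (Finset (Fin n)) = l.compLeft _ * l'.compLeft _ := rfl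

lemma Commute.compLeft {l l' : Module.End R B} (h : Commute l l') :
    Commute (l.compLeft (Finset (Fin n))) (l'.compLeft (Finset (Fin n))) := by
  rw [Commute, SemiconjBy, ← compLeft_mul, ← compLeft_mul, h.eq]

lemma contr_single (r : Fin n → Fin n → Prop) [DecidableRel r] (s : Fin n) (T : Finset (Fin n))
    (b : B) : contr R B r s (Pi.single T b) =
      if s ∈ T then moveSign r s (T.erase s) • Pi.single (T.erase s) b else 0 := by
  ext S
  rw [contr_apply]
  by_cases hT : s ∈ T
  · by_cases hS : s ∈ S
    · have : S ≠ T.erase s := fun e => by simp [e] at hS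
      simp [hT, hS, this]
    · by_cases e : S = T.erase s
      · subst e
        simp [hT]
      · have : insert s S ≠ T := fun e' => e (by rw [← e', Finset.erase_insert hS])
        simp [hS, hT, e, this]
  · by_cases hS : s ∈ S
    · simp [hT, hS]
    · have : insert s S ≠ T := fun e' => hT (by rw [← e']; simp)
      simp [hT, this]

/-- The Koszul type operator `∑ s, contr s ⊗ l s`. -/
def koszulOp (r : Fin n → Fin n → Prop) [DecidableRel r] (l : Fin n → Module.End R B) :
    Module.End R (Finset (Fin n) → B) :=
  ∑ s, contr R B r s * (l s).compLeft _

lemma koszulOp_apply (r : Fin n → Fin n → Prop) [DecidableRel r] (l : Fin n → Module.End R B)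
    (f : Finset (Fin n) → B) (S : Finset (Fin n)) :
    koszulOp r l f S = ∑ s, if s ∈ S then 0 else moveSign r s S • l s (f (insert s S)) := by
  simp [koszulOp, contr_apply]

lemma koszulOp_single (r : Fin n → Fin n → Prop) [DecidableRel r] (l : Fin n → Module.End R B)
    (T : Finset (Fin n)) (b : B) :
    koszulOp r l (Pi.single T b) =
      ∑ s ∈ T, moveSign r s (T.erase s) • Pi.single (T.erase s) (l s b) := by
  have : ∀ s, (l s).compLeft (Finset (Fin n)) (Pi.single T b) = Pi.single T (l s b) := by
    intro s
    ext S
    by_cases h : S = T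
    · subst h; simp
    · simp [h]
  simp [koszulOp, this, contr_single]

lemma koszulOp_commute (r r' : Fin n → Fin n → Prop) [DecidableRel r] [DecidableRel r']
    (hr : ∀ s t, r s t ↔ r' t s) (l l' : Fin n → Module.End R B)
    (h : ∀ s t, Commute (l s) (l' t)) : Commute (koszulOp r l) (koszulOp r' l') := by
  refine Commute.sum_left _ _ _ fun s _ => Commute.sum_right _ _ _ fun t _ => ?_
  refine Commute.mul_left ?_ ?_
  · exact (contr_comm r r' hr s t).mul_right (contr_compLeft r s _)
  · exact (contr_compLeft r' t _).symm.mul_right (h s t).compLeft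

/-- The antisymmetrized product of elements of a ring. -/
def antisymmProd {Q : Type*} [Ring Q] (x : Fin n → Q) {N : ℕ} (v : Fin N → Fin n) : Q :=
  ∑ σ : Equiv.Perm (Fin N), (Equiv.Perm.sign σ : ℤ) • (List.ofFn fun j => x (v (σ j))).prod

/-! ### Products of anticommuting square-zero elements -/

section Exterior

variable {E : Type*} [Ring E]

/-- The elements `c s` define a ring morphism from the exterior algebra of `ℤ ^ n`, so their
products are alternating in `v`. -/
lemma anticomm_prod_perm (c : Fin n → E) (h0 : ∀ s, c s * c s = 0)
    (h : ∀ s t, c s * c t + c t * c s = 0) {N : ℕ} (v : Fin N → Fin n) :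
    (¬ Function.Injective v → (List.ofFn fun j => c (v j)).prod = 0) ∧
    ∀ σ : Equiv.Perm (Fin N), (List.ofFn fun j => c (v (σ j))).prod =
      (Equiv.Perm.sign σ : ℤ) • (List.ofFn fun j => c (v j)).prod := by
  let f : (Fin n → ℤ) →ₗ[ℤ] E := Fintype.linearCombination ℤ c
  have hf : ∀ x, f x * f x = algebraMap ℤ E 0 := by
    intro x
    simp only [f, Fintype.linearCombination_apply, map_zero]
    rw [Finset.sum_mul_sum, ← Finset.sum_product']
    -- Off-diagonal terms of the square cancel in pairs; diagonal terms vanish by `h0`.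
    refine Finset.sum_involution (fun p _ => (p.2, p.1)) ?_ ?_ ?_ ?_
    · rintro ⟨s, t⟩ -
      simp only [smul_mul_smul_comm]
      rw [mul_comm (x t), ← smul_add, h, smul_zero]
    · rintro ⟨s, t⟩ - hne heq
      obtain rfl : t = s := congrArg Prod.fst heq
      exact hne (by rw [smul_mul_smul_comm, h0, smul_zero])
    · simp
    · simp
  let F := ExteriorAlgebra.lift ℤ ⟨f, by simpa using hf⟩
  have key : ∀ w : Fin N → Fin n, (List.ofFn fun j => c (w j)).prod =
      F (ExteriorAlgebra.ιMulti ℤ N fun j => Pi.single (w j) 1) := by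
    intro w
    rw [ExteriorAlgebra.ιMulti_apply, map_list_prod, List.map_ofFn]
    congr 2
    ext j
    simp [F, f]
  constructor
  · intro hv
    rw [key]
    simp only [Function.Injective, not_forall] at hv
    obtain ⟨i, j, e, hij⟩ := hv
    rw [AlternatingMap.map_eq_zero_of_eq _ _ (i := i) (j := j) (by simp [e]) hij, map_zero]
  · intro σ
    rw [key, key]
    have := (ExteriorAlgebra.ιMulti ℤ N (M := Fin n → ℤ)).map_perm
      (fun j => Pi.single (v j) 1) σ
    have e : (fun j => (Pi.single (v (σ j)) 1 : Fin n → ℤ)) = (fun j => Pi.single (v j) 1) ∘ σ :=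
      rfl
    rw [e, this]
    rcases Int.units_eq_one_or (Equiv.Perm.sign σ) with h | h <;> simp [h]

lemma sum_pow_eq_sum_prod (a : Fin n → E) (N : ℕ) :
    (∑ s, a s) ^ N = ∑ v : Fin N → Fin n, (List.ofFn fun j => a (v j)).prod := by
  have := (MultilinearMap.mkPiAlgebraFin ℤ N E).map_sum (fun (_ : Fin N) (s : Fin n) => a s)
  simpa using this

lemma prod_ofFn_mul (a b : ℕ → E) (N : ℕ) (h : ∀ i j, Commute (a i) (b j)) :
    (List.ofFn fun j : Fin N => a j * b j).prod =
      (List.ofFn fun j : Fin N => a j).prod * (List.ofFn fun j : Fin N => b j).prod := by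
  induction N generalizing a b with
  | zero => simp
  | succ N ih =>
    simp only [List.ofFn_succ, List.prod_cons, Fin.val_zero, Fin.val_succ]
    rw [ih (fun j => a (j + 1)) (fun j => b (j + 1)) (fun i j => h _ _)]
    have : Commute (b 0) (List.ofFn fun j : Fin N => a (j + 1)).prod := by
      refine Commute.list_prod_right _ _ fun x hx => ?_
      obtain ⟨j, rfl⟩ := List.mem_ofFn.1 hx
      exact (h _ _).symm
    rw [mul_assoc, mul_assoc, ← mul_assoc (b 0), this.eq, mul_assoc]

end Exterior

lemma koszulOp_pow (r : Fin n → Fin n → Prop) [DecidableRel r]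
    (l : Fin n → Module.End R B) (N : ℕ) :
    koszulOp r l ^ N = ∑ v : Fin N → Fin n, (List.ofFn fun j => contr R B r (v j)).prod *
      ((List.ofFn fun j => l (v j)).prod).compLeft _ := by
  rw [koszulOp, sum_pow_eq_sum_prod]
  refine Finset.sum_congr rfl fun v _ => ?_
  have hc : ∀ L : List (Module.End R B), (L.prod).compLeft (Finset (Fin n)) =
      (L.map fun x => x.compLeft (Finset (Fin n))).prod := by
    intro L
    induction L with
    | nil => rfl
    | cons x L ih => rw [List.prod_cons, compLeft_mul, ih, List.map_cons, List.prod_cons]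
  rw [hc, List.map_ofFn]
  -- `prod_ofFn_mul` takes families indexed by `ℕ`, so both families are extended by `1` beyond `N`.
  have := prod_ofFn_mul
    (fun j => if h : j < N then contr R B r (v ⟨j, h⟩) else 1)
    (fun j => if h : j < N then (l (v ⟨j, h⟩)).compLeft (Finset (Fin n)) else 1) N ?_
  · simpa [Function.comp_def] using this
  · intro i j
    split_ifs
    · exact contr_compLeft _ _ _
    · exact Commute.one_right _
    · exact Commute.one_left _
    · exact Commute.one_left _

/-- Averaging the expansion of the `N`-th power over the symmetric group. -/
lemma factorial_smul_koszulOp_pow (r : Fin n → Fin n → Prop) [DecidableRel r]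
    (hr : ∀ s t, s ≠ t → (r s t ↔ ¬ r t s)) (l : Fin n → Module.End R B) (N : ℕ) :
    N.factorial • koszulOp r l ^ N =
      ∑ v : Fin N → Fin n, (List.ofFn fun j => contr R B r (v j)).prod *
        (antisymmProd l v).compLeft _ := by
  -- The sum runs over all `v`, so replacing `v` by `v ∘ σ` only reindexes it. Summing over `σ` and
  -- moving the signs of the contractions onto the `l`-products produces the antisymmetrizer.
  have h1 : ∀ σ : Equiv.Perm (Fin N), koszulOp r l ^ N = ∑ v : Fin N → Fin n,
      (List.ofFn fun j => contr R B r (v (σ j))).prod *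
      ((List.ofFn fun j => l (v (σ j))).prod).compLeft _ := by
    intro σ
    rw [koszulOp_pow]
    refine (Fintype.sum_equiv (Equiv.arrowCongr σ (Equiv.refl _)) _ _ fun v => ?_)
    simp [Equiv.arrowCongr]
  have h2 : N.factorial • koszulOp r l ^ N = ∑ σ : Equiv.Perm (Fin N), koszulOp r l ^ N := by
    simp [Fintype.card_perm]
  rw [h2, Finset.sum_congr rfl fun σ _ => h1 σ, Finset.sum_comm]
  refine Finset.sum_congr rfl fun v _ => ?_
  have h3 := (anticomm_prod_perm (contr R B r) (contr_mul_self r) (contr_anticomm r hr) v).2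
  simp only [h3]
  refine LinearMap.ext fun f => funext fun S => ?_
  simp only [smul_mul_assoc, LinearMap.coe_sum, Finset.sum_apply, LinearMap.smul_apply,
    Module.End.mul_apply]
  have h4 : (antisymmProd l v).compLeft (Finset (Fin n)) f = ∑ σ : Equiv.Perm (Fin N),
      (Equiv.Perm.sign σ : ℤ) • ((List.ofFn fun j => l (v (σ j))).prod).compLeft _ f := by
    ext S
    simp [antisymmProd]
  rw [h4, map_sum, Finset.sum_apply]
  refine Finset.sum_congr rfl fun σ _ => ?_
  rw [map_zsmul]

/-- If the antisymmetrized products of length `N` vanish, so does the `N`-th power. -/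
lemma koszulOp_pow_eq_zero (r : Fin n → Fin n → Prop) [DecidableRel r]
    (hr : ∀ s t, s ≠ t → (r s t ↔ ¬ r t s)) (l : Fin n → Module.End R B) (N : ℕ)
    (hB : ∀ b : B, N.factorial • b = 0 → b = 0)
    (hl : ∀ v : Fin N → Fin n, Function.Injective v → antisymmProd l v = 0) :
    koszulOp r l ^ N = 0 := by
  have h : N.factorial • koszulOp r l ^ N = 0 := by
    rw [factorial_smul_koszulOp_pow r hr]
    refine Finset.sum_eq_zero fun v _ => ?_
    by_cases hv : Function.Injective v
    · rw [hl v hv]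
      refine LinearMap.ext fun f => funext fun S => ?_
      simp only [Module.End.mul_apply]
      have : (0 : Module.End R B).compLeft (Finset (Fin n)) f = 0 := rfl
      rw [this, map_zero]; rfl
    · rw [(anticomm_prod_perm (contr R B r) (contr_mul_self r) (contr_anticomm r hr) v).1 hv,
        zero_mul]
  refine LinearMap.ext fun f => funext fun S => ?_
  refine hB _ ?_
  have := congrFun (LinearMap.congr_fun h f) S
  simpa using this

variable (R B n) in
/-- Functions supported on the sets with `j` elements. -/
def cardSupp (j : ℕ) : Submodule R (Finset (Fin n) → B) where
  carrier := {f | ∀ S, S.card ≠ j → f S = 0}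
  add_mem' hf hg S hS := by simp [hf S hS, hg S hS]
  zero_mem' S _ := rfl
  smul_mem' a f hf S hS := by simp [hf S hS]

lemma single_mem_cardSupp {T : Finset (Fin n)} {j : ℕ} (h : T.card = j) (b : B) :
    Pi.single T b ∈ cardSupp n R B j := by
  intro S hS
  rw [Pi.single_eq_of_ne]
  rintro rfl
  exact hS h

lemma koszulOp_mem (r : Fin n → Fin n → Prop) [DecidableRel r] (l : Fin n → Module.End R B)
    {j : ℕ} {f : Finset (Fin n) → B} (hf : f ∈ cardSupp n R B (j + 1)) :
    koszulOp r l f ∈ cardSupp n R B j := by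
  intro S hS
  rw [koszulOp_apply]
  refine Finset.sum_eq_zero fun s _ => ?_
  split_ifs with h
  · rfl
  · rw [hf _ (by rw [Finset.card_insert_of_notMem h]; omega), map_zero, smul_zero]

lemma koszulOp_pow_mem (r : Fin n → Fin n → Prop) [DecidableRel r] (l : Fin n → Module.End R B)
    {i j : ℕ} {f : Finset (Fin n) → B} (hf : f ∈ cardSupp n R B (j + i)) :
    (koszulOp r l ^ i) f ∈ cardSupp n R B j := by
  induction i generalizing f with
  | zero => simpa using hf
  | succ i ih =>
    rw [pow_succ, Module.End.mul_apply]
    exact ih (koszulOp_mem r l hf)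

end Contraction

/-! ### Koszul complexes of modules with a basis of words -/

section LeadingTerms

variable {n : ℕ} {R B M : Type*} [Ring R] [AddCommGroup B] [Module R B] [AddCommGroup M]

/-- The operator removing letters on the left. -/
abbrev leftOp (l : Fin n → Module.End R B) : Module.End R (Finset (Fin n) → B) :=
  koszulOp (· < ·) l

/-- The operator removing letters on the right. -/
abbrev rightOp (l : Fin n → Module.End R B) : Module.End R (Finset (Fin n) → B) :=
  koszulOp (· > ·) l

/-- The degree of the `i`-th differential of the Koszul complex. -/
def stepLen (N i : ℕ) : ℕ := if Even i then 1 else N - 1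

lemma jump_succ {N : ℕ} (hN : 1 ≤ N) (i : ℕ) : jump N (i + 1) = jump N i + stepLen N i := by
  unfold jump stepLen
  rcases Nat.even_or_odd' i with ⟨q, rfl | rfl⟩
  · have h1 : (2 * q + 1) / 2 = q := by omega
    have h2 : 2 * q / 2 = q := by omega
    simp [h1, h2]
  · have h1 : (2 * q + 1 + 1) / 2 = q + 1 := by omega
    have h2 : (2 * q + 1) / 2 = q := by omega
    have h3 : (2 * q + 1 + 1) % 2 = 0 := by omega
    have h4 : (2 * q + 1) % 2 = 1 := by omega
    have h5 : ¬ Even (2 * q + 1) := by simp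
    rw [h1, h2, h3, h4, if_neg h5, add_mul]
    omega

/-- The differential of the Koszul complex from degree `i + 1` to degree `i`. -/
def koszulDiff (N : ℕ) (l ρ : Fin n → Module.End R B) (i : ℕ) :
    Module.End R (Finset (Fin n) → B) :=
  if Even i then leftOp l - rightOp ρ
  else ∑ a ∈ Finset.range N, leftOp l ^ a * rightOp ρ ^ (N - 1 - a)

lemma koszulDiff_mem {N : ℕ} (hN : 1 ≤ N) (l ρ : Fin n → Module.End R B) (i : ℕ)
    {f : Finset (Fin n) → B} (hf : f ∈ cardSupp n R B (jump N (i + 1))) :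
    koszulDiff N l ρ i f ∈ cardSupp n R B (jump N i) := by
  rw [jump_succ hN] at hf
  unfold stepLen at hf
  unfold koszulDiff
  split_ifs with h
  · rw [if_pos h] at hf
    exact Submodule.sub_mem _ (koszulOp_mem _ _ hf) (koszulOp_mem _ _ hf)
  · rw [if_neg h] at hf
    rw [LinearMap.sum_apply]
    refine Submodule.sum_mem _ fun a ha => ?_
    rw [Finset.mem_range] at ha
    rw [Module.End.mul_apply]
    refine koszulOp_pow_mem _ _ (koszulOp_pow_mem _ _ ?_)
    rw [add_assoc]
    convert hf using 2
    omega

lemma leftOp_rightOp_commute {l ρ : Fin n → Module.End R B}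
    (h : ∀ s t, Commute (l s) (ρ t)) : Commute (leftOp l) (rightOp ρ) :=
  koszulOp_commute _ _ (fun _ _ => Iff.rfl) l ρ h

/-- Since `D = leftOp l` and `E = rightOp ρ` commute, `(D - E) * ∑ D ^ a * E ^ (N - 1 - a) = D ^ N -
E ^ N`, in either order of the factors. -/
lemma koszulDiff_mul {N : ℕ} {l ρ : Fin n → Module.End R B}
    (h : ∀ s t, Commute (l s) (ρ t)) (hl : leftOp l ^ N = 0) (hρ : rightOp ρ ^ N = 0) (i : ℕ) :
    koszulDiff N l ρ i * koszulDiff N l ρ (i + 1) = 0 := by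
  have hc := leftOp_rightOp_commute h
  unfold koszulDiff
  by_cases hi : Even i
  · rw [if_pos hi, if_neg (by simpa [Nat.even_add_one] using hi), hc.mul_geom_sum₂, hl, hρ, sub_zero]
  · rw [if_neg hi, if_pos (by simpa [Nat.even_add_one] using hi), hc.geom_sum₂_mul, hl, hρ, sub_zero]

/-- The subgroup generated by the monomials whose word is less than `u`. -/
def lowMono (β : List (Fin n) → M →+ B) (u : List (Fin n)) :
    AddSubgroup (Finset (Fin n) → B) :=
  AddSubgroup.closure {f | ∃ w S m, wordKey (w ++ descList S) < wordKey u ∧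
    f = Pi.single S (β w m)}

lemma single_mem_lowMono {β : List (Fin n) → M →+ B} {u w : List (Fin n)} {S : Finset (Fin n)}
    (h : wordKey (w ++ descList S) < wordKey u) (m : M) :
    Pi.single S (β w m) ∈ lowMono β u :=
  AddSubgroup.subset_closure ⟨w, S, m, h, rfl⟩

lemma lowMono_mono (β : List (Fin n) → M →+ B) {u v : List (Fin n)}
    (h : wordKey u ≤ wordKey v) : lowMono β u ≤ lowMono β v := by
  refine AddSubgroup.closure_mono ?_
  rintro f ⟨w, S, m, hw, rfl⟩
  exact ⟨w, S, m, hw.trans_le h, rfl⟩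

/-- Taking out a letter `s` other than the largest letter `a` puts `s < a` in the place just after
`w`, so the word drops. Thus only the largest letter contributes to the leading term of `leftOp`. -/
lemma wordKey_erase_lt (w : List (Fin n)) {a s : Fin n} {c : List (Fin n)}
    (hc : Descending (a :: c)) (hs : s ∈ c) :
    wordKey (w ++ [s] ++ descList ((a :: c).toFinset.erase s)) < wordKey (w ++ a :: c) := by
  rw [List.append_assoc]
  refine wordKey_append_left_lt w ?_
  refine wordKey_cons_lt (v := c) (u := descList ((a :: c).toFinset.erase s))
    ((List.pairwise_cons.1 hc).1 s hs) ?_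
  rw [length_descList, Finset.card_erase_of_mem (by simp [hs]), hc.card_toFinset]
  simp

lemma erase_toFinset_cons {a : Fin n} {c : List (Fin n)} (hc : Descending (a :: c)) :
    (a :: c).toFinset.erase a = c.toFinset := by
  rw [List.toFinset_cons, Finset.erase_insert]
  simpa using hc.nodup.notMem

lemma wordKey_erase_le (w : List (Fin n)) {s : Fin n} {T : Finset (Fin n)} (hs : s ∈ T) :
    wordKey (w ++ [s] ++ descList (T.erase s)) ≤ wordKey (w ++ descList T) := by
  have hd := descending_descList T
  have hT := toFinset_descList T
  generalize descList T = c at hd hT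
  subst hT
  cases c with
  | nil => simp at hs
  | cons a c =>
    by_cases h : s = a
    · subst h
      rw [erase_toFinset_cons hd, descList_toFinset (List.pairwise_cons.1 hd).2]
      simp
    · exact (wordKey_erase_lt w hd (by simpa [h] using hs)).le

variable {l ρ : Fin n → Module.End R B} {β : List (Fin n) → M →+ B}

lemma leftOp_mem_lowMono (hl : ∀ s w m, l s (β w m) = β (w ++ [s]) m) {u : List (Fin n)}
    {f : Finset (Fin n) → B} (hf : f ∈ lowMono β u) : leftOp l f ∈ lowMono β u := by
  have : lowMono β u ≤ (lowMono β u).comap (leftOp l).toAddMonoidHom := by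
    refine (AddSubgroup.closure_le _).2 ?_
    rintro f ⟨w, S, m, hw, rfl⟩
    change leftOp l (Pi.single S (β w m)) ∈ lowMono β u
    rw [leftOp, koszulOp_single]
    refine AddSubgroup.sum_mem _ fun s hs => AddSubgroup.zsmul_mem _ ?_ _
    rw [hl]
    exact single_mem_lowMono ((wordKey_erase_le w hs).trans_lt hw) m
  exact this hf

/-- The removed letter goes into the coefficient and leaves `w` unchanged, so the total word gets
shorter: `rightOp` never affects leading terms. -/
lemma rightOp_single_mem_lowMono {y : Fin n → M → M} (hρ : ∀ s w m, ρ s (β w m) = β w (y s m))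
    (w : List (Fin n)) (S : Finset (Fin n)) (m : M) :
    rightOp ρ (Pi.single S (β w m)) ∈ lowMono β (w ++ descList S) := by
  rw [rightOp, koszulOp_single]
  refine AddSubgroup.sum_mem _ fun s hs => AddSubgroup.zsmul_mem _ ?_ _
  rw [hρ]
  refine single_mem_lowMono (wordKey_lt_of_length_lt ?_) _
  have := Finset.card_pos.2 ⟨s, hs⟩
  simp only [List.length_append, length_descList, Finset.card_erase_of_mem hs]
  omega

lemma rightOp_mem_lowMono {y : Fin n → M → M} (hρ : ∀ s w m, ρ s (β w m) = β w (y s m))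
    {u : List (Fin n)} {f : Finset (Fin n) → B} (hf : f ∈ lowMono β u) :
    rightOp ρ f ∈ lowMono β u := by
  have : lowMono β u ≤ (lowMono β u).comap (rightOp ρ).toAddMonoidHom := by
    refine (AddSubgroup.closure_le _).2 ?_
    rintro f ⟨w, S, m, hw, rfl⟩
    exact lowMono_mono β hw.le (rightOp_single_mem_lowMono hρ w S m)
  exact this hf

lemma pow_mem_lowMono {E : Module.End R (Finset (Fin n) → B)} {u : List (Fin n)}
    (hE : ∀ f ∈ lowMono β u, E f ∈ lowMono β u) (j : ℕ) :
    ∀ f ∈ lowMono β u, (E ^ j) f ∈ lowMono β u := by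
  induction j with
  | zero => simp
  | succ j ih =>
    intro f hf
    rw [pow_succ, Module.End.mul_apply]
    exact ih _ (hE _ hf)

/-- The leading term of a power of `leftOp`. -/
lemma leftOp_pow_single (hl : ∀ s w m, l s (β w m) = β (w ++ [s]) m) (w p c : List (Fin n))
    (m : M) (hpc : Descending (p ++ c)) :
    (leftOp l ^ p.length) (Pi.single (p ++ c).toFinset (β w m)) -
      Pi.single c.toFinset (β (w ++ p) m) ∈ lowMono β (w ++ (p ++ c)) := by
  induction p generalizing w with
  | nil => simp
  | cons a p ih =>
    rw [List.cons_append] at hpc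
    have hd : Descending (p ++ c) := (List.pairwise_cons.1 hpc).2
    have h1 : leftOp l (Pi.single (a :: p ++ c).toFinset (β w m)) -
        Pi.single (p ++ c).toFinset (β (w ++ [a]) m) ∈ lowMono β (w ++ (a :: p ++ c)) := by
      rw [leftOp, koszulOp_single, List.cons_append,
        ← Finset.add_sum_erase _ _ (show a ∈ (a :: (p ++ c)).toFinset by simp),
        erase_toFinset_cons hpc]
      -- The largest letter moves past nothing, so the leading coefficient is exactly `1`.
      have hs : moveSign (· < ·) a (p ++ c).toFinset = 1 := by
        unfold moveSign
        rw [Finset.filter_eq_empty_iff.2, Finset.card_empty, pow_zero]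
        intro x hx
        exact not_lt_of_gt ((List.pairwise_cons.1 hpc).1 x (by simpa using hx))
      rw [hs, one_smul, hl, add_sub_cancel_left]
      refine AddSubgroup.sum_mem _ fun s hs => AddSubgroup.zsmul_mem _ ?_ _
      rw [hl]
      exact single_mem_lowMono (wordKey_erase_lt w hpc (by simpa using hs)) m
    have h2 := pow_mem_lowMono (fun f hf => leftOp_mem_lowMono hl hf) p.length _ h1
    have h3 := ih (w ++ [a]) hd
    rw [map_sub] at h2
    have h4 := AddSubgroup.add_mem _ h2 (by simpa using h3)
    rw [List.length_cons, pow_succ, Module.End.mul_apply]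
    simpa using h4

/-- The leading term of the Koszul differential. -/
lemma koszulDiff_single {N : ℕ} (hN : 1 ≤ N) {y : Fin n → M → M}
    (hl : ∀ s w m, l s (β w m) = β (w ++ [s]) m) (hρ : ∀ s w m, ρ s (β w m) = β w (y s m))
    (i : ℕ) (w p c : List (Fin n)) (m : M) (hp : p.length = stepLen N i)
    (hpc : Descending (p ++ c)) :
    koszulDiff N l ρ i (Pi.single (p ++ c).toFinset (β w m)) -
      Pi.single c.toFinset (β (w ++ p) m) ∈ lowMono β (w ++ (p ++ c)) := by
  have h1 := leftOp_pow_single hl w p c m hpc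
  have h2 := rightOp_single_mem_lowMono hρ w (p ++ c).toFinset m
  rw [descList_toFinset hpc] at h2
  rw [hp] at h1
  unfold stepLen at h1
  unfold koszulDiff
  split_ifs with h
  · rw [if_pos h, pow_one] at h1
    rw [LinearMap.sub_apply, sub_right_comm]
    exact AddSubgroup.sub_mem _ h1 h2
  · rw [if_neg h] at h1
    obtain ⟨N, rfl⟩ : ∃ k, N = k + 1 := ⟨N - 1, by omega⟩
    -- The last summand is the pure power of `leftOp`; every other summand contains a factor
    -- `rightOp` and is of lower order.
    rw [Finset.sum_range_succ, LinearMap.add_apply, add_sub_assoc]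
    refine AddSubgroup.add_mem _ ?_ (by simpa using h1)
    rw [LinearMap.sum_apply]
    refine AddSubgroup.sum_mem _ fun a ha => ?_
    rw [Finset.mem_range] at ha
    obtain ⟨b, hb⟩ : ∃ b, N + 1 - 1 - a = b + 1 := ⟨N - a - 1, by omega⟩
    rw [hb, Module.End.mul_apply, pow_succ, Module.End.mul_apply]
    exact pow_mem_lowMono (fun f hf => leftOp_mem_lowMono hl hf) _ _
      (pow_mem_lowMono (fun f hf => rightOp_mem_lowMono hρ hf) _ _ h2)

lemma koszulDiff_mem_lowMono {N : ℕ} {y : Fin n → M → M}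
    (hl : ∀ s w m, l s (β w m) = β (w ++ [s]) m) (hρ : ∀ s w m, ρ s (β w m) = β w (y s m))
    (i : ℕ) {u : List (Fin n)} {f : Finset (Fin n) → B} (hf : f ∈ lowMono β u) :
    koszulDiff N l ρ i f ∈ lowMono β u := by
  unfold koszulDiff
  split_ifs with h
  · exact AddSubgroup.sub_mem _ (leftOp_mem_lowMono hl hf) (rightOp_mem_lowMono hρ hf)
  · rw [LinearMap.sum_apply]
    refine AddSubgroup.sum_mem _ fun a ha => ?_
    exact pow_mem_lowMono (fun f hf => leftOp_mem_lowMono hl hf) _ _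
      (pow_mem_lowMono (fun f hf => rightOp_mem_lowMono hρ hf) _ _ hf)

end LeadingTerms

/-! ### Exactness by comparison of leading terms -/

section Exactness

variable {n : ℕ}

/-- A group `B` whose elements are combinations of irreducible words with coefficients in `M`,
with two commuting families of operators: `l s` appends the letter `s` to a word, and `ρ s` acts
on the coefficients. -/
structure WordModule (n N : ℕ) (R B M : Type*) [Ring R] [AddCommGroup B] [Module R B]
    [AddCommGroup M] where
  l : Fin n → Module.End R B
  ρ : Fin n → Module.End R B
  comm : ∀ s t, Commute (l s) (ρ t)
  left_pow : leftOp l ^ N = 0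
  right_pow : rightOp ρ ^ N = 0
  β : List (Fin n) → M →+ B
  y : Fin n → M → M
  l_β : ∀ s w m, l s (β w m) = β (w ++ [s]) m
  ρ_β : ∀ s w m, ρ s (β w m) = β w (y s m)
  coord : B →+ ({w : List (Fin n) // ¬ Reducible N w} →₀ M)
  expand : ∀ b, b = (coord b).sum fun w m => β w m
  coord_β_le : ∀ w m w', coord (β w m) w' ≠ 0 → wordKey w'.1 ≤ wordKey w
  coord_β_self : ∀ w m, coord (β w.1 m) w = m

namespace WordModule

variable {N : ℕ} {R B M : Type*} [Ring R] [AddCommGroup B] [Module R B]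
    [AddCommGroup M] (W : WordModule n N R B M)

/-- The Koszul differential. -/
def d (i : ℕ) : Module.End R (Finset (Fin n) → B) := koszulDiff N W.l W.ρ i

lemma d_d (i : ℕ) (f : Finset (Fin n) → B) : W.d i (W.d (i + 1) f) = 0 :=
  LinearMap.congr_fun (koszulDiff_mul W.comm W.left_pow W.right_pow i) f

/-- The words in a generator of `lowMono` may be reducible, but rewriting them in irreducible words
never raises the order (`coord_β_le`), so the bound passes to coordinates. -/
lemma coord_of_mem_lowMono {u : List (Fin n)} {f : Finset (Fin n) → B}
    (hf : f ∈ lowMono W.β u) (S : Finset (Fin n)) (w : {w : List (Fin n) // ¬ Reducible N w})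
    (h : W.coord (f S) w ≠ 0) : wordKey (w.1 ++ descList S) < wordKey u := by
  contrapose! h
  refine AddSubgroup.closure_induction (p := fun f _ => W.coord (f S) w = 0) ?_ ?_ ?_ ?_ hf
  · rintro f ⟨w', S', m, hw, rfl⟩
    by_cases e : S = S'
    · subst e
      rw [Pi.single_eq_same]
      by_contra h'
      exact absurd (hw.trans_le h) (wordKey_append_right_le _ (W.coord_β_le _ _ _ h')).not_gt
    · simp [e]
  · simp
  · intro f g _ _ hf hg
    simp [hf, hg]
  · intro f _ hf
    simp [hf]

lemma exists_max {f : Finset (Fin n) → B} (hf : f ≠ 0) :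
    ∃ S w, W.coord (f S) w ≠ 0 ∧ ∀ S' w', W.coord (f S') w' ≠ 0 →
      wordKey (w'.1 ++ descList S') ≤ wordKey (w.1 ++ descList S) := by
  let s : Finset (Σ _ : Finset (Fin n), {w : List (Fin n) // ¬ Reducible N w}) :=
    Finset.univ.sigma fun S => (W.coord (f S)).support
  have hs : s.Nonempty := by
    obtain ⟨S, hS⟩ := Function.ne_iff.1 hf
    have : W.coord (f S) ≠ 0 := fun h => hS (by rw [W.expand (f S), h]; simp)
    obtain ⟨w, hw⟩ := Finsupp.support_nonempty_iff.2 this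
    exact ⟨⟨S, w⟩, by simpa [s] using hw⟩
  obtain ⟨⟨S, w⟩, h1, h2⟩ := s.exists_max_image (fun p => wordKey (p.2.1 ++ descList p.1)) hs
  refine ⟨S, w, by simpa [s] using h1, fun S' w' h => ?_⟩
  exact h2 ⟨S', w'⟩ (by simpa [s] using h)

/-- Because all sets in the support have `j` elements, the concatenation `w ++ descList S`
determines both `w` and `S`. Hence every monomial other than the leading one is strictly smaller,
not merely at most as large. -/
lemma sub_single_mem_lowMono {j : ℕ} {f : Finset (Fin n) → B} (hf : f ∈ cardSupp n R B j)
    {S : Finset (Fin n)} (hS : S.card = j) {w : {w : List (Fin n) // ¬ Reducible N w}}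
    (h : ∀ S' w', W.coord (f S') w' ≠ 0 →
      wordKey (w'.1 ++ descList S') ≤ wordKey (w.1 ++ descList S)) :
    f - Pi.single S (W.β w.1 (W.coord (f S) w)) ∈ lowMono W.β (w.1 ++ descList S) := by
  have h1 : ∀ S' w', (S' ≠ S ∨ w' ≠ w) → Pi.single S' (W.β w'.1 (W.coord (f S') w')) ∈
      lowMono W.β (w.1 ++ descList S) := by
    intro S' w' hne
    by_cases h0 : W.coord (f S') w' = 0
    · simp [h0, zero_mem]
    · refine single_mem_lowMono (lt_of_le_of_ne (h S' w' h0) fun e => ?_) _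
      have e := wordKey_injective e
      have hS' : S'.card = j := by
        by_contra hc
        exact h0 (by simp [hf S' hc])
      obtain ⟨e1, e2⟩ := List.append_inj' e (by simp [hS, hS'])
      have e3 := congrArg List.toFinset e2
      simp only [toFinset_descList] at e3
      rcases hne with hne | hne
      · exact hne e3
      · exact hne (Subtype.ext e1)
  have h2 : ∀ S', f S' = ∑ w' ∈ insert w (W.coord (f S')).support,
      W.β w'.1 (W.coord (f S') w') := by
    intro S'
    conv_lhs => rw [W.expand (f S')]
    rw [Finsupp.sum]
    refine Finset.sum_subset (Finset.subset_insert _ _) fun x _ hx => ?_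
    rw [Finsupp.notMem_support_iff.1 hx, map_zero]
  have h3 : ∀ (S' : Finset (Fin n)) (b : B), Pi.single S' b =
      AddMonoidHom.single (fun _ => B) S' b := fun _ _ => rfl
  have h4 : f = ∑ S', ∑ w' ∈ insert w (W.coord (f S')).support,
      Pi.single S' (W.β w'.1 (W.coord (f S') w')) := by
    conv_lhs => rw [← Finset.univ_sum_single f]
    refine Finset.sum_congr rfl fun S' _ => ?_
    rw [h3]
    conv_lhs => rw [h2 S']
    rw [map_sum]
    rfl
  have h5 : f - Pi.single S (W.β w.1 (W.coord (f S) w)) =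
      ∑ w' ∈ (W.coord (f S)).support.erase w, Pi.single S (W.β w'.1 (W.coord (f S) w')) +
      ∑ S' ∈ Finset.univ.erase S, ∑ w' ∈ insert w (W.coord (f S')).support,
        Pi.single S' (W.β w'.1 (W.coord (f S') w')) := by
    rw [sub_eq_iff_eq_add]
    conv_lhs => rw [h4]
    rw [← Finset.add_sum_erase _ _ (Finset.mem_univ S),
      ← Finset.add_sum_erase _ _ (Finset.mem_insert_self w _), Finset.erase_insert_eq_erase]
    abel
  rw [h5]
  refine AddSubgroup.add_mem _ (AddSubgroup.sum_mem _ fun w' hw' => ?_)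
    (AddSubgroup.sum_mem _ fun S' hS' => AddSubgroup.sum_mem _ fun w' hw' => ?_)
  · exact h1 _ _ (Or.inr (Finset.ne_of_mem_erase hw'))
  · exact h1 _ _ (Or.inl (Finset.ne_of_mem_erase hS'))

/-- If the leading terms of all elements of a subgroup `K` of cycles are leading terms of
boundaries, then all elements of `K` are boundaries. -/
lemma exists_preimage (hN : 1 ≤ N) (i : ℕ) (K : AddSubgroup (Finset (Fin n) → B))
    (hK : ∀ g ∈ cardSupp n R B (jump N (i + 1)), W.d i g ∈ K)
    (H : ∀ f ∈ cardSupp n R B (jump N i), f ∈ K → ∀ S w, W.coord (f S) w ≠ 0 →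
      f - Pi.single S (W.β w.1 (W.coord (f S) w)) ∈ lowMono W.β (w.1 ++ descList S) →
      S.card = jump N i →
      ∃ w' t, w.1 = w' ++ t ∧ t.length = stepLen N i ∧ Descending (t ++ descList S)) :
    ∀ f ∈ cardSupp n R B (jump N i), f ∈ K →
      ∃ g ∈ cardSupp n R B (jump N (i + 1)), W.d i g = f := by
  have key : ∀ u : List (Fin n), ∀ f ∈ cardSupp n R B (jump N i), f ∈ K → ∀ S w,
      u = w.1 ++ descList S → W.coord (f S) w ≠ 0 → (∀ S' w', W.coord (f S') w' ≠ 0 →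
      wordKey (w'.1 ++ descList S') ≤ wordKey (w.1 ++ descList S)) →
      ∃ g ∈ cardSupp n R B (jump N (i + 1)), W.d i g = f := by
    intro u
    induction u using wordKey_lt_wf.induction with
    | _ u ih =>
    intro f hf hfK S w hu h0 hmax
    have hS : S.card = jump N i := by
      by_contra hc
      exact h0 (by simp [hf S hc])
    have hlow := W.sub_single_mem_lowMono hf hS hmax
    obtain ⟨w', t, hw, ht, hd⟩ := H f hf hfK S w h0 hlow hS
    set m := W.coord (f S) w
    have h1 := koszulDiff_single hN W.l_β W.ρ_β i w' t (descList S) m ht hd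
    rw [toFinset_descList, ← hw, ← List.append_assoc, ← hw] at h1
    set g : Finset (Fin n) → B := Pi.single (t ++ descList S).toFinset (W.β w' m)
    have hg : g ∈ cardSupp n R B (jump N (i + 1)) := by
      refine single_mem_cardSupp ?_ _
      rw [hd.card_toFinset, List.length_append, length_descList, ht, hS, jump_succ hN, add_comm]
    -- `f` and `d g` have the same leading monomial, so their difference has a smaller leading word
    -- and the induction hypothesis applies.
    have h2 : f - W.d i g ∈ lowMono W.β (w.1 ++ descList S) := by
      have := AddSubgroup.sub_mem _ hlow h1
      rwa [sub_sub_sub_cancel_right] at this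
    have h3 : f - W.d i g ∈ cardSupp n R B (jump N i) :=
      Submodule.sub_mem _ hf (koszulDiff_mem hN _ _ _ hg)
    have h4 : f - W.d i g ∈ K := AddSubgroup.sub_mem _ hfK (hK g hg)
    by_cases hz : f - W.d i g = 0
    · exact ⟨g, hg, (sub_eq_zero.1 hz).symm⟩
    · obtain ⟨S1, w1, h5, h6⟩ := W.exists_max hz
      obtain ⟨g', hg', e⟩ := ih (w1.1 ++ descList S1)
        (hu ▸ W.coord_of_mem_lowMono h2 S1 w1 h5) _ h3 h4 S1 w1 rfl h5 h6
      refine ⟨g' + g, Submodule.add_mem _ hg' hg, ?_⟩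
      rw [map_add, e, sub_add_cancel]
  intro f hf hfK
  by_cases hz : f = 0
  · exact ⟨0, Submodule.zero_mem _, by simp [hz]⟩
  · obtain ⟨S, w, h1, h2⟩ := W.exists_max hz
    exact key _ f hf hfK S w rfl h1 h2

lemma stepLen_lt (hN : 2 ≤ N) (i : ℕ) : stepLen N i < N := by
  unfold stepLen; split_ifs <;> omega

lemma stepLen_succ (hN : 2 ≤ N) (i : ℕ) : stepLen N (i + 1) = N - stepLen N i := by
  unfold stepLen
  by_cases h : Even i
  · rw [if_pos h, if_neg (by simpa [Nat.even_add_one] using h)]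
  · rw [if_neg h, if_pos (by simpa [Nat.even_add_one] using h)]; omega

/-- Exactness of the Koszul complex in positive degrees. -/
theorem exact_succ (hN : 2 ≤ N) (i : ℕ) {f : Finset (Fin n) → B}
    (hf : f ∈ cardSupp n R B (jump N (i + 1))) (h0 : W.d i f = 0) :
    ∃ g ∈ cardSupp n R B (jump N (i + 2)), W.d (i + 1) g = f := by
  refine W.exists_preimage (by omega) (i + 1) (W.d i).toAddMonoidHom.ker
    (fun g _ => W.d_d i g) ?_ f hf h0
  intro f hf hfK S w hc hlow hS
  have hle : stepLen N i ≤ (descList S).length := by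
    rw [length_descList, hS, jump_succ (by omega)]; omega
  obtain ⟨p, c, hpc, hp⟩ : ∃ p c, descList S = p ++ c ∧ p.length = stepLen N i :=
    ⟨(descList S).take (stepLen N i), (descList S).drop (stepLen N i),
      (List.take_append_drop _ _).symm, by simpa using hle⟩
  have hd : Descending (p ++ c) := hpc ▸ descending_descList S
  have hSpc : S = (p ++ c).toFinset := by rw [← hpc, toFinset_descList]
  -- Consecutive step lengths add up to `N`, so the suffix length required here is the one produced
  -- by `exists_descending_suffix`.
  rw [stepLen_succ hN, hpc]
  refine exists_descending_suffix (stepLen_lt hN i) hp hd w.2 ?_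
  -- Were `w ++ p` irreducible, `(w ++ p) ⊗ c` with its nonzero coefficient would survive as leading
  -- term of the differential of `f`, which is zero.
  by_contra hred
  set m := W.coord (f S) w
  have h1 := koszulDiff_single (by omega) W.l_β W.ρ_β i w.1 p c m hp hd
  rw [← hSpc, ← hpc] at h1
  have h2 := koszulDiff_mem_lowMono (N := N) W.l_β W.ρ_β i hlow
  have h3 : koszulDiff N W.l W.ρ i f = 0 := hfK
  rw [map_sub, h3] at h2
  have h4 := AddSubgroup.add_mem _ h1 h2
  have h5 : koszulDiff N W.l W.ρ i (Pi.single S (W.β w.1 m)) -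
      Pi.single c.toFinset (W.β (w.1 ++ p) m) +
      (0 - koszulDiff N W.l W.ρ i (Pi.single S (W.β w.1 m))) =
      - Pi.single c.toFinset (W.β (w.1 ++ p) m) := by abel
  rw [h5] at h4
  have h6 := W.coord_of_mem_lowMono h4 c.toFinset ⟨w.1 ++ p, hred⟩ (by
    rw [Pi.neg_apply, Pi.single_eq_same, map_neg, Finsupp.neg_apply,
      W.coord_β_self ⟨w.1 ++ p, hred⟩]
    exact neg_ne_zero.2 hc)
  rw [descList_toFinset (List.pairwise_append.1 hd).2.1, hpc, List.append_assoc] at h6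
  exact lt_irrefl _ h6

lemma aug_d_zero {Z : Type*} [AddCommGroup Z] (μ : B →+ Z) (hμ : ∀ s b, μ (W.l s b) = μ (W.ρ s b))
    (g : Finset (Fin n) → B) : μ (W.d 0 g ∅) = 0 := by
  simp [d, koszulDiff, koszulOp_apply, moveSign, hμ]

/-- Exactness of the augmented Koszul complex in degree zero. -/
theorem exact_zero (hN : 1 ≤ N) {Z : Type*} [AddCommGroup Z] (μ : B →+ Z)
    (hμ : ∀ s b, μ (W.l s b) = μ (W.ρ s b)) (hinj : ∀ m, μ (W.β [] m) = 0 → m = 0)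
    {f : Finset (Fin n) → B} (hf : f ∈ cardSupp n R B 0) (h0 : μ (f ∅) = 0) :
    ∃ g ∈ cardSupp n R B 1, W.d 0 g = f := by
  have hj0 : jump N 0 = 0 := by simp [jump]
  have hj1 : jump N 1 = 1 := by simp [jump]
  have := W.exists_preimage hN 0 (μ.comp (Pi.evalAddMonoidHom (fun _ : Finset (Fin n) => B) ∅)).ker
    (fun g _ => W.aug_d_zero μ hμ g) ?_ f (by rwa [hj0]) h0
  · simpa [hj1] using this
  intro f hf hfK S w hc hlow hS
  rw [hj0, Finset.card_eq_zero] at hS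
  subst hS
  rcases List.eq_nil_or_concat' w.1 with hw | ⟨w', s, hw⟩
  · exfalso
    -- Nothing lies below the empty word, so `f` equals its leading term and `hinj` kills the
    -- coefficient.
    have hbot : lowMono W.β ([] : List (Fin n)) = ⊥ := by
      rw [lowMono, AddSubgroup.closure_eq_bot_iff]
      rintro f ⟨w, S, m, h, rfl⟩
      simp [wordKey_lt_iff] at h
    have hd : descList (∅ : Finset (Fin n)) = [] := by
      rw [← List.length_eq_zero_iff]; simp
    rw [hw, hd, List.append_nil, hbot, AddSubgroup.mem_bot, sub_eq_zero] at hlow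
    have h1 : μ (f ∅) = 0 := hfK
    set m := W.coord (f ∅) w
    rw [hlow, Pi.single_eq_same] at h1
    exact hc (hinj _ h1)
  · refine ⟨w', [s], hw, by simp [stepLen], ?_⟩
    have hd : descList (∅ : Finset (Fin n)) = [] := by
      rw [← List.length_eq_zero_iff]; simp
    simp [hd]

end WordModule

end Exactness

/-! ### Antisymmetrized products -/

section Antisymm

variable {n : ℕ}

lemma exists_strictMono_comp_perm {N : ℕ} {v : Fin N → Fin n} (hv : Function.Injective v) :
    ∃ (i : Fin N → Fin n) (τ : Equiv.Perm (Fin N)), StrictMono i ∧ v = i ∘ τ := by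
  refine ⟨v ∘ Tuple.sort v, (Tuple.sort v)⁻¹, ?_, ?_⟩
  · exact (Tuple.monotone_sort v).strictMono_of_injective
      (hv.comp (Tuple.sort v).injective)
  · ext j
    simp

lemma List.reverse_ofFn_eq {α : Type*} {N : ℕ} (v : Fin N → α) :
    (List.ofFn v).reverse = List.ofFn (v ∘ Fin.rev) := by
  refine List.ext_getElem (by simp) fun j h1 h2 => ?_
  simp only [List.getElem_reverse, List.getElem_ofFn, Function.comp_apply, List.length_ofFn]
  congr 1
  ext
  simp [Fin.val_rev]
  omega

lemma antisymmProd_comp_perm {Q : Type*} [Ring Q] (x : Fin n → Q) {N : ℕ} (v : Fin N → Fin n)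
    (τ : Equiv.Perm (Fin N)) :
    antisymmProd x (v ∘ τ) = (Equiv.Perm.sign τ : ℤ) • antisymmProd x v := by
  unfold antisymmProd
  rw [Finset.smul_sum]
  refine Fintype.sum_equiv (Equiv.mulLeft τ) _ _ fun σ => ?_
  rw [smul_smul]
  simp only [Function.comp_apply, Equiv.coe_mulLeft, Equiv.Perm.mul_apply, Equiv.Perm.sign_mul]
  congr 1
  rw [Units.val_mul, ← mul_assoc, Int.units_coe_mul_self, one_mul]

lemma antisymmetrizer_eq (k : Type*) [Field k] {N : ℕ} (v : Fin N → Fin n) :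
    antisymmetrizer k v = antisymmProd (FreeAlgebra.ι k) v := by
  simp [antisymmetrizer, antisymmProd]

lemma map_antisymmProd {Q Q' F : Type*} [Ring Q] [Ring Q'] [FunLike F Q Q'] [RingHomClass F Q Q']
    (f : F) (x : Fin n → Q) {N : ℕ} (v : Fin N → Fin n) :
    f (antisymmProd x v) = antisymmProd (fun s => f (x s)) v := by
  simp only [antisymmProd, map_sum, map_zsmul, map_list_prod, List.map_ofFn, Function.comp_def]

/-- The product of the letters of a word. -/
def wordProd {Q : Type*} [Monoid Q] (x : Fin n → Q) (w : List (Fin n)) : Q := (w.map x).prod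

@[simp] lemma wordProd_nil {Q : Type*} [Monoid Q] (x : Fin n → Q) : wordProd x [] = 1 := rfl

lemma wordProd_append {Q : Type*} [Monoid Q] (x : Fin n → Q) (w w' : List (Fin n)) :
    wordProd x (w ++ w') = wordProd x w * wordProd x w' := by simp [wordProd]

@[simp] lemma wordProd_singleton {Q : Type*} [Monoid Q] (x : Fin n → Q) (s : Fin n) :
    wordProd x [s] = x s := by simp [wordProd]

/-- Right multiplications on the left factor of a tensor product. -/
def tensorLeft (k : Type*) {Q : Type*} (M : Type*) [Field k] [Ring Q] [Algebra k Q]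
    [AddCommGroup M] [Module k M] (x : Fin n → Q) (s : Fin n) : Module.End Q (Q ⊗[k] M) :=
  AlgebraTensorModule.map (LinearMap.toSpanSingleton Q Q (x s)) LinearMap.id

section

variable {k Q M : Type*} [Field k] [Ring Q] [Algebra k Q] [AddCommGroup M] [Module k M]
  (x : Fin n → Q)

@[simp] lemma tensorLeft_tmul (s : Fin n) (a : Q) (m : M) :
    tensorLeft k M x s (a ⊗ₜ m) = (a * x s) ⊗ₜ m := by
  simp [tensorLeft]

lemma prod_tensorLeft (L : List (Fin n)) (a : Q) (m : M) :
    (L.map (tensorLeft k M x)).prod (a ⊗ₜ m) = (a * wordProd x L.reverse) ⊗ₜ m := by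
  induction L generalizing a with
  | nil => simp
  | cons s L ih =>
    rw [List.map_cons, List.prod_cons, Module.End.mul_apply, ih, tensorLeft_tmul,
      List.reverse_cons, wordProd_append, wordProd_singleton, mul_assoc]

/-- Right multiplications compose in the reverse order; reversing all factors contributes the sign
of `Fin.revPerm`. -/
lemma antisymmProd_tensorLeft {N : ℕ} (v : Fin N → Fin n) (a : Q) (m : M) :
    antisymmProd (tensorLeft k M x) v (a ⊗ₜ m) =
      (Equiv.Perm.sign (Fin.revPerm (n := N)) : ℤ) • ((a * antisymmProd x v) ⊗ₜ[k] m) := by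
  rw [antisymmProd, LinearMap.sum_apply, antisymmProd, Finset.mul_sum, TensorProduct.sum_tmul,
    Finset.smul_sum]
  refine Fintype.sum_equiv (Equiv.mulRight Fin.revPerm) _ _ fun σ => ?_
  have h : (List.ofFn fun j => tensorLeft k M x (v (σ j))) =
      (List.ofFn fun j => v (σ j)).map (tensorLeft k M x) := by
    rw [List.map_ofFn]; rfl
  rw [LinearMap.smul_apply, h, prod_tensorLeft, List.reverse_ofFn_eq, wordProd, List.map_ofFn,
    mul_smul_comm, ← TensorProduct.smul_tmul', smul_smul, Equiv.coe_mulRight, Equiv.Perm.sign_mul,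
    Units.val_mul, mul_left_comm, Int.units_coe_mul_self, mul_one]
  rfl

end

end Antisymm

/-! ### Relations in the free algebra -/

section Relation

variable {n : ℕ}

/-- Used at `T' = ∅`, where a nonzero contribution forces `L` to have `T` as its set of letters. -/
lemma contr_prod_single {R : Type*} (B : Type*) [Ring R] [AddCommGroup B] [Module R B]
    (r : Fin n → Fin n → Prop) [DecidableRel r] (L : List (Fin n)) (T : Finset (Fin n)) :
    ∃ (e : ℤ) (T' : Finset (Fin n)), (e = 0 ∨ T = T' ∪ L.toFinset) ∧
      ∀ b : B, (L.map (contr R B r)).prod (Pi.single T b) = e • Pi.single T' b := by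
  induction L with
  | nil => exact ⟨1, T, by simp, by simp⟩
  | cons s L ih =>
    obtain ⟨e, T', h, hb⟩ := ih
    by_cases hs : s ∈ T'
    · refine ⟨e * moveSign r s (T'.erase s), T'.erase s, ?_, fun b => ?_⟩
      · rcases h with h | h
        · left; rw [h, zero_mul]
        · right
          rw [h, List.toFinset_cons, Finset.union_insert, ← Finset.insert_union,
            Finset.insert_erase hs]
      · rw [List.map_cons, List.prod_cons, Module.End.mul_apply, hb, map_zsmul, contr_single,
          if_pos hs, smul_smul]
    · refine ⟨0, T', Or.inl rfl, fun b => ?_⟩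
      rw [List.map_cons, List.prod_cons, Module.End.mul_apply, hb, map_zsmul, contr_single,
          if_neg hs, smul_zero, zero_smul]

variable (k : Type*) [Field k]

/-- The free algebra tensored with itself. -/
abbrev FreeSq (k : Type*) [Field k] (n : ℕ) := FreeAlgebra k (Fin n) ⊗[k] FreeAlgebra k (Fin n)

/-- The letters of the free algebra, acting on the left tensor factor. -/
abbrev freeL (n : ℕ) : Fin n → Module.End (FreeAlgebra k (Fin n)) (FreeSq k n) :=
  tensorLeft k _ (FreeAlgebra.ι k)

/-- The letters of the free algebra, acting on the right tensor factor. -/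
def freeR (n : ℕ) (s : Fin n) : Module.End (FreeAlgebra k (Fin n)) (FreeSq k n) :=
  AlgebraTensorModule.map LinearMap.id (LinearMap.mulLeft k (FreeAlgebra.ι k s))

lemma freeR_tmul (s : Fin n) (a b : FreeAlgebra k (Fin n)) :
    freeR k n s (a ⊗ₜ b) = a ⊗ₜ (FreeAlgebra.ι k s * b) := by
  simp [freeR]

lemma freeL_freeR_commute (s t : Fin n) : Commute (freeL k n s) (freeR k n t) := by
  refine LinearMap.ext fun z => ?_
  induction z using TensorProduct.induction_on with
  | zero => simp
  | tmul a b => simp [freeR_tmul]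
  | add x y hx hy => rw [map_add, map_add, hx, hy]

/-- The multiplication of the free algebra. -/
abbrev freeMul (n : ℕ) : FreeSq k n →ₗ[k] FreeAlgebra k (Fin n) := LinearMap.mul' k _

/-- The antisymmetric relation attached to a finite set of letters, multiplied by the factors of
a tensor. -/
def relMul (N : ℕ) (S : Finset (Fin n)) (z : FreeSq k n) : FreeAlgebra k (Fin n) :=
  freeMul k n ((leftOp (freeL k n) ^ N) (Pi.single S z) ∅)

/-- The antisymmetric relation attached to a finite set of letters. -/
def rel (N : ℕ) (S : Finset (Fin n)) : FreeAlgebra k (Fin n) := relMul k N S (1 ⊗ₜ 1)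

lemma koszulOp_compLeft_commute {R B : Type*} [Ring R] [AddCommGroup B] [Module R B]
    (r : Fin n → Fin n → Prop) [DecidableRel r] (l : Fin n → Module.End R B)
    (g : Module.End R B) (h : ∀ s, Commute (l s) g) :
    Commute (koszulOp r l) (g.compLeft (Finset (Fin n))) := by
  refine Commute.sum_left _ _ _ fun s _ => ?_
  exact (contr_compLeft r s g).mul_left (h s).compLeft

lemma compLeft_single {R B : Type*} [Ring R] [AddCommGroup B] [Module R B]
    (g : Module.End R B) (T : Finset (Fin n)) (b : B) :
    g.compLeft (Finset (Fin n)) (Pi.single T b) = Pi.single T (g b) := by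
  ext S
  by_cases h : S = T
  · subst h; simp
  · simp [h]

/-- `leftOp` inserts letters between the two tensor factors, so it commutes with left multiplication
by `a` on the first and right multiplication by `b` on the second. -/
lemma relMul_tmul (N : ℕ) (S : Finset (Fin n)) (a b : FreeAlgebra k (Fin n)) :
    relMul k N S (a ⊗ₜ b) = a * rel k N S * b := by
  let g : Module.End (FreeAlgebra k (Fin n)) (FreeSq k n) :=
    AlgebraTensorModule.map LinearMap.id (LinearMap.mulRight k b)
  have hg : ∀ s, Commute (freeL k n s) g := by
    intro s
    refine LinearMap.ext fun z => ?_
    induction z using TensorProduct.induction_on with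
    | zero => simp
    | tmul a b => simp [g]
    | add x y hx hy => rw [map_add, map_add, hx, hy]
  have hc := (koszulOp_compLeft_commute (· < ·) (freeL k n) g hg).pow_left N
  have h1 : (Pi.single S (a ⊗ₜ b) : Finset (Fin n) → FreeSq k n) =
      g.compLeft _ (a • Pi.single S (1 ⊗ₜ 1)) := by
    rw [map_smul, compLeft_single, ← Pi.single_smul]
    simp [g, TensorProduct.smul_tmul']
  have hm : ∀ z, freeMul k n (g z) = freeMul k n z * b := by
    intro z
    induction z using TensorProduct.induction_on with
    | zero => simp
    | tmul a b => simp [g, mul_assoc]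
    | add x y hx hy => rw [map_add, map_add, map_add, hx, hy, add_mul]
  have hs : ∀ z, freeMul k n (a • z) = a * freeMul k n z := by
    intro z
    induction z using TensorProduct.induction_on with
    | zero => simp
    | tmul a b => simp [TensorProduct.smul_tmul', mul_assoc]
    | add x y hx hy => rw [smul_add, map_add, map_add, hx, hy, mul_add]
  have hc' := LinearMap.congr_fun hc.eq (a • Pi.single S (1 ⊗ₜ 1))
  rw [Module.End.mul_apply, Module.End.mul_apply] at hc'
  rw [relMul, h1, leftOp, hc', LinearMap.compLeft_apply, Function.comp_apply, hm, map_smul,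
    Pi.smul_apply, hs]
  rfl

/-- The two expansions of an antisymmetric relation of degree `N + 1`. -/
lemma sum_rel_eq (N : ℕ) (T : Finset (Fin n)) :
    ∑ s ∈ T, moveSign (· < ·) s (T.erase s) • (FreeAlgebra.ι k s * rel k N (T.erase s)) =
      ∑ s ∈ T, moveSign (· > ·) s (T.erase s) • (rel k N (T.erase s) * FreeAlgebra.ι k s) := by
  let f : Finset (Fin n) → FreeSq k n := Pi.single T (1 ⊗ₜ 1)
  let D := leftOp (freeL k n)
  let E := rightOp (freeR k n)
  have hDE : Commute (D ^ N) E := (leftOp_rightOp_commute (freeL_freeR_commute k)).pow_left N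
  have hμ : ∀ s z, freeMul k n (freeL k n s z) = freeMul k n (freeR k n s z) := by
    intro s z
    induction z using TensorProduct.induction_on with
    | zero => simp
    | tmul a b => simp [freeR_tmul, mul_assoc]
    | add x y hx hy => rw [map_add, map_add, map_add, map_add, hx, hy]
  have h0 : ∀ g : Finset (Fin n) → FreeSq k n, freeMul k n (D g ∅) = freeMul k n (E g ∅) := by
    intro g
    simp [D, E, koszulOp_apply, moveSign, hμ]
  -- After multiplying the tensor factors, `D` and `E` agree at `∅`. Applied to `D ^ N f`, and with
  -- `D ^ N` moved to the outside, this compares the expansions along the first and the last letter.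
  have h1 := h0 ((D ^ N) f)
  have h2 : E ((D ^ N) f) = (D ^ N) (E f) := (LinearMap.congr_fun hDE.eq f).symm
  have h3 : D ((D ^ N) f) = (D ^ N) (D f) := by
    rw [← Module.End.mul_apply, ← Module.End.mul_apply, ← pow_succ, ← pow_succ']
  have e1 : D f = ∑ s ∈ T, moveSign (· < ·) s (T.erase s) •
      Pi.single (T.erase s) (FreeAlgebra.ι k s ⊗ₜ 1) := by
    simp [D, f, koszulOp_single]
  have e2 : E f = ∑ s ∈ T, moveSign (· > ·) s (T.erase s) •
      Pi.single (T.erase s) (1 ⊗ₜ FreeAlgebra.ι k s) := by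
    simp [E, f, koszulOp_single, freeR_tmul]
  rw [h2, h3, e1, e2] at h1
  simp only [map_sum, map_zsmul, Finset.sum_apply, Pi.smul_apply] at h1
  have h4 : ∀ S z, freeMul k n ((D ^ N) (Pi.single S z) ∅) = relMul k N S z := fun _ _ => rfl
  simpa [h4, relMul_tmul] using h1

/-- The relation attached to a set is proportional to the antisymmetrizer. -/
lemma exists_smul_rel_eq [CharZero k] {N : ℕ} {i : Fin N → Fin n} (hi : StrictMono i) :
    ∃ t : k, rel k N (Finset.univ.image i) = t • antisymmetrizer k i := by
  have h := factorial_smul_koszulOp_pow (· < ·)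
    (fun s t hst => ⟨fun h => not_lt_of_gt h, fun h => lt_of_le_of_ne (not_lt.1 h) hst⟩)
    (freeL k n) N
  have h1 := congrArg (freeMul k n) (congrFun (LinearMap.congr_fun h
    (Pi.single (Finset.univ.image i) (1 ⊗ₜ 1))) ∅)
  have h2 : freeMul k n ((N.factorial • koszulOp (· < ·) (freeL k n) ^ N)
      (Pi.single (Finset.univ.image i) (1 ⊗ₜ 1)) ∅) = N.factorial • rel k N (Finset.univ.image i) := by
    rw [LinearMap.smul_apply, Pi.smul_apply, map_nsmul]
    rfl
  rw [h2, LinearMap.sum_apply, Finset.sum_apply, map_sum] at h1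
  suffices hz : N.factorial • rel k N (Finset.univ.image i) ∈ Submodule.span k {antisymmetrizer k i} by
    obtain ⟨t, ht⟩ := Submodule.mem_span_singleton.1 hz
    refine ⟨(N.factorial : k)⁻¹ * t, ?_⟩
    rw [mul_smul, ht, ← Nat.cast_smul_eq_nsmul k, smul_smul,
      inv_mul_cancel₀ (by exact_mod_cast N.factorial_ne_zero), one_smul]
  rw [h1]
  refine Submodule.sum_mem _ fun v _ => ?_
  rw [Module.End.mul_apply, compLeft_single, antisymmProd_tensorLeft]
  have hL : (List.ofFn fun j => contr (FreeAlgebra k (Fin n)) (FreeSq k n) (· < ·) (v j)) =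
      (List.ofFn v).map (contr (FreeAlgebra k (Fin n)) (FreeSq k n) (· < ·)) := by
    rw [List.map_ofFn]; rfl
  obtain ⟨e, T', he, hb⟩ := contr_prod_single (R := FreeAlgebra k (Fin n)) (FreeSq k n) (· < ·)
    (List.ofFn v) (Finset.univ.image i)
  rw [hL, hb, Pi.smul_apply, map_zsmul]
  rcases he with he | he
  · rw [he, zero_smul]
    exact Submodule.zero_mem _
  refine Submodule.smul_of_tower_mem _ e ?_
  -- Only `T' = ∅` is seen by evaluation at `∅`; the letters of `v` are then those of `i`, all
  -- distinct by counting, so `v` is a permutation of `i`.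
  by_cases hT : T' = ∅
  · subst hT
    have himg : Finset.univ.image v = Finset.univ.image i := by
      rw [he, Finset.empty_union]
      ext; simp [List.mem_ofFn]
    have hcard : (Finset.univ.image v).card = (Finset.univ : Finset (Fin N)).card := by
      rw [himg, Finset.card_image_of_injective _ hi.injective]
    have hinj : Function.Injective v := by
      have := Finset.card_image_iff.1 hcard
      rwa [Finset.coe_univ, Set.injOn_univ] at this
    obtain ⟨i', τ, hi', rfl⟩ := exists_strictMono_comp_perm hinj
    have : i' = i := by
      refine (StrictMono.range_inj hi' hi).1 ?_
      have := congrArg (fun s : Finset (Fin n) => (s : Set (Fin n))) himg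
      simp only [Finset.coe_image, Finset.coe_univ, Set.image_univ] at this
      rwa [τ.surjective.range_comp] at this
    subst this
    rw [Pi.single_eq_same, map_zsmul, LinearMap.mul'_apply, one_mul, mul_one,
      antisymmProd_comp_perm, ← antisymmetrizer_eq]
    exact Submodule.smul_of_tower_mem _ _ (Submodule.smul_of_tower_mem _ _
      (Submodule.mem_span_singleton_self _))
  · rw [Pi.single_eq_of_ne (Ne.symm hT), map_zero]
    exact Submodule.zero_mem _

end Relation

/-! ### The relations form a Gröbner basis -/

section Groebner

variable {n : ℕ} (k : Type*) [Field k]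

/-- The monomial of the free algebra attached to a word. -/
abbrev freeWord (w : List (Fin n)) : FreeAlgebra k (Fin n) := wordProd (FreeAlgebra.ι k) w

lemma basisFreeMonoid_ofList (w : List (Fin n)) :
    FreeAlgebra.basisFreeMonoid k (Fin n) (FreeMonoid.ofList w) = freeWord k w := by
  simp [FreeAlgebra.basisFreeMonoid, FreeAlgebra.equivMonoidAlgebraFreeMonoid,
    MonoidAlgebra.lift_apply, wordProd]

/-- The basis of words of the free algebra. -/
def wordBasis (n : ℕ) : Module.Basis (List (Fin n)) k (FreeAlgebra k (Fin n)) :=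
  (FreeAlgebra.basisFreeMonoid k (Fin n)).reindex FreeMonoid.toList

lemma wordBasis_apply (w : List (Fin n)) : wordBasis k n w = freeWord k w := by
  rw [wordBasis, Module.Basis.reindex_apply, ← basisFreeMonoid_ofList]
  rfl

lemma span_freeWord : Submodule.span k (Set.range (freeWord k (n := n))) = ⊤ := by
  have : freeWord k (n := n) = wordBasis k n := funext fun w => (wordBasis_apply k w).symm
  rw [this]
  exact (wordBasis k n).span_eq

/-- The span of the words less than `u`. -/
def lowWords (u : List (Fin n)) : Submodule k (FreeAlgebra k (Fin n)) :=
  Submodule.span k {z | ∃ w, wordKey w < wordKey u ∧ z = freeWord k w}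

lemma freeWord_mem_lowWords {u w : List (Fin n)} (h : wordKey w < wordKey u) :
    freeWord k w ∈ lowWords k u := Submodule.subset_span ⟨w, h, rfl⟩

lemma coord_of_mem_lowWords {u v : List (Fin n)} {z : FreeAlgebra k (Fin n)}
    (hz : z ∈ lowWords k u) (h : wordKey u ≤ wordKey v) : (wordBasis k n).repr z v = 0 := by
  have : lowWords k u ≤ LinearMap.ker ((wordBasis k n).coord v) := by
    refine Submodule.span_le.2 ?_
    rintro z ⟨w, hw, rfl⟩
    have hne : w ≠ v := by
      rintro rfl
      exact absurd h hw.not_ge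
    simp [← wordBasis_apply, hne]
  exact this hz

lemma mul_mem_lowWords {u : List (Fin n)} {z : FreeAlgebra k (Fin n)}
    (hz : z ∈ lowWords k u) (w v : List (Fin n)) :
    freeWord k w * z * freeWord k v ∈ lowWords k (w ++ u ++ v) := by
  have : lowWords k u ≤ (lowWords k (w ++ u ++ v)).comap
      (LinearMap.mulLeftRight k (freeWord k w, freeWord k v)) := by
    refine Submodule.span_le.2 ?_
    rintro z ⟨x, hx, rfl⟩
    simp only [SetLike.mem_coe, Submodule.mem_comap, LinearMap.mulLeftRight_apply,
      ← wordProd_append]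
    exact freeWord_mem_lowWords k
      (wordKey_append_right_lt _ (wordKey_append_left_lt _ hx))
  exact this hz

/-- The leading word of a relation. -/
lemma rel_sub_mem_lowWords {N : ℕ} {c : List (Fin n)} (hc : Descending c) (hN : c.length = N) :
    rel k N c.toFinset - freeWord k c ∈ lowWords k c := by
  let β : List (Fin n) → k →+ FreeSq k n := fun w =>
    (LinearMap.toSpanSingleton k (FreeSq k n) (freeWord k w ⊗ₜ 1)).toAddMonoidHom
  have hβ : ∀ w a, β w a = a • (freeWord k w ⊗ₜ 1) := fun _ _ => rfl
  have hl : ∀ s w m, freeL k n s (β w m) = β (w ++ [s]) m := by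
    intro s w m
    have e : freeWord k (w ++ [s]) = freeWord k w * FreeAlgebra.ι k s := by
      rw [freeWord, wordProd_append, wordProd_singleton]
    rw [hβ, hβ, e, ← algebraMap_smul (FreeAlgebra k (Fin n)) m, map_smul, tensorLeft_tmul,
      algebraMap_smul]
  -- All letters of `c` are moved to the word, none remaining in the set.
  have h1 := leftOp_pow_single (β := β) hl [] c [] 1 (by simpa using hc)
  let ev : (Finset (Fin n) → FreeSq k n) →+ FreeAlgebra k (Fin n) :=
    (freeMul k n).toAddMonoidHom.comp (Pi.evalAddMonoidHom (fun _ => FreeSq k n) ∅)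
  have h2 : lowMono β c ≤ (lowWords k c).toAddSubgroup.comap ev := by
    refine (AddSubgroup.closure_le _).2 ?_
    rintro f ⟨w, S, m, hw, rfl⟩
    change freeMul k n ((Pi.single S (β w m) : Finset (Fin n) → FreeSq k n) ∅) ∈ lowWords k c
    by_cases hS : ∅ = S
    · subst hS
      have hd : descList (∅ : Finset (Fin n)) = [] := by
        rw [← List.length_eq_zero_iff]; simp
      rw [hd, List.append_nil] at hw
      rw [Pi.single_eq_same, hβ, map_smul]
      refine Submodule.smul_mem _ _ ?_
      simpa using freeWord_mem_lowWords k hw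
    · rw [Pi.single_eq_of_ne hS, map_zero]
      exact Submodule.zero_mem _
  have h3 : ev _ ∈ lowWords k c := h2 (by simpa using h1)
  rw [map_sub] at h3
  have e1 : ev (Pi.single ∅ (β c 1)) = freeWord k c := by
    change freeMul k n ((Pi.single ∅ (β c 1) : Finset (Fin n) → FreeSq k n) ∅) = _
    rw [Pi.single_eq_same, hβ, one_smul, LinearMap.mul'_apply, mul_one]
  have e2 : ev ((leftOp (freeL k n) ^ c.length) (Pi.single c.toFinset (β [] 1))) =
      rel k N c.toFinset := by
    rw [hN]
    change freeMul k n ((leftOp (freeL k n) ^ N) (Pi.single c.toFinset (β [] 1)) ∅) = _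
    rw [hβ, one_smul]
    rfl
  rw [e2, e1] at h3
  exact h3

/-- A multiple of a relation. -/
def relWord (N : ℕ) (w c v : List (Fin n)) : FreeAlgebra k (Fin n) :=
  freeWord k w * rel k N c.toFinset * freeWord k v

/-- The span of the multiples of the relations with leading word less than `u`. -/
def lowRel (N : ℕ) (u : List (Fin n)) : Submodule k (FreeAlgebra k (Fin n)) :=
  Submodule.span k {z | ∃ w c v, Descending c ∧ c.length = N ∧
    wordKey (w ++ c ++ v) < wordKey u ∧ z = relWord k N w c v}

lemma relWord_mem_lowRel {N : ℕ} {u w c v : List (Fin n)} (hc : Descending c) (hN : c.length = N)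
    (h : wordKey (w ++ c ++ v) < wordKey u) : relWord k N w c v ∈ lowRel k N u :=
  Submodule.subset_span ⟨w, c, v, hc, hN, h, rfl⟩

lemma relWord_sub_mem_lowWords {N : ℕ} {w c v : List (Fin n)} (hc : Descending c)
    (hN : c.length = N) : relWord k N w c v - freeWord k (w ++ c ++ v) ∈ lowWords k (w ++ c ++ v) := by
  have := mul_mem_lowWords k (rel_sub_mem_lowWords k hc hN) w v
  rw [mul_sub, sub_mul] at this
  simpa [wordProd_append, relWord, mul_assoc] using this

/-- Multiples of a relation by a combination of low words. -/
lemma mul_rel_mem_lowRel {N : ℕ} {q c : List (Fin n)} (hc : Descending c) (hN : c.length = N)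
    {z : FreeAlgebra k (Fin n)} (hz : z ∈ lowWords k q) (w y v : List (Fin n)) :
    freeWord k w * z * freeWord k y * rel k N c.toFinset * freeWord k v ∈
      lowRel k N (w ++ q ++ y ++ c ++ v) := by
  have : lowWords k q ≤ (lowRel k N (w ++ q ++ y ++ c ++ v)).comap
      (LinearMap.mulLeftRight k (freeWord k w,
        freeWord k y * rel k N c.toFinset * freeWord k v)) := by
    refine Submodule.span_le.2 ?_
    rintro z ⟨x, hx, rfl⟩
    simp only [SetLike.mem_coe, Submodule.mem_comap, LinearMap.mulLeftRight_apply]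
    have e : freeWord k w * freeWord k x * (freeWord k y * rel k N c.toFinset * freeWord k v) =
        relWord k N (w ++ x ++ y) c v := by
      simp [relWord, wordProd_append, mul_assoc]
    rw [e]
    refine relWord_mem_lowRel k hc hN ?_
    have := wordKey_append_right_lt (y ++ c ++ v) (wordKey_append_left_lt w hx)
    simpa using this
  simpa [mul_assoc] using this hz

lemma rel_mul_mem_lowRel {N : ℕ} {q c : List (Fin n)} (hc : Descending c) (hN : c.length = N)
    {z : FreeAlgebra k (Fin n)} (hz : z ∈ lowWords k q) (w y v : List (Fin n)) :
    freeWord k w * rel k N c.toFinset * freeWord k y * z * freeWord k v ∈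
      lowRel k N (w ++ c ++ y ++ q ++ v) := by
  have : lowWords k q ≤ (lowRel k N (w ++ c ++ y ++ q ++ v)).comap
      (LinearMap.mulLeftRight k (freeWord k w * rel k N c.toFinset * freeWord k y,
        freeWord k v)) := by
    refine Submodule.span_le.2 ?_
    rintro z ⟨x, hx, rfl⟩
    simp only [SetLike.mem_coe, Submodule.mem_comap, LinearMap.mulLeftRight_apply]
    have e : freeWord k w * rel k N c.toFinset * freeWord k y * freeWord k x * freeWord k v =
        relWord k N w c (y ++ x ++ v) := by
      simp [relWord, wordProd_append, mul_assoc]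
    rw [e]
    refine relWord_mem_lowRel k hc hN ?_
    have := wordKey_append_right_lt v (wordKey_append_left_lt (w ++ c ++ y) hx)
    simpa using this
  exact this hz

/-- Disjoint relations. -/
lemma relWord_sub_disjoint {N : ℕ} {c c' : List (Fin n)} (hc : Descending c) (hN : c.length = N)
    (hc' : Descending c') (hN' : c'.length = N) (w y v : List (Fin n)) :
    relWord k N w c (y ++ c' ++ v) - relWord k N (w ++ c ++ y) c' v ∈
      lowRel k N (w ++ c ++ y ++ c' ++ v) := by
  have h1 := rel_mul_mem_lowRel k hc hN (rel_sub_mem_lowWords k hc' hN') w y v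
  have h2 := mul_rel_mem_lowRel k hc' hN' (rel_sub_mem_lowWords k hc hN) w y v
  -- Writing `r`, `r'` for the relations and identifying words with monomials, `(r - c) y r' - r y
  -- (r' - c') = r y c' - c y r'`: the product `r y r'` cancels.
  have := Submodule.sub_mem _ h2 h1
  convert this using 1
  simp only [relWord, wordProd_append]
  noncomm_ring

lemma moveSign_eq_one {r : Fin n → Fin n → Prop} [DecidableRel r] {s : Fin n}
    {S : Finset (Fin n)} (h : ∀ t ∈ S, ¬ r s t) : moveSign r s S = 1 := by
  rw [moveSign, Finset.filter_eq_empty_iff.2 h, Finset.card_empty, pow_zero]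

lemma descList_erase {p q : List (Fin n)} {s : Fin n} (h : Descending (p ++ s :: q)) :
    descList ((p ++ s :: q).toFinset.erase s) = p ++ q := by
  have hd : Descending (p ++ q) := by
    refine h.sublist ?_
    exact List.Sublist.append_left (List.sublist_cons_self _ _) _
  rw [← descList_toFinset hd]
  congr 1
  have hn := h.nodup
  rw [List.nodup_middle, List.nodup_cons] at hn
  ext x
  simp only [Finset.mem_erase, List.mem_toFinset, List.mem_append, List.mem_cons]
  constructor
  · rintro ⟨h1, h2 | h2 | h2⟩
    · exact Or.inl h2
    · exact absurd h2 h1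
    · exact Or.inr h2
  · intro h2
    refine ⟨?_, by tauto⟩
    rintro rfl
    exact hn.1 (by simpa using h2)

/-- Shifting a relation by one letter inside a descending word. -/
lemma relWord_sub_shift {N : ℕ} {a b : Fin n} {c : List (Fin n)}
    (h : Descending (a :: c ++ [b])) (hN : c.length + 1 = N) (w v : List (Fin n)) :
    relWord k N w (a :: c) (b :: v) - relWord k N (w ++ [a]) (c ++ [b]) v ∈
      lowRel k N (w ++ (a :: c ++ [b]) ++ v) := by
  set T := (a :: c ++ [b]).toFinset with hT
  have haT : a ∈ T := by simp [hT]
  have hbT : b ∈ T := by simp [hT]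
  have hd1 : Descending (a :: c) := (List.pairwise_append.1 h).1
  have hd2 : Descending (c ++ [b]) := (List.pairwise_cons.1 h).2
  have hTcard : T.card = N + 1 := by rw [hT, h.card_toFinset]; simp; omega
  have eA : T.erase a = (c ++ [b]).toFinset := erase_toFinset_cons h
  have eB : T.erase b = (a :: c).toFinset := by
    have := congrArg List.toFinset (descList_erase (p := a :: c) (q := []) h)
    rwa [toFinset_descList, List.append_nil] at this
  have hsum := sum_rel_eq k N T
  -- The first-letter expansion is led by the largest letter `a`, the last-letter expansion by the
  -- smallest letter `b`, both with sign `1`. These are the two terms being compared; the others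
  -- have smaller leading words.
  rw [← Finset.add_sum_erase T _ haT, ← Finset.add_sum_erase T _ hbT] at hsum
  rw [moveSign_eq_one (s := a), moveSign_eq_one (s := b), one_smul, one_smul, eA, eB] at hsum
  rotate_left
  · intro t ht
    rw [eB] at ht
    exact not_lt_of_gt ((List.pairwise_append.1 h).2.2 t (by simpa using ht) b (by simp))
  · intro t ht
    rw [eA] at ht
    exact not_lt_of_gt ((List.pairwise_cons.1 h).1 t (by simpa [or_comm] using ht))
  have key : relWord k N w (a :: c) (b :: v) - relWord k N (w ++ [a]) (c ++ [b]) v =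
      ∑ s ∈ (c ++ [b]).toFinset, moveSign (· < ·) s (T.erase s) •
        relWord k N (w ++ [s]) (descList (T.erase s)) v -
      ∑ s ∈ (a :: c).toFinset, moveSign (· > ·) s (T.erase s) •
        relWord k N w (descList (T.erase s)) ([s] ++ v) := by
    have := congrArg (fun z => freeWord k w * z * freeWord k v) hsum
    simp only [mul_add, add_mul, Finset.mul_sum, Finset.sum_mul, mul_smul_comm, smul_mul_assoc]
      at this
    simp only [relWord, toFinset_descList, wordProd_append, wordProd_singleton, ← mul_assoc]
    simp only [← mul_assoc] at this
    have e : freeWord k (b :: v) = FreeAlgebra.ι k b * freeWord k v := by simp [wordProd]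
    rw [e, ← mul_assoc, sub_eq_sub_iff_add_eq_add, ← this, add_comm]
  rw [key]
  refine Submodule.sub_mem _ (Submodule.sum_mem _ fun s hs => ?_)
    (Submodule.sum_mem _ fun s hs => ?_)
  · refine Submodule.smul_of_tower_mem _ (moveSign (· < ·) s (T.erase s)) ?_
    have hsT : s ∈ T := by rw [← eA] at hs; exact Finset.mem_of_mem_erase hs
    refine relWord_mem_lowRel k (descending_descList _) ?_ ?_
    · rw [length_descList, Finset.card_erase_of_mem hsT, hTcard, Nat.add_sub_cancel]
    · refine wordKey_append_right_lt v ?_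
      exact wordKey_erase_lt w h (by simpa [or_comm] using hs)
  · refine Submodule.smul_of_tower_mem _ (moveSign (· > ·) s (T.erase s)) ?_
    have hsT : s ∈ T := by rw [← eB] at hs; exact Finset.mem_of_mem_erase hs
    refine relWord_mem_lowRel k (descending_descList _) ?_ ?_
    · rw [length_descList, Finset.card_erase_of_mem hsT, hTcard, Nat.add_sub_cancel]
    · obtain ⟨p, q, hpq⟩ := List.append_of_mem (List.mem_toFinset.1 hs)
      have h' : Descending (p ++ s :: (q ++ [b])) := by
        have := h
        rw [hpq] at this
        simpa using this
      have hT' : T = (p ++ s :: (q ++ [b])).toFinset := by rw [hT, hpq]; simp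
      rw [hT', descList_erase h', hpq]
      -- Sending `s` to the end replaces it by the next, smaller letter.
      have h1 : wordKey (q ++ [b] ++ [s]) < wordKey (s :: q ++ [b]) := by
        have h2 := (List.pairwise_append.1 h').2.1
        cases q with
        | nil => exact wordKey_cons_lt ((List.pairwise_cons.1 h2).1 b (by simp)) rfl
        | cons e q => exact wordKey_cons_lt ((List.pairwise_cons.1 h2).1 e (by simp)) (by simp)
      have h3 := wordKey_append_right_lt v (wordKey_append_left_lt (w ++ p) h1)
      simpa using h3

/-- Multiples of relations with the same leading word agree up to lower terms. -/
lemma relWord_sub_mem_lowRel {N : ℕ} {c₁ c₂ : List (Fin n)} (h₁ : Descending c₁)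
    (hN₁ : c₁.length = N) (h₂ : Descending c₂) (hN₂ : c₂.length = N) (t : List (Fin n))
    (w v₁ v₂ : List (Fin n)) (e : c₁ ++ v₁ = t ++ c₂ ++ v₂) :
    relWord k N w c₁ v₁ - relWord k N (w ++ t) c₂ v₂ ∈ lowRel k N (w ++ c₁ ++ v₁) := by
  induction t generalizing w c₁ v₁ with
  | nil =>
    obtain ⟨rfl, rfl⟩ := List.append_inj e (by simp [hN₁, hN₂])
    simp
  | cons a t ih =>
    by_cases hlt : N ≤ (a :: t).length
    · rw [List.append_assoc] at e
      obtain ⟨y, hy, e'⟩ : ∃ y, a :: t = c₁ ++ y ∧ v₁ = y ++ (c₂ ++ v₂) := by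
        rcases List.append_eq_append_iff.1 e with ⟨y, h, h'⟩ | ⟨y, h, h'⟩
        · exact ⟨y, h, h'⟩
        · have hy : y = [] := by
            have := congrArg List.length h
            rw [List.length_append, hN₁] at this
            exact List.length_eq_zero_iff.1 (by omega)
          subst hy
          exact ⟨[], by simpa using h.symm, by simpa using h'.symm⟩
      rw [hy, e']
      have := relWord_sub_disjoint k h₁ hN₁ h₂ hN₂ w y v₂
      simpa using this
    · push Not at hlt
      obtain ⟨z, hz, e'⟩ : ∃ z, c₁ = a :: t ++ z ∧ c₂ ++ v₂ = z ++ v₁ := by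
        rw [List.append_assoc] at e
        rcases List.append_eq_append_iff.1 e with ⟨y, h, h'⟩ | ⟨y, h, h'⟩
        · exfalso
          have := congrArg List.length h
          rw [List.length_append, hN₁] at this
          omega
        · exact ⟨y, h, h'⟩
      have hzlen : (a :: t).length + z.length = N := by
        rw [← hN₁, hz, List.length_append]
      obtain ⟨x, hx, e''⟩ : ∃ x, c₂ = z ++ x ∧ v₁ = x ++ v₂ := by
        rcases List.append_eq_append_iff.1 e' with ⟨y, h, h'⟩ | ⟨y, h, h'⟩
        · exfalso
          have := congrArg List.length h
          rw [List.length_append, hN₂] at this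
          simp at hzlen
          omega
        · exact ⟨y, h, h'⟩
      have hxlen : x.length = (a :: t).length := by
        have := hN₂
        rw [hx, List.length_append] at this
        omega
      cases x with
      | nil => simp at hxlen
      | cons b x =>
        cases z with
        | nil =>
          exfalso
          simp only [List.length_nil, add_zero] at hzlen
          omega
        | cons f z =>
          subst hz e'' hx
          -- The leading words overlap in `f :: z`, so they glue to one descending word. Its first
          -- `N + 1` letters allow a shift by one place, and the induction on `t` does the rest.
          have hd : Descending (a :: (t ++ f :: z) ++ [b]) := by
            have := descending_append_cons (t := a :: t) (c := z ++ b :: x) h₁ h₂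
            refine this.sublist ?_
            simp only [List.cons_append, List.append_assoc, List.cons_sublist_cons]
            refine List.Sublist.append_left ?_ _
            simp only [List.cons_sublist_cons]
            refine List.Sublist.append_left ?_ _
            simp
          have hs := relWord_sub_shift k (N := N) hd
            (by rw [← hN₁]; simp) w (x ++ v₂)
          have hr := ih (c₁ := t ++ f :: z ++ [b]) (v₁ := x ++ v₂)
            (List.pairwise_cons.1 hd).2 (by rw [← hN₁]; simp; omega) (w ++ [a]) (by simp)
          have := Submodule.add_mem _ hs (show _ ∈ lowRel k N (w ++ (a :: (t ++ f :: z) ++ [b]) ++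
            (x ++ v₂)) by simpa using hr)
          simpa using this

end Groebner

/-! ### The basis of irreducible words -/

section Basis

variable {n : ℕ} (k : Type*) [Field k]

/-- The span of all multiples of the relations. -/
def relSpan (n N : ℕ) : Submodule k (FreeAlgebra k (Fin n)) :=
  Submodule.span k {z | ∃ w c v : List (Fin n), Descending c ∧ c.length = N ∧ z = relWord k N w c v}

lemma relWord_sub_relWord_mem {N : ℕ} {u w₁ c₁ v₁ w₂ c₂ v₂ : List (Fin n)} (h₁ : Descending c₁)
    (hN₁ : c₁.length = N) (h₂ : Descending c₂) (hN₂ : c₂.length = N)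
    (e₁ : u = w₁ ++ c₁ ++ v₁) (e₂ : u = w₂ ++ c₂ ++ v₂) :
    relWord k N w₁ c₁ v₁ - relWord k N w₂ c₂ v₂ ∈ lowRel k N u := by
  have e := e₁.symm.trans e₂
  rw [List.append_assoc, List.append_assoc] at e
  rcases List.append_eq_append_iff.1 e with ⟨t, rfl, h'⟩ | ⟨t, rfl, h'⟩
  · rw [e₁]
    exact relWord_sub_mem_lowRel k h₁ hN₁ h₂ hN₂ t w₁ v₁ v₂ (by simpa using h')
  · rw [e₂, ← neg_sub]
    exact Submodule.neg_mem _
      (relWord_sub_mem_lowRel k h₂ hN₂ h₁ hN₁ t w₂ v₂ v₁ (by simpa using h'))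

/-- A relation with a given leading word. -/
lemma exists_standard_rel (N : ℕ) : ∃ g : {u : List (Fin n) // Reducible N u} →
    FreeAlgebra k (Fin n), ∀ u, ∃ w c v, u.1 = w ++ c ++ v ∧ c.length = N ∧ Descending c ∧
      g u = relWord k N w c v := by
  have : ∀ u : {u : List (Fin n) // Reducible N u}, ∃ z : FreeAlgebra k (Fin n),
      ∃ w c v, u.1 = w ++ c ++ v ∧ c.length = N ∧ Descending c ∧ z = relWord k N w c v := by
    rintro ⟨u, w, c, v, h1, h2, h3⟩
    exact ⟨_, w, c, v, h1, h2, h3, rfl⟩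
  exact ⟨fun u => (this u).choose, fun u => (this u).choose_spec⟩

/-- Multiples of relations with the same leading word agree modulo multiples with smaller ones, so
one chosen multiple per reducible word spans `relSpan`. In a nonzero combination of these, the
largest leading word cannot cancel, and it is reducible. -/
lemma eq_zero_of_mem_relSpan {N : ℕ} {z : FreeAlgebra k (Fin n)} (hz : z ∈ relSpan k n N)
    (hirr : ∀ u, Reducible N u → (wordBasis k n).repr z u = 0) : z = 0 := by
  obtain ⟨g, hg⟩ := exists_standard_rel k (n := n) N
  have hle : relSpan k n N ≤ Submodule.span k (Set.range g) := by
    have key : ∀ u w c v : List (Fin n), u = w ++ c ++ v → Descending c → c.length = N →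
        relWord k N w c v ∈ Submodule.span k (Set.range g) := by
      intro u
      induction u using wordKey_lt_wf.induction with
      | _ u ih =>
      intro w c v e hc hN
      obtain ⟨w', c', v', e', hN', hc', hg'⟩ := hg ⟨u, w, c, v, e, hN, hc⟩
      have h1 : lowRel k N u ≤ Submodule.span k (Set.range g) := by
        refine Submodule.span_le.2 ?_
        rintro _ ⟨w1, c1, v1, hc1, hN1, hlt, rfl⟩
        exact ih _ hlt _ _ _ rfl hc1 hN1
      have h2 := h1 (relWord_sub_relWord_mem k hc hN hc' hN' e e')
      rw [← hg'] at h2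
      have := Submodule.add_mem _ h2 (Submodule.subset_span ⟨⟨u, w, c, v, e, hN, hc⟩, rfl⟩)
      rwa [sub_add_cancel] at this
    refine Submodule.span_le.2 ?_
    rintro _ ⟨w, c, v, hc, hN, rfl⟩
    exact key _ w c v rfl hc hN
  obtain ⟨a, ha⟩ := Finsupp.mem_span_range_iff_exists_finsupp.1 (hle hz)
  by_cases h0 : a = 0
  · rw [← ha, h0, Finsupp.sum_zero_index]
  · exfalso
    obtain ⟨u, hu, hmax⟩ := a.support.exists_max_image (fun u => wordKey u.1)
      (Finsupp.support_nonempty_iff.2 h0)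
    have hlead : ∀ u', g u' - freeWord k u'.1 ∈ lowWords k u'.1 := by
      intro u'
      obtain ⟨w, c, v, e, hN, hc, h⟩ := hg u'
      rw [h, e]
      exact relWord_sub_mem_lowWords k hc hN
    have h1 : ∀ u' ∈ a.support, (wordBasis k n).repr (g u') u.1 = if u' = u then 1 else 0 := by
      intro u' hu'
      have h2 := coord_of_mem_lowWords k (hlead u') (hmax u' hu')
      rw [map_sub, Finsupp.sub_apply, sub_eq_zero] at h2
      rw [h2, ← wordBasis_apply, Module.Basis.repr_self, Finsupp.single_apply]
      simp [Subtype.ext_iff]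
    have h3 := hirr u.1 u.2
    rw [← ha, Finsupp.sum, map_sum, Finsupp.finsetSum_apply] at h3
    rw [Finset.sum_congr rfl fun u' hu' => by
      rw [map_smul, Finsupp.smul_apply, h1 u' hu', smul_eq_mul]] at h3
    rw [Finset.sum_eq_single u (by intro b _ hb; simp [hb]) (fun h => absurd hu h)] at h3
    simp only [if_true, mul_one] at h3
    exact Finsupp.mem_support_iff.1 hu h3

lemma relSpan_mul_mem {N : ℕ} (a b : FreeAlgebra k (Fin n)) {z : FreeAlgebra k (Fin n)}
    (hz : z ∈ relSpan k n N) : a * z * b ∈ relSpan k n N := by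
  have h1 : ∀ w v : List (Fin n), freeWord k w * z * freeWord k v ∈ relSpan k n N := by
    intro w v
    have : relSpan k n N ≤ (relSpan k n N).comap
        (LinearMap.mulLeftRight k (freeWord k w, freeWord k v)) := by
      refine Submodule.span_le.2 ?_
      rintro _ ⟨w', c, v', hc, hN, rfl⟩
      refine Submodule.subset_span ⟨w ++ w', c, v' ++ v, hc, hN, ?_⟩
      simp [relWord, wordProd_append, mul_assoc]
    exact this hz
  have h2 : ∀ w : List (Fin n), freeWord k w * z * b ∈ relSpan k n N := by
    intro w
    have : (⊤ : Submodule k (FreeAlgebra k (Fin n))) ≤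
        (relSpan k n N).comap (LinearMap.mulLeft k (freeWord k w * z)) := by
      rw [← span_freeWord, Submodule.span_le]
      rintro _ ⟨v, rfl⟩
      exact h1 w v
    exact this Submodule.mem_top
  have : (⊤ : Submodule k (FreeAlgebra k (Fin n))) ≤
      (relSpan k n N).comap (LinearMap.mulRight k (z * b)) := by
    rw [← span_freeWord, Submodule.span_le]
    rintro _ ⟨w, rfl⟩
    simpa [mul_assoc] using h2 w
  simpa [mul_assoc] using this (Submodule.mem_top : a ∈ ⊤)

variable [CharZero k]

lemma rel_ne_zero {N : ℕ} {c : List (Fin n)} (hc : Descending c) (hN : c.length = N) :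
    rel k N c.toFinset ≠ 0 := by
  intro h
  have := coord_of_mem_lowWords k (rel_sub_mem_lowWords k hc hN) le_rfl
  rw [h, zero_sub, map_neg, ← wordBasis_apply, Module.Basis.repr_self] at this
  simp at this

/-- The scalar relating `rel` to the antisymmetrizer is invertible, because `rel` has a leading term
and so is nonzero. -/
lemma antisymmetrizer_mem_relSpan {N : ℕ} {i : Fin N → Fin n} (hi : StrictMono i) :
    antisymmetrizer k i ∈ relSpan k n N := by
  obtain ⟨t, ht⟩ := exists_smul_rel_eq k hi
  have hc := descending_descList (Finset.univ.image i)
  have hN : (descList (Finset.univ.image i)).length = N := by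
    rw [length_descList, Finset.card_image_of_injective _ hi.injective, Finset.card_univ,
      Fintype.card_fin]
  have h1 : rel k N (Finset.univ.image i) ∈ relSpan k n N := by
    refine Submodule.subset_span ⟨[], _, [], hc, hN, ?_⟩
    simp [relWord]
  have h2 := rel_ne_zero k hc hN
  rw [toFinset_descList] at h2
  have ht0 : t ≠ 0 := by
    rintro rfl
    exact h2 (by rw [ht, zero_smul])
  rw [ht] at h1
  exact (Submodule.smul_mem_iff _ ht0).1 h1

/-- `relSpan` is a two-sided ideal containing the defining relations, so the quotient by it factors
through the algebra. -/
lemma mem_relSpan_of_mkAlgHom_eq_zero {N : ℕ} {z : FreeAlgebra k (Fin n)}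
    (hz : RingQuot.mkAlgHom k (antisymmetrizerRel k n N) z = 0) : z ∈ relSpan k n N := by
  let J : TwoSidedIdeal (FreeAlgebra k (Fin n)) := TwoSidedIdeal.mk' (relSpan k n N)
    (Submodule.zero_mem _) (Submodule.add_mem _) (Submodule.neg_mem _)
    (fun {x y} hy => by simpa using relSpan_mul_mem k x 1 hy)
    (fun {x y} hx => by simpa using relSpan_mul_mem k 1 y hx)
  have hJ : ∀ x, x ∈ J ↔ x ∈ relSpan k n N := fun x => TwoSidedIdeal.mem_mk' ..
  have hmk : ∀ x, J.ringCon.mk' x = 0 ↔ x ∈ J := by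
    intro x
    rw [TwoSidedIdeal.mem_iff, ← RingCon.eq]
    rfl
  let F : RingQuot (antisymmetrizerRel k n N) →+* J.ringCon.Quotient :=
    RingQuot.lift ⟨J.ringCon.mk', by
      rintro a b ⟨⟨i, hi, rfl⟩, rfl⟩
      rw [map_zero, hmk, hJ]
      exact antisymmetrizer_mem_relSpan k hi⟩
  have h1 : F (RingQuot.mkRingHom (antisymmetrizerRel k n N) z) = J.ringCon.mk' z :=
    RingQuot.lift_mkRingHom_apply _ _ _
  have h2 : RingQuot.mkRingHom (antisymmetrizerRel k n N) z = 0 := by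
    rw [← RingQuot.mkAlgHom_coe k]; exact hz
  rw [h2, map_zero] at h1
  exact (hJ z).1 ((hmk z).1 h1.symm)

end Basis

/-! ### Passage to the quotient algebra -/

namespace AntisymmetrizerAlgebra

variable (k : Type*) [Field k] (n N : ℕ)

lemma mkAlgHom_freeWord (w : List (Fin n)) :
    RingQuot.mkAlgHom k (antisymmetrizerRel k n N) (freeWord k w) = wordProd (gen k n N) w := by
  rw [freeWord, wordProd, map_list_prod, List.map_map]
  rfl

lemma span_wordProd : Submodule.span k (Set.range (wordProd (gen k n N))) = ⊤ := by
  have h : (⊤ : Submodule k (AntisymmetrizerAlgebra k n N)) =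
      (⊤ : Submodule k (FreeAlgebra k (Fin n))).map
        (RingQuot.mkAlgHom k (antisymmetrizerRel k n N)).toLinearMap := by
    rw [Submodule.map_top, eq_comm, LinearMap.range_eq_top]
    exact RingQuot.mkAlgHom_surjective k _
  rw [h, ← span_freeWord, Submodule.map_span, ← Set.range_comp]
  congr 2
  ext w
  exact (mkAlgHom_freeWord k n N w).symm

lemma antisymmProd_gen {v : Fin N → Fin n} (hv : Function.Injective v) :
    antisymmProd (gen k n N) v = 0 := by
  obtain ⟨i, τ, hi, rfl⟩ := exists_strictMono_comp_perm hv
  have h := RingQuot.mkAlgHom_rel k (s := antisymmetrizerRel k n N) (x := antisymmetrizer k i)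
    (y := 0) ⟨⟨i, hi, rfl⟩, rfl⟩
  rw [antisymmetrizer_eq, map_antisymmProd, map_zero] at h
  have h' : antisymmProd (gen k n N) i = 0 := h
  rw [antisymmProd_comp_perm, h']
  exact smul_zero _

variable [CharZero k]

lemma mkAlgHom_rel {c : List (Fin n)} (hc : Descending c) (hN : c.length = N) :
    RingQuot.mkAlgHom k (antisymmetrizerRel k n N) (rel k N c.toFinset) = 0 := by
  have hcard : c.toFinset.card = N := by rw [hc.card_toFinset, hN]
  obtain ⟨t, ht⟩ := exists_smul_rel_eq k (c.toFinset.orderEmbOfFin hcard).strictMono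
  have himg : Finset.univ.image (c.toFinset.orderEmbOfFin hcard) = c.toFinset := by
    rw [← Finset.coe_inj]
    simp
  rw [himg] at ht
  have h := RingQuot.mkAlgHom_rel k (s := antisymmetrizerRel k n N)
    (x := antisymmetrizer k (c.toFinset.orderEmbOfFin hcard))
    (y := 0) ⟨⟨_, (c.toFinset.orderEmbOfFin hcard).strictMono, rfl⟩, rfl⟩
  rw [ht, map_smul, h, map_zero, smul_zero]

/-- Every word is a combination of smaller irreducible words. -/
lemma wordProd_mem_span (u : List (Fin n)) : wordProd (gen k n N) u ∈
    Submodule.span k {z | ∃ w, ¬ Reducible N w ∧ wordKey w ≤ wordKey u ∧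
      z = wordProd (gen k n N) w} := by
  induction u using wordKey_lt_wf.induction with
  | _ u ih =>
  by_cases hu : Reducible N u
  · obtain ⟨w, c, v, e, hN, hc⟩ := hu
    have h1 := relWord_sub_mem_lowWords k (w := w) (v := v) hc hN
    rw [← e] at h1
    have h2 : lowWords k u ≤ (Submodule.span k {z | ∃ w, ¬ Reducible N w ∧ wordKey w ≤ wordKey u ∧
        z = wordProd (gen k n N) w}).comap
        (RingQuot.mkAlgHom k (antisymmetrizerRel k n N)).toLinearMap := by
      refine Submodule.span_le.2 ?_
      rintro _ ⟨w', hw', rfl⟩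
      simp only [SetLike.mem_coe, Submodule.mem_comap, AlgHom.toLinearMap_apply,
        mkAlgHom_freeWord]
      refine Submodule.span_mono ?_ (ih w' hw')
      rintro _ ⟨x, hx, hle, rfl⟩
      exact ⟨x, hx, hle.trans hw'.le, rfl⟩
    have h3 := h2 h1
    simp only [Submodule.mem_comap, AlgHom.toLinearMap_apply, map_sub, relWord, map_mul,
      mkAlgHom_rel k n N hc hN, mul_zero, zero_mul, zero_sub, mkAlgHom_freeWord] at h3
    exact (Submodule.neg_mem_iff _).1 h3
  · exact Submodule.subset_span ⟨u, hu, le_rfl, rfl⟩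

/-- The basis of irreducible words. -/
def irrBasis : Module.Basis {w : List (Fin n) // ¬ Reducible N w} k
    (AntisymmetrizerAlgebra k n N) :=
  Module.Basis.mk (v := fun w => wordProd (gen k n N) w.1)
    (by
      rw [linearIndependent_iff]
      intro a ha
      set z := Finsupp.linearCombination k (fun w : {w : List (Fin n) // ¬ Reducible N w} =>
        freeWord k w.1) a with hzdef
      have hz : RingQuot.mkAlgHom k (antisymmetrizerRel k n N) z = 0 := by
        rw [← ha, hzdef, Finsupp.linearCombination_apply, Finsupp.linearCombination_apply,
          Finsupp.sum, Finsupp.sum, map_sum]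
        refine Finset.sum_congr rfl fun w _ => ?_
        rw [map_smul, mkAlgHom_freeWord]
      have hli : LinearIndependent k (fun w : {w : List (Fin n) // ¬ Reducible N w} =>
          freeWord k w.1) := by
        have := (wordBasis k n).linearIndependent.comp
          (Subtype.val : {w : List (Fin n) // ¬ Reducible N w} → _) Subtype.val_injective
        simpa [Function.comp_def, wordBasis_apply] using this
      refine linearIndependent_iff.1 hli a ?_
      -- The lift `z` of a linear relation lies in `relSpan` but involves no reducible word.
      refine eq_zero_of_mem_relSpan k (mem_relSpan_of_mkAlgHom_eq_zero k hz) fun u hu => ?_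
      rw [← hzdef, hzdef, Finsupp.linearCombination_apply, Finsupp.sum, map_sum,
        Finsupp.finsetSum_apply]
      refine Finset.sum_eq_zero fun w _ => ?_
      have hne : w.1 ≠ u := by
        rintro rfl
        exact w.2 hu
      rw [map_smul, ← wordBasis_apply, Module.Basis.repr_self, Finsupp.smul_apply,
        Finsupp.single_eq_of_ne (Ne.symm hne), smul_zero])
    (by
      rw [← span_wordProd, Submodule.span_le]
      rintro _ ⟨u, rfl⟩
      refine Submodule.span_mono ?_ (wordProd_mem_span k n N u)
      rintro _ ⟨w, hw, -, rfl⟩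
      exact ⟨⟨w, hw⟩, rfl⟩)

lemma irrBasis_apply (w : {w : List (Fin n) // ¬ Reducible N w}) :
    irrBasis k n N w = wordProd (gen k n N) w.1 := by
  simp [irrBasis]

lemma irrBasis_repr_wordProd {u : List (Fin n)} {w : {w : List (Fin n) // ¬ Reducible N w}}
    (h : (irrBasis k n N).repr (wordProd (gen k n N) u) w ≠ 0) : wordKey w.1 ≤ wordKey u := by
  contrapose! h
  have : Submodule.span k {z | ∃ w, ¬ Reducible N w ∧ wordKey w ≤ wordKey u ∧
      z = wordProd (gen k n N) w} ≤ LinearMap.ker ((irrBasis k n N).coord w) := by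
    refine Submodule.span_le.2 ?_
    rintro _ ⟨w', hw', hle, rfl⟩
    have hne : (⟨w', hw'⟩ : {w : List (Fin n) // ¬ Reducible N w}) ≠ w := by
      rintro rfl
      exact absurd hle h.not_ge
    have e := irrBasis_apply k n N ⟨w', hw'⟩
    simp only at e
    simp [← e, hne]
  exact this (wordProd_mem_span k n N u)

end AntisymmetrizerAlgebra

/-! ### Algebras with a basis of irreducible words -/

/-- An algebra generated by `x 0, …, x (n - 1)` in which the antisymmetrizers of degree `N` vanish
and the irreducible words form a basis, with the anti-automorphism reversing words. -/
structure WordAlgebra (k A : Type*) [Field k] [Ring A] [Algebra k A] (n N : ℕ) where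
  x : Fin n → A
  antisymmProd_eq_zero : ∀ v : Fin N → Fin n, Function.Injective v → antisymmProd x v = 0
  basis : Module.Basis {w : List (Fin n) // ¬ Reducible N w} k A
  basis_apply : ∀ w, basis w = wordProd x w.1
  repr_le : ∀ (u : List (Fin n)) w, basis.repr (wordProd x u) w ≠ 0 → wordKey w.1 ≤ wordKey u
  rev : A →ₗ[k] A
  rev_wordProd : ∀ w, rev (wordProd x w) = wordProd x w.reverse
  ε : A →ₐ[k] k
  ε_x : ∀ s, ε (x s) = 0
  dual : A →ₐ[k] DualNumber k
  dual_x : ∀ s, dual (x s) = DualNumber.eps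

namespace AntisymmetrizerAlgebra

variable (k : Type*) [Field k] (n N : ℕ)

lemma antisymmProd_op {Q : Type*} [Ring Q] (x : Fin n → Q) (v : Fin N → Fin n) :
    antisymmProd (fun s => MulOpposite.op (x s)) v =
      (Equiv.Perm.sign (Fin.revPerm (n := N)) : ℤ) • MulOpposite.op (antisymmProd x v) := by
  rw [antisymmProd, antisymmProd, Finset.op_sum, Finset.smul_sum]
  refine Fintype.sum_equiv (Equiv.mulRight Fin.revPerm) _ _ fun σ => ?_
  rw [MulOpposite.op_smul, smul_smul, MulOpposite.op_list_prod, List.map_ofFn,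
    List.reverse_ofFn_eq, Equiv.coe_mulRight, Equiv.Perm.sign_mul, Units.val_mul, mul_left_comm,
    Int.units_coe_mul_self, mul_one]
  congr 3
  ext j
  simp

/-- The anti-automorphism reversing words, as a morphism to the opposite algebra. -/
def revHom : AntisymmetrizerAlgebra k n N →ₐ[k] (AntisymmetrizerAlgebra k n N)ᵐᵒᵖ :=
  RingQuot.liftAlgHom k ⟨FreeAlgebra.lift k fun s => MulOpposite.op (gen k n N s), by
    rintro a b ⟨⟨i, hi, rfl⟩, rfl⟩
    rw [antisymmetrizer_eq, map_antisymmProd, map_zero]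
    simp only [FreeAlgebra.lift_ι_apply]
    rw [antisymmProd_op, antisymmProd_gen k n N hi.injective, MulOpposite.op_zero]
    exact smul_zero _⟩

lemma revHom_gen (s : Fin n) : revHom k n N (gen k n N s) = MulOpposite.op (gen k n N s) := by
  rw [revHom, gen, RingQuot.liftAlgHom_mkAlgHom_apply, FreeAlgebra.lift_ι_apply]
  rfl

/-- The morphism to the dual numbers sending all the generators to `ε`. -/
def dualHom (hN : 2 ≤ N) : AntisymmetrizerAlgebra k n N →ₐ[k] DualNumber k :=
  RingQuot.liftAlgHom k ⟨FreeAlgebra.lift k fun _ => DualNumber.eps, by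
    rintro a b ⟨⟨i, hi, rfl⟩, rfl⟩
    rw [antisymmetrizer_eq, map_antisymmProd, map_zero]
    simp only [FreeAlgebra.lift_ι_apply]
    refine Finset.sum_eq_zero fun σ _ => ?_
    obtain ⟨N, rfl⟩ : ∃ m, N = m + 2 := ⟨N - 2, by omega⟩
    rw [List.ofFn_succ, List.ofFn_succ, List.prod_cons, List.prod_cons, ← mul_assoc,
      DualNumber.eps_mul_eps, zero_mul, smul_zero]⟩

variable [CharZero k]

/-- The antisymmetrizer algebra has a basis of irreducible words. -/
def wordAlgebra (hN : 2 ≤ N) : WordAlgebra k (AntisymmetrizerAlgebra k n N) n N where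
  x := gen k n N
  antisymmProd_eq_zero v hv := antisymmProd_gen k n N hv
  basis := irrBasis k n N
  basis_apply := irrBasis_apply k n N
  repr_le _ _ h := irrBasis_repr_wordProd k n N h
  rev := (MulOpposite.opLinearEquiv k).symm.toLinearMap ∘ₗ (revHom k n N).toLinearMap
  rev_wordProd w := by
    have h : revHom k n N (wordProd (gen k n N) w) =
        MulOpposite.op (wordProd (gen k n N) w.reverse) := by
      rw [wordProd, map_list_prod, List.map_map, wordProd, MulOpposite.op_list_prod,
        ← List.map_reverse, ← List.map_reverse, List.reverse_reverse, List.map_map]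
      congr 2
      exact funext fun s => revHom_gen k n N s
    exact congrArg MulOpposite.unop h
  ε := augmentation k n hN
  ε_x s := by
    rw [augmentation, gen, RingQuot.liftAlgHom_mkAlgHom_apply, FreeAlgebra.lift_ι_apply]
  dual := dualHom k n N hN
  dual_x s := by
    rw [dualHom, gen, RingQuot.liftAlgHom_mkAlgHom_apply, FreeAlgebra.lift_ι_apply]

end AntisymmetrizerAlgebra

/-! ### The three Koszul complexes over such an algebra -/

namespace WordAlgebra

variable {k A : Type*} [Field k] [CharZero k] [Ring A] [Algebra k A] {n N : ℕ}
  (W : WordAlgebra k A n N)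

omit [CharZero k] in
lemma expand (a : A) : a = (W.basis.repr a).sum fun w c => c • wordProd W.x w.1 := by
  conv_lhs => rw [← W.basis.linearCombination_repr a, Finsupp.linearCombination_apply]
  simp only [W.basis_apply]

omit [CharZero k] in
lemma rev_rev (a : A) : W.rev (W.rev a) = a := by
  have : W.rev ∘ₗ W.rev = LinearMap.id := by
    refine W.basis.ext fun w => ?_
    simp [W.basis_apply, W.rev_wordProd]
  exact LinearMap.congr_fun this a

lemma factorial_smul_eq_zero (k : Type*) [Field k] [CharZero k] {B : Type*} [AddCommGroup B]
    [Module k B] (N : ℕ) (b : B) (h : N.factorial • b = 0) : b = 0 := by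
  rw [← Nat.cast_smul_eq_nsmul k] at h
  exact (smul_eq_zero.1 h).resolve_left (by exact_mod_cast N.factorial_ne_zero)

lemma lt_antisymm_iff (s t : Fin n) (h : s ≠ t) : s < t ↔ ¬ t < s :=
  ⟨fun h => not_lt_of_gt h, fun h' => lt_of_le_of_ne (not_lt.1 h') h⟩

lemma gt_antisymm_iff (s t : Fin n) (h : s ≠ t) : s > t ↔ ¬ t > s :=
  lt_antisymm_iff t s h.symm

lemma rightOp_zero_pow {R B : Type*} [Ring R] [AddCommGroup B] [Module R B] (hN : 2 ≤ N) :
    rightOp (fun _ : Fin n => (0 : Module.End R B)) ^ N = 0 := by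
  have : rightOp (fun _ : Fin n => (0 : Module.End R B)) = 0 := by
    refine LinearMap.ext fun f => funext fun S => ?_
    simp [koszulOp_apply]
  rw [this, zero_pow (by omega)]

section Tensor

variable (M : Type*) [AddCommGroup M] [Module k M] [Module A M] [IsScalarTower k A M]

/-- The action of the generators on the coefficients. -/
def tensorRight (s : Fin n) : Module.End A (A ⊗[k] M) :=
  AlgebraTensorModule.map LinearMap.id (Algebra.lsmul k k M (W.x s))

omit [CharZero k] in
lemma tensorRight_tmul (s : Fin n) (a : A) (m : M) :
    W.tensorRight M s (a ⊗ₜ m) = a ⊗ₜ (W.x s • m) := by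
  simp [tensorRight]

omit [CharZero k] in
lemma prod_tensorRight (L : List (Fin n)) (a : A) (m : M) :
    (L.map (W.tensorRight M)).prod (a ⊗ₜ m) = a ⊗ₜ (wordProd W.x L • m) := by
  induction L with
  | nil => simp
  | cons s L ih =>
    rw [List.map_cons, List.prod_cons, Module.End.mul_apply, ih, tensorRight_tmul, smul_smul]
    simp [wordProd]

omit [CharZero k] in
lemma antisymmProd_tensorRight (v : Fin N → Fin n) (a : A) (m : M) :
    antisymmProd (W.tensorRight M) v (a ⊗ₜ m) = a ⊗ₜ[k] (antisymmProd W.x v • m) := by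
  rw [antisymmProd, LinearMap.sum_apply, antisymmProd, Finset.sum_smul, TensorProduct.tmul_sum]
  refine Finset.sum_congr rfl fun σ _ => ?_
  have h : (List.ofFn fun j => W.tensorRight M (v (σ j))) =
      (List.ofFn fun j => v (σ j)).map (W.tensorRight M) := by
    rw [List.map_ofFn]; rfl
  have h2 : (List.ofFn fun j => W.x (v (σ j))).prod = wordProd W.x (List.ofFn fun j => v (σ j)) := by
    rw [wordProd, List.map_ofFn]; rfl
  rw [LinearMap.smul_apply, h, prod_tensorRight, h2]
  rcases Int.units_eq_one_or (Equiv.Perm.sign σ) with e | e <;> simp [e, TensorProduct.tmul_neg]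

/-- The bimodule Koszul complex tensored with the module `M`. -/
def tensorModule : WordModule n N A (A ⊗[k] M) M where
  l := tensorLeft k M W.x
  ρ := W.tensorRight M
  comm s t := by
    refine LinearMap.ext fun z => ?_
    induction z using TensorProduct.induction_on with
    | zero => simp
    | tmul a b => simp [tensorRight_tmul]
    | add x y hx hy => rw [map_add, map_add, hx, hy]
  left_pow := by
    refine koszulOp_pow_eq_zero _ lt_antisymm_iff _ N (factorial_smul_eq_zero k N) fun v hv => ?_
    refine LinearMap.ext fun z => ?_
    induction z using TensorProduct.induction_on with
    | zero => simp
    | tmul a b => simp [antisymmProd_tensorLeft, W.antisymmProd_eq_zero v hv]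
    | add x y hx hy => rw [map_add, map_add, hx, hy]
  right_pow := by
    refine koszulOp_pow_eq_zero _ gt_antisymm_iff _ N (factorial_smul_eq_zero k N) fun v hv => ?_
    refine LinearMap.ext fun z => ?_
    induction z using TensorProduct.induction_on with
    | zero => simp
    | tmul a b => simp [antisymmProd_tensorRight, W.antisymmProd_eq_zero v hv]
    | add x y hx hy => rw [map_add, map_add, hx, hy]
  β w := (TensorProduct.mk k A M (wordProd W.x w)).toAddMonoidHom
  y s m := W.x s • m
  l_β s w m := by simp [wordProd_append]
  ρ_β s w m := by simp [tensorRight_tmul]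
  coord := (TensorProduct.equivFinsuppOfBasisLeft W.basis).toLinearMap.toAddMonoidHom
  expand b := by
    have h := (TensorProduct.equivFinsuppOfBasisLeft (N := M) W.basis).symm_apply_apply b
    rw [TensorProduct.equivFinsuppOfBasisLeft_symm_apply] at h
    simpa [W.basis_apply] using h.symm
  coord_β_le w m w' h := by
    refine W.repr_le w w' fun h0 => h ?_
    simp [h0]
  coord_β_self w m := by
    simp [← W.basis_apply]

end Tensor

/-- The Koszul complex of the trivial module. -/
def trivialWordModule (hN : 2 ≤ N) : WordModule n N A A k where
  l s := LinearMap.toSpanSingleton A A (W.x s)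
  ρ _ := 0
  comm s t := Commute.zero_right _
  left_pow := by
    refine koszulOp_pow_eq_zero _ lt_antisymm_iff _ N (factorial_smul_eq_zero k N) fun v hv => ?_
    have h := map_antisymmProd (RingEquiv.moduleEndSelf A) (fun s => MulOpposite.op (W.x s)) v
    rw [AntisymmetrizerAlgebra.antisymmProd_op, W.antisymmProd_eq_zero v hv, MulOpposite.op_zero,
      smul_zero, map_zero] at h
    rw [h]
    rfl
  right_pow := rightOp_zero_pow hN
  β w := (LinearMap.toSpanSingleton k A (wordProd W.x w)).toAddMonoidHom
  y _ _ := 0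
  l_β s w m := by simp [wordProd_append]
  ρ_β s w m := by simp
  coord := W.basis.repr.toLinearMap.toAddMonoidHom
  expand b := by simpa using W.expand b
  coord_β_le w m w' h := by
    refine W.repr_le w w' fun h0 => h ?_
    simp [h0]
  coord_β_self w m := by
    simp [← W.basis_apply]

/-- The Koszul complex of right modules. -/
def rightWordModule (hN : 2 ≤ N) : WordModule n N k A k where
  l s := LinearMap.mulLeft k (W.x s)
  ρ _ := 0
  comm s t := Commute.zero_right _
  left_pow := by
    refine koszulOp_pow_eq_zero _ lt_antisymm_iff _ N (factorial_smul_eq_zero k N) fun v hv => ?_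
    have := map_antisymmProd (Algebra.lmul k A) W.x v
    rw [W.antisymmProd_eq_zero v hv, map_zero] at this
    exact this.symm
  right_pow := rightOp_zero_pow hN
  -- Left multiplication by `x s` appends `s` only if words are read backwards; `rev` transports the
  -- basis accordingly.
  β w := (LinearMap.toSpanSingleton k A (wordProd W.x w.reverse)).toAddMonoidHom
  y _ _ := 0
  l_β s w m := by simp [wordProd]
  ρ_β s w m := by simp
  coord := (W.basis.repr.toLinearMap ∘ₗ W.rev).toAddMonoidHom
  expand b := by
    have h := congrArg W.rev (W.expand (W.rev b))
    rw [W.rev_rev, Finsupp.sum, map_sum] at h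
    simpa [W.rev_wordProd, Finsupp.sum] using h
  coord_β_le w m w' h := by
    refine W.repr_le w w' fun h0 => h ?_
    simp [W.rev_wordProd, h0]
  coord_β_self w m := by
    simp [W.rev_wordProd, ← W.basis_apply]

end WordAlgebra

open CategoryTheory

/-! ### Projective resolutions of modules from exact sequences -/

section ModuleResolution

variable {R : Type u} [Ring R] (P : ℕ → ModuleCat.{u} R) (d : ∀ i, P (i + 1) ⟶ P i)
  {Z : ModuleCat.{u} R} (μ : P 0 ⟶ Z)

lemma moduleComplex_d_comp_d (hd : ∀ i, Function.Exact (d (i + 1)) (d i)) (i : ℕ) :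
    d (i + 1) ≫ d i = 0 := by
  ext x
  exact (hd i).apply_apply_eq_zero x

lemma moduleComplex_d_comp_aug (h0 : Function.Exact (d 0) μ) : d 0 ≫ μ = 0 := by
  ext x
  exact h0.apply_apply_eq_zero x

/-- The complex of modules of an exact sequence. -/
abbrev moduleComplex (hd : ∀ i, Function.Exact (d (i + 1)) (d i)) : ChainComplex (ModuleCat.{u} R) ℕ :=
  ChainComplex.of P d (moduleComplex_d_comp_d P d hd)

lemma moduleComplex_d (hd : ∀ i, Function.Exact (d (i + 1)) (d i)) (i : ℕ) :
    (moduleComplex P d hd).d (i + 1) i = d i :=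
  ChainComplex.of_d ..

/-- A projective resolution of a module built from an exact sequence. -/
def moduleResolution (hP : ∀ i, Projective (P i)) (hμ : Function.Surjective μ)
    (h0 : Function.Exact (d 0) μ) (hd : ∀ i, Function.Exact (d (i + 1)) (d i)) :
    ProjectiveResolution Z where
  complex := moduleComplex P d hd
  projective := hP
  π := (ChainComplex.toSingle₀Equiv (moduleComplex P d hd) Z).symm ⟨μ, by
    have : (moduleComplex P d hd).d 1 0 = d 0 := moduleComplex_d P d hd 0
    rw [this]
    exact moduleComplex_d_comp_aug P d μ h0⟩
  quasiIso := ⟨fun n => by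
    cases n with
    | zero =>
      rw [ChainComplex.quasiIsoAt₀_iff, ShortComplex.quasiIso_iff_of_zeros']
      · refine (ShortComplex.exact_and_epi_g_iff_of_iso
          (S₂ := ShortComplex.mk (d 0) μ (moduleComplex_d_comp_aug P d μ h0)) ?_).2
          ⟨?_, ?_⟩
        · refine ShortComplex.isoMk (Iso.refl _) (Iso.refl _) (Iso.refl _) ?_ ?_
          · have := moduleComplex_d P d hd 0
            refine (Category.id_comp _).trans (Eq.trans ?_ (Category.comp_id _).symm)
            exact this.symm
          · refine (Category.id_comp _).trans (Eq.trans ?_ (Category.comp_id _).symm)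
            exact (ChainComplex.toSingle₀Equiv_symm_apply_f_zero (C := moduleComplex P d hd) μ _).symm
        · rw [ShortComplex.ShortExact.moduleCat_exact_iff_function_exact]
          exact h0
        · rw [ModuleCat.epi_iff_surjective]
          exact hμ
      all_goals rfl
    | succ n =>
      rw [quasiIsoAt_iff_exactAt' _ _ (ChainComplex.exactAt_succ_single_obj Z n)]
      rw [HomologicalComplex.exactAt_iff' _ (n + 2) (n + 1) n (by simp) (by simp)]
      rw [ShortComplex.ShortExact.moduleCat_exact_iff_function_exact]
      have h1 := moduleComplex_d P d hd (n + 1)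
      have h2 := moduleComplex_d P d hd n
      have := hd n
      rw [← h1, ← h2] at this
      exact this⟩

variable {P d μ}
variable {hP : ∀ i, Projective (P i)} {hμ : Function.Surjective μ}
    {h0 : Function.Exact (d 0) μ} {hd : ∀ i, Function.Exact (d (i + 1)) (d i)}

lemma moduleResolution_d (i : ℕ) :
    (moduleResolution P d μ hP hμ h0 hd).complex.d (i + 1) i = d i :=
  moduleComplex_d P d hd i

variable {Y : ModuleCat.{u} R}

variable (hP hμ h0 hd) in
/-- The class in `Ext` of a cocycle. -/
def extClass {i : ℕ} (f : P i ⟶ Y) (hf : d i ≫ f = 0) : Abelian.Ext Z Y i :=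
  (moduleResolution P d μ hP hμ h0 hd).extMk f (i + 1) rfl (by rw [moduleResolution_d]; exact hf)

lemma extClass_surjective {i : ℕ} (e : Abelian.Ext Z Y i) :
    ∃ (f : P i ⟶ Y) (hf : d i ≫ f = 0), extClass hP hμ h0 hd f hf = e := by
  obtain ⟨f, hf, h⟩ := (moduleResolution P d μ hP hμ h0 hd).extMk_surjective e (i + 1) rfl
  exact ⟨f, by rw [moduleResolution_d] at hf; exact hf, h⟩

lemma extClass_eq_zero_iff {i : ℕ} (f : P (i + 1) ⟶ Y) (hf : d (i + 1) ≫ f = 0) :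
    extClass hP hμ h0 hd f hf = 0 ↔ ∃ g : P i ⟶ Y, d i ≫ g = f := by
  have := (moduleResolution P d μ hP hμ h0 hd).extMk_eq_zero_iff (Y := Y) f (i + 2) rfl
    (by rw [moduleResolution_d]; exact hf) i rfl
  refine this.trans ⟨fun ⟨g, h⟩ => ⟨g, ?_⟩, fun ⟨g, h⟩ => ⟨g, ?_⟩⟩
  · exact (congrArg (· ≫ g) (moduleResolution_d i)).symm.trans h
  · exact (congrArg (· ≫ g) (moduleResolution_d i)).trans h

lemma extClass_zero {i : ℕ} : extClass hP hμ h0 hd (0 : P i ⟶ Y) (by simp) = 0 :=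
  (moduleResolution P d μ hP hμ h0 hd).extMk_zero (i + 1) rfl

lemma extClass_add {i : ℕ} (f g : P i ⟶ Y) (hf : d i ≫ f = 0) (hg : d i ≫ g = 0) :
    extClass hP hμ h0 hd (f + g) (by rw [Preadditive.comp_add, hf, hg, add_zero]) =
      extClass hP hμ h0 hd f hf + extClass hP hμ h0 hd g hg :=
  ((moduleResolution P d μ hP hμ h0 hd).add_extMk f g (i + 1) rfl _ _).symm

lemma extClass_comp {i : ℕ} (f : P i ⟶ Y) (hf : d i ≫ f = 0) (g : Y ⟶ Y) :
    (extClass hP hμ h0 hd f hf).comp (Abelian.Ext.mk₀ g) (add_zero i) =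
      extClass hP hμ h0 hd (f ≫ g) (by rw [← Category.assoc, hf, Limits.zero_comp]) :=
  (moduleResolution P d μ hP hμ h0 hd).extMk_comp_mk₀ f (i + 1) rfl _ g

end ModuleResolution

/-! ### The Koszul resolution -/

section Restrict

variable {n : ℕ} {R B : Type*} [Ring R] [AddCommGroup B] [Module R B]

/-- The sets of `j` letters. -/
abbrev CardSet (n j : ℕ) : Type := {S : Finset (Fin n) // S.card = j}

variable (R B) in
/-- Extension by zero. -/
def extendZero (j : ℕ) : (CardSet n j → B) →ₗ[R] (Finset (Fin n) → B) where
  toFun f S := if h : S.card = j then f ⟨S, h⟩ else 0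
  map_add' f g := by ext S; by_cases h : S.card = j <;> simp [h]
  map_smul' a f := by ext S; by_cases h : S.card = j <;> simp [h]

variable (R B) in
/-- Restriction to the sets with `j` elements. -/
def restrictCard (j : ℕ) : (Finset (Fin n) → B) →ₗ[R] (CardSet n j → B) :=
  LinearMap.funLeft R B Subtype.val

lemma restrictCard_apply {j : ℕ} (f : Finset (Fin n) → B) (S : CardSet n j) :
    restrictCard R B j f S = f S.1 := rfl

lemma restrictCard_extendZero {j : ℕ} (f : CardSet n j → B) :
    restrictCard R B j (extendZero R B j f) = f := by
  ext S
  simp [restrictCard_apply, extendZero, S.2]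

lemma extendZero_apply {j : ℕ} (f : CardSet n j → B) (S : CardSet n j) :
    extendZero R B j f S.1 = f S := by
  simp [extendZero, S.2]

lemma extendZero_mem {j : ℕ} (f : CardSet n j → B) : extendZero R B j f ∈ cardSupp n R B j := by
  intro S hS
  simp [extendZero, hS]

lemma extendZero_restrictCard {j : ℕ} {f : Finset (Fin n) → B} (hf : f ∈ cardSupp n R B j) :
    extendZero R B j (restrictCard R B j f) = f := by
  ext S
  by_cases h : S.card = j
  · simp [extendZero, h, restrictCard_apply]
  · simp [extendZero, h, hf S h]

lemma extendZero_single {j : ℕ} (S : CardSet n j) (b : B) :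
    extendZero R B j (Pi.single S b) = Pi.single S.1 b := by
  ext T
  by_cases h : T.card = j
  · by_cases e : T = S.1
    · subst e
      simp [extendZero, h]
    · have : (⟨T, h⟩ : CardSet n j) ≠ S := fun e' => e (congrArg Subtype.val e')
      simp [extendZero, h, e, this]
  · have : T ≠ S.1 := fun e => h (e ▸ S.2)
    simp [extendZero, h, this]

end Restrict

namespace WordModule

section

variable {n N : ℕ} {R B M : Type*} [Ring R] [AddCommGroup B] [Module R B]
    [AddCommGroup M] (W : WordModule n N R B M)

/-- The differential of the Koszul complex. -/
def koszulMap (i : ℕ) : (CardSet n (jump N (i + 1)) → B) →ₗ[R] (CardSet n (jump N i) → B) :=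
  restrictCard R B _ ∘ₗ W.d i ∘ₗ extendZero R B _

lemma d_mem (hN : 2 ≤ N) (i : ℕ) {f : Finset (Fin n) → B}
    (hf : f ∈ cardSupp n R B (jump N (i + 1))) : W.d i f ∈ cardSupp n R B (jump N i) :=
  koszulDiff_mem (by omega) _ _ _ hf

lemma extendZero_koszulMap (hN : 2 ≤ N) (i : ℕ) (f : CardSet n (jump N (i + 1)) → B) :
    extendZero R B _ (W.koszulMap i f) = W.d i (extendZero R B _ f) :=
  extendZero_restrictCard (W.d_mem hN i (extendZero_mem f))

lemma koszulMap_exact (hN : 2 ≤ N) (i : ℕ) :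
    Function.Exact (W.koszulMap (i + 1)) (W.koszulMap i) := by
  intro f
  constructor
  · intro h
    have h1 : W.d i (extendZero R B _ f) = 0 := by
      rw [← W.extendZero_koszulMap hN, h, map_zero]
    obtain ⟨g, hg, e⟩ := W.exact_succ hN i (extendZero_mem f) h1
    refine ⟨restrictCard R B _ g, ?_⟩
    rw [koszulMap, LinearMap.comp_apply, LinearMap.comp_apply, extendZero_restrictCard hg, e,
      restrictCard_extendZero]
  · rintro ⟨g, rfl⟩
    rw [← restrictCard_extendZero (R := R) (W.koszulMap i _), W.extendZero_koszulMap hN,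
      W.extendZero_koszulMap hN, W.d_d, map_zero]

/-- The empty set. -/
def emptyCard : CardSet n (jump N 0) := ⟨∅, by simp [jump]⟩

lemma koszulMap_exact_zero {Z : Type*} [AddCommGroup Z] (hN : 2 ≤ N) (μ : B →+ Z)
    (hμ : ∀ s b, μ (W.l s b) = μ (W.ρ s b)) (hinj : ∀ m, μ (W.β [] m) = 0 → m = 0) :
    Function.Exact (W.koszulMap 0) fun f => μ (f emptyCard) := by
  have hj0 : jump N 0 = 0 := by simp [jump]
  have hj1 : jump N 1 = 1 := by simp [jump]
  intro f
  constructor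
  · intro h
    have hf : extendZero R B _ f ∈ cardSupp n R B 0 := by
      have e : cardSupp n R B 0 = cardSupp n R B (jump N 0) := by rw [hj0]
      rw [e]
      exact extendZero_mem f
    have h1 : μ (extendZero R B _ f ∅) = 0 := by
      rw [← h]
      exact congrArg μ (extendZero_apply (R := R) f emptyCard)
    obtain ⟨g, hg, e⟩ := W.exact_zero (by omega) μ hμ hinj hf h1
    rw [← hj1] at hg
    refine ⟨restrictCard R B _ g, ?_⟩
    rw [koszulMap, LinearMap.comp_apply, LinearMap.comp_apply, extendZero_restrictCard hg, e,
      restrictCard_extendZero]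
  · rintro ⟨g, rfl⟩
    exact W.aug_d_zero μ hμ (extendZero R B _ g)

end

section Resolution

variable {n N : ℕ} {R B : Type u} {M : Type*} [Ring R] [AddCommGroup B] [Module R B]
    [AddCommGroup M] (W : WordModule n N R B M)

/-- The modules of the Koszul complex. -/
abbrev koszulObj (_ : WordModule n N R B M) (i : ℕ) : ModuleCat.{u} R :=
  ModuleCat.of R (CardSet n (jump N i) → B)

/-- The differentials of the Koszul complex. -/
abbrev koszulHom (i : ℕ) : W.koszulObj (i + 1) ⟶ W.koszulObj i := ModuleCat.ofHom (W.koszulMap i)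

lemma koszulObj_projective [Module.Free R B] (i : ℕ) : Projective (W.koszulObj i) := by
  have : Module.Projective R (CardSet n (jump N i) → B) := inferInstance
  infer_instance

variable {Z : ModuleCat.{u} R} (μ : B →ₗ[R] Z)

/-- The augmentation of the Koszul complex. -/
abbrev koszulAug : W.koszulObj 0 ⟶ Z :=
  ModuleCat.ofHom (μ ∘ₗ LinearMap.proj emptyCard)

lemma koszulAug_surjective (hμ : Function.Surjective μ) : Function.Surjective (W.koszulAug μ) := by
  intro z
  obtain ⟨b, rfl⟩ := hμ z
  exact ⟨fun _ => b, rfl⟩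

end Resolution

end WordModule

/-! ### Vanishing of `Ext` and the global dimension -/

section Dimension

lemma jump_lt_jump {N : ℕ} (hN : 2 ≤ N) {i j : ℕ} (h : i < j) : jump N i < jump N j := by
  refine strictMono_nat_of_lt_succ (fun i => ?_) h
  rw [jump_succ (by omega)]
  unfold stepLen
  split_ifs <;> omega

lemma le_jump {N : ℕ} (hN : 2 ≤ N) (i : ℕ) : i ≤ jump N i :=
  StrictMono.le_apply (f := jump N) fun _ _ h => jump_lt_jump hN h

lemma isEmpty_cardSet {n j : ℕ} (h : n < j) : IsEmpty (CardSet n j) := by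
  refine ⟨fun S => ?_⟩
  have := Finset.card_le_univ S.1
  rw [S.2, Fintype.card_fin] at this
  omega

/-- `T` will be the length of the Koszul resolution, hence the global dimension; it is positive
because `jump N 1 = 1`. -/
lemma exists_jump_le {N n : ℕ} (hN : 2 ≤ N) (hn : 1 ≤ n) :
    ∃ T, T ≠ 0 ∧ jump N T ≤ n ∧ n < jump N (T + 1) := by
  have hex : ∃ T, n < jump N (T + 1) := ⟨n, Nat.lt_of_lt_of_le n.lt_succ_self (le_jump hN _)⟩
  have hT0 : Nat.find hex ≠ 0 := fun h => by
    have := Nat.find_spec hex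
    rw [h] at this
    simp [jump] at this
    omega
  refine ⟨Nat.find hex, hT0, ?_, Nat.find_spec hex⟩
  obtain ⟨T, hT⟩ := Nat.exists_eq_succ_of_ne_zero hT0
  have := Nat.find_min hex (m := T) (by omega)
  rw [hT]
  exact not_lt.1 this

lemma eq_zero_of_mem_cardSupp {n j : ℕ} {R B : Type*} [Ring R] [AddCommGroup B] [Module R B]
    {f : Finset (Fin n) → B} (hf : f ∈ cardSupp n R B j) (h : n < j) : f = 0 := by
  ext S
  refine hf S fun e => ?_
  have := Finset.card_le_univ S
  rw [e, Fintype.card_fin] at this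
  omega

namespace WordModule

variable {n N : ℕ} {R B : Type u} {M : Type*} [Ring R] [AddCommGroup B] [Module R B]
    [AddCommGroup M] (W : WordModule n N R B M)

lemma koszulObj_hom_eq_zero {i : ℕ} (h : n < jump N i) {Y : ModuleCat.{u} R}
    (f : W.koszulObj i ⟶ Y) : f = 0 := by
  have := isEmpty_cardSet h
  refine ModuleCat.hom_ext (LinearMap.ext fun x => ?_)
  have hx : x = 0 := Subsingleton.elim (α := CardSet n (jump N i) → B) x 0
  rw [hx, map_zero, map_zero]

variable [Module.Free R B] {Z : ModuleCat.{u} R} {μ : B →ₗ[R] Z}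

omit [Module.Free R B] in
lemma koszulAug_exact (hN : 2 ≤ N) (hμl : ∀ s b, μ (W.l s b) = μ (W.ρ s b))
    (hinj : ∀ m, μ (W.β [] m) = 0 → m = 0) : Function.Exact (W.koszulHom 0) (W.koszulAug μ) :=
  W.koszulMap_exact_zero hN μ.toAddMonoidHom hμl hinj

lemma subsingleton_ext (hN : 2 ≤ N) (hμ : Function.Surjective μ)
    (hμl : ∀ s b, μ (W.l s b) = μ (W.ρ s b)) (hinj : ∀ m, μ (W.β [] m) = 0 → m = 0)
    {i : ℕ} (hi : n < jump N i) (Y : ModuleCat.{u} R) : Subsingleton (Abelian.Ext Z Y i) := by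
  refine ⟨fun e e' => ?_⟩
  obtain ⟨f, hf, rfl⟩ := extClass_surjective (hP := W.koszulObj_projective)
    (hμ := W.koszulAug_surjective μ hμ) (h0 := W.koszulAug_exact hN hμl hinj)
    (hd := W.koszulMap_exact hN) e
  obtain ⟨f', hf', rfl⟩ := extClass_surjective (hP := W.koszulObj_projective)
    (hμ := W.koszulAug_surjective μ hμ) (h0 := W.koszulAug_exact hN hμl hinj)
    (hd := W.koszulMap_exact hN) e'
  obtain rfl : f = f' := (W.koszulObj_hom_eq_zero hi f).trans (W.koszulObj_hom_eq_zero hi f').symm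
  rfl

end WordModule

namespace WordAlgebra

variable {k A : Type u} [Field k] [CharZero k] [Ring A] [Algebra k A] {n N : ℕ}
  (W : WordAlgebra k A n N)

-- The Koszul complex with coefficients in `M` consists of free modules, since `A ⊗ M` is free over
-- `A`, and it resolves `M` through the action map. It has no terms once `jump N i` exceeds `n`.
include W in
lemma hasProjectiveDimensionLT (hN : 2 ≤ N) {T : ℕ} (hT : n < jump N T) (M : ModuleCat.{u} A) :
    HasProjectiveDimensionLT M T := by
  let _ : Module k M := Module.compHom M (algebraMap k A)
  have : IsScalarTower k A M := ⟨fun c a m => by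
    rw [Algebra.smul_def, mul_smul]
    rfl⟩
  let V := W.tensorModule M
  let μ : A ⊗[k] M →ₗ[A] M :=
    AlgebraTensorModule.lift (LinearMap.toSpanSingleton A (M →ₗ[k] M) LinearMap.id)
  have hμ : ∀ a m, μ (a ⊗ₜ m) = a • m := fun a m => by simp [μ]
  rw [hasProjectiveDimensionLT_iff]
  intro i hi Y e
  have : Subsingleton (Abelian.Ext M Y i) := by
    refine V.subsingleton_ext (μ := μ) hN (fun m => ⟨1 ⊗ₜ m, by rw [hμ, one_smul]⟩) ?_ ?_
      (hT.trans_le ?_) Y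
    · intro s b
      induction b using TensorProduct.induction_on with
      | zero => simp
      | tmul a m =>
        change μ (tensorLeft k M W.x s (a ⊗ₜ m)) = μ (W.tensorRight M s (a ⊗ₜ m))
        rw [tensorLeft_tmul, tensorRight_tmul, hμ, hμ, mul_smul]
      | add x y hx hy => rw [map_add, map_add, map_add, map_add, hx, hy]
    · intro m h
      change μ ((1 : A) ⊗ₜ m) = 0 at h
      rwa [hμ, one_smul] at h
    · rcases hi.eq_or_lt with rfl | h
      · exact le_rfl
      · exact (jump_lt_jump hN h).le
  exact Subsingleton.elim _ _

include W in
lemma leftGlobalDimension_le (hN : 2 ≤ N) {D : ℕ} (hD : n < jump N (D + 1)) :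
    leftGlobalDimension A ≤ (D : WithBot ℕ∞) := by
  refine iSup_le fun M => ?_
  rw [projectiveDimension_le_iff]
  exact W.hasProjectiveDimensionLT hN hD M

end WordAlgebra

end Dimension

/-! ### The trivial module -/

section Trivial

variable {k A : Type u} [Field k] [Ring A] [Algebra k A]

/-- The augmentation as a linear map to the trivial module. -/
def augLinear (ε : A →ₐ[k] k) : A →ₗ[A] trivialModule ε where
  toFun a := (ε a : k)
  map_add' a b := map_add ε a b
  map_smul' a b := map_mul ε a b

lemma augLinear_surjective (ε : A →ₐ[k] k) : Function.Surjective (augLinear ε) := fun c =>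
  ⟨algebraMap k A c, ε.commutes c⟩

namespace WordAlgebra

variable [CharZero k] {n N : ℕ} (W : WordAlgebra k A n N) (hN : 2 ≤ N)

omit [CharZero k] in
lemma augLinear_mul_x (s : Fin n) (b : A) : augLinear W.ε (b * W.x s) = augLinear W.ε 0 := by
  change W.ε (b * W.x s) = W.ε 0
  rw [map_mul, W.ε_x, mul_zero, map_zero]

omit [CharZero k] in
lemma eq_zero_of_augmentation_smul_one {c : k} (h : W.ε (c • (1 : A)) = 0) : c = 0 := by
  simpa using h

/-- The classes of cocycles for the Koszul resolution of the trivial module. -/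
def cls {i : ℕ} (f : (W.trivialWordModule hN).koszulObj i ⟶ ModuleCat.of A A)
    (hf : (W.trivialWordModule hN).koszulHom i ≫ f = 0) :
    Abelian.Ext (trivialModule W.ε) (ModuleCat.of A A) i :=
  extClass (μ := (W.trivialWordModule hN).koszulAug (augLinear W.ε))
    (W.trivialWordModule hN).koszulObj_projective
    ((W.trivialWordModule hN).koszulAug_surjective _ (augLinear_surjective W.ε))
    ((W.trivialWordModule hN).koszulAug_exact hN
      W.augLinear_mul_x fun _ => W.eq_zero_of_augmentation_smul_one)
    ((W.trivialWordModule hN).koszulMap_exact hN) f hf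

end WordAlgebra

end Trivial

/-! ### Self-duality of the Koszul complex -/

section Pairing

/-- Only the summand without a factor `rightOp` survives, so the differentials alternate between `D`
and `D ^ (N - 1)`. -/
lemma koszulDiff_zero_right {n N : ℕ} {R B : Type*} [Ring R] [AddCommGroup B] [Module R B]
    (hN : 2 ≤ N) (l : Fin n → Module.End R B) (i : ℕ) :
    koszulDiff N l (fun _ => 0) i = leftOp l ^ stepLen N i := by
  have h0 : rightOp (fun _ : Fin n => (0 : Module.End R B)) = 0 := by
    refine LinearMap.ext fun f => funext fun S => ?_
    simp [koszulOp_apply]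
  unfold koszulDiff stepLen
  rw [h0]
  split_ifs
  · rw [sub_zero, pow_one]
  · rw [Finset.sum_eq_single (N - 1)]
    · simp
    · intro a ha hne
      rw [Finset.mem_range] at ha
      rw [zero_pow (by omega), mul_zero]
    · intro h
      exact absurd (Finset.mem_range.2 (by omega)) h

variable {k A : Type*} [Field k] [Ring A] [Algebra k A] {n : ℕ} (x : Fin n → A)

/-- Contraction with right multiplication by the generators. -/
abbrev contrRight : Module.End A (Finset (Fin n) → A) :=
  leftOp fun s => LinearMap.toSpanSingleton A A (x s)

variable (k) in
/-- Contraction with left multiplication by the generators. -/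
abbrev contrLeft : Module.End k (Finset (Fin n) → A) :=
  leftOp fun s => LinearMap.mulLeft k (x s)

lemma contrRight_apply (f : Finset (Fin n) → A) (S : Finset (Fin n)) :
    contrRight x f S = ∑ s ∈ Sᶜ, moveSign (· < ·) s S • (f (insert s S) * x s) := by
  rw [contrRight, leftOp, koszulOp_apply, ← Finset.sum_filter_add_sum_filter_not _ (· ∈ S),
    Finset.sum_eq_zero, zero_add]
  · have : Finset.univ.filter (fun s => s ∉ S) = Sᶜ := by ext; simp
    rw [this]
    refine Finset.sum_congr rfl fun s hs => ?_
    rw [if_neg (by simpa using hs)]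
    simp
  · intro s hs
    rw [if_pos (by simpa using hs)]

lemma contrLeft_apply (f : Finset (Fin n) → A) (S : Finset (Fin n)) :
    contrLeft k x f S = ∑ s ∈ Sᶜ, moveSign (· < ·) s S • (x s * f (insert s S)) := by
  rw [contrLeft, leftOp, koszulOp_apply, ← Finset.sum_filter_add_sum_filter_not _ (· ∈ S),
    Finset.sum_eq_zero, zero_add]
  · have : Finset.univ.filter (fun s => s ∉ S) = Sᶜ := by ext; simp
    rw [this]
    refine Finset.sum_congr rfl fun s hs => ?_
    rw [if_neg (by simpa using hs)]
    simp
  · intro s hs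
    rw [if_pos (by simpa using hs)]

/-- Each contraction contributes one generator. With `c = 0` this detects constant terms, and in the
dual numbers with `c = eps` it detects linear terms. -/
lemma contrRight_pow_dvd {Q : Type*} [CommRing Q] (ψ : A →+* Q) {c : Q} (hc : ∀ s, ψ (x s) = c)
    (r : ℕ) (f : Finset (Fin n) → A) (S : Finset (Fin n)) :
    c ^ r ∣ ψ ((contrRight x ^ r) f S) := by
  induction r generalizing S with
  | zero => simp
  | succ r ih =>
    rw [pow_succ' (contrRight x), Module.End.mul_apply, contrRight_apply, map_sum, pow_succ]
    refine Finset.dvd_sum fun s _ => ?_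
    rw [map_zsmul, map_mul, hc, zsmul_eq_mul]
    exact Dvd.dvd.mul_left (mul_dvd_mul_right (ih _) c) _

lemma contrRight_pow_mem {V : Submodule k A} (hV : ∀ s, x s ∈ V) (r : ℕ)
    {f : Finset (Fin n) → A} (hf : ∀ S, f S ∈ V ^ 0) (S : Finset (Fin n)) :
    (contrRight x ^ r) f S ∈ V ^ r := by
  induction r generalizing S with
  | zero => exact hf S
  | succ r ih =>
    rw [pow_succ' (contrRight x), Module.End.mul_apply, contrRight_apply, pow_succ]
    refine Submodule.sum_mem _ fun s _ => zsmul_mem ?_ _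
    exact Submodule.mul_mem_mul (ih _) (hV s)

/-- The sign of the set `S` in the duality pairing. -/
def dualSign (S : Finset (Fin n)) : ℤ := ∏ t ∈ S, moveSign (· < ·) t Finset.univ

lemma moveSign_mul_self (r : Fin n → Fin n → Prop) [DecidableRel r] (s : Fin n)
    (S : Finset (Fin n)) : moveSign r s S * moveSign r s S = 1 := by
  rw [moveSign, ← mul_pow]
  simp

lemma dualSign_mul_self (S : Finset (Fin n)) : dualSign S * dualSign S = 1 := by
  rw [dualSign, ← Finset.prod_mul_distrib]
  exact Finset.prod_eq_one fun s _ => moveSign_mul_self _ _ _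

lemma moveSign_univ (s : Fin n) (S : Finset (Fin n)) :
    moveSign (· < ·) s Finset.univ =
      moveSign (· < ·) s (S.erase s) * moveSign (· < ·) s Sᶜ := by
  unfold moveSign
  rw [← pow_add, ← Finset.card_union_of_disjoint, ← Finset.filter_union]
  · congr 2
    ext t
    simp only [Finset.mem_filter, Finset.mem_univ, true_and, Finset.mem_union, Finset.mem_erase,
      Finset.mem_compl]
    constructor
    · intro h
      exact ⟨by by_cases ht : t ∈ S <;> simp [ht, h.ne'], h⟩
    · exact fun h => h.2
  · refine Finset.disjoint_filter_filter ?_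
    exact Disjoint.mono_left (Finset.erase_subset _ _) disjoint_compl_right

/-- `dualSign` is chosen so that removing `s` from `S` and removing it from the complement are
adjoint with no sign left over. -/
lemma dualSign_erase {s : Fin n} {S : Finset (Fin n)} (hs : s ∈ S) :
    dualSign (S.erase s) * moveSign (· < ·) s (S.erase s) =
      dualSign S * moveSign (· < ·) s Sᶜ := by
  have h : dualSign S = moveSign (· < ·) s Finset.univ * dualSign (S.erase s) :=
    (Finset.mul_prod_erase S (fun t => moveSign (· < ·) t Finset.univ) hs).symm
  rw [h, moveSign_univ s S]
  linear_combination (-dualSign (S.erase s) * moveSign (· < ·) s (S.erase s)) *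
    moveSign_mul_self (· < ·) s Sᶜ

/-- The duality pairing. -/
def dualPairing (h : Finset (Fin n) → A) : (Finset (Fin n) → A) →ₗ[A] A :=
  ∑ S, dualSign S • LinearMap.toSpanSingleton A A (h Sᶜ) ∘ₗ LinearMap.proj S

lemma dualPairing_apply (h f : Finset (Fin n) → A) :
    dualPairing h f = ∑ S, dualSign S • (f S * h Sᶜ) := by
  simp [dualPairing]

/-- Both sides are sums of terms `f (S ∪ {s}) * x s * h Sᶜ` with `s ∉ S`; on the right they are
indexed by `S ∪ {s}`. -/
lemma dualPairing_contr (f h : Finset (Fin n) → A) :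
    dualPairing h (contrRight x f) = dualPairing (contrLeft k x h) f := by
  simp only [dualPairing_apply, contrRight_apply, contrLeft_apply, compl_compl, Finset.mul_sum,
    Finset.sum_mul, Finset.smul_sum]
  rw [Finset.sum_sigma', Finset.sum_sigma']
  refine Finset.sum_bij' (fun p _ => ⟨insert p.2 p.1, p.2⟩) (fun p _ => ⟨p.1.erase p.2, p.2⟩)
    ?_ ?_ ?_ ?_ ?_
  · rintro ⟨S, s⟩ -
    simp
  · rintro ⟨S, s⟩ -
    simp
  · rintro ⟨S, s⟩ hs
    have hs : s ∉ S := by simpa using hs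
    simp [hs]
  · rintro ⟨S, s⟩ hs
    have hs : s ∈ S := by simpa using hs
    simp [hs]
  · rintro ⟨S, s⟩ hs
    have hs : s ∉ S := by simpa using hs
    have h1 := dualSign_erase (Finset.mem_insert_self s S)
    rw [Finset.erase_insert hs] at h1
    have h2 : insert s (insert s S)ᶜ = Sᶜ := by
      ext t
      by_cases e : t = s
      · simp [e, hs]
      · simp [e]
    simp only [smul_mul_assoc, mul_smul_comm, smul_smul, h1, h2, mul_assoc]

lemma dualPairing_contr_pow (r : ℕ) (f h : Finset (Fin n) → A) :
    dualPairing h ((contrRight x ^ r) f) = dualPairing ((contrLeft k x ^ r) h) f := by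
  induction r generalizing f with
  | zero => rfl
  | succ r ih =>
    rw [pow_succ, Module.End.mul_apply, ih, dualPairing_contr (k := k), pow_succ',
      Module.End.mul_apply]

lemma dualPairing_single (h : Finset (Fin n) → A) (S : Finset (Fin n)) :
    dualPairing h (Pi.single S 1) = dualSign S • h Sᶜ := by
  rw [dualPairing_apply, Finset.sum_eq_single S]
  · simp
  · intro T _ hT
    simp [hT]
  · simp

end Pairing

/-! ### Extensions of the trivial module by the algebra -/

lemma exists_addEquiv_of_ker_eq {G H K : Type*} [AddCommGroup G] [AddCommGroup H] [AddCommGroup K]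
    (Φ : G →+ H) (χ : G →+ K) (hΦ : Function.Surjective Φ) (hχ : Function.Surjective χ)
    (h : ∀ g, Φ g = 0 ↔ χ g = 0) : ∃ e : H ≃+ K, ∀ g, e (Φ g) = χ g := by
  have hk : Φ.ker = χ.ker := by
    ext g
    exact h g
  refine ⟨(QuotientAddGroup.quotientKerEquivOfSurjective Φ hΦ).symm.trans
    ((QuotientAddGroup.quotientAddEquivOfEq hk).trans
      (QuotientAddGroup.quotientKerEquivOfSurjective χ hχ)), fun g => ?_⟩
  have : (QuotientAddGroup.quotientKerEquivOfSurjective Φ hΦ).symm (Φ g) = (g : G ⧸ Φ.ker) := by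
    rw [AddEquiv.symm_apply_eq]
    rfl
  rw [AddEquiv.trans_apply, this]
  rfl

namespace WordAlgebra

variable {k A : Type u} [Field k] [CharZero k] [Ring A] [Algebra k A] {n N : ℕ}
  (W : WordAlgebra k A n N) (hN : 2 ≤ N)

lemma trivial_d (i : ℕ) : (W.trivialWordModule hN).d i = contrRight W.x ^ stepLen N i :=
  koszulDiff_zero_right hN _ i

lemma right_d (i : ℕ) : (W.rightWordModule hN).d i = contrLeft k W.x ^ stepLen N i :=
  koszulDiff_zero_right hN _ i

/-- The cochains of the Koszul resolution with values in the algebra. -/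
abbrev Cochain (i : ℕ) := (W.trivialWordModule hN).koszulObj i ⟶ ModuleCat.of A A

variable {hN}

/-- The value of a cochain on a basis element. -/
def value {i : ℕ} (f : W.Cochain hN i) (S : CardSet n (jump N i)) : A := f.hom (Pi.single S 1)

lemma hom_apply {i : ℕ} (f : W.Cochain hN i) (v : CardSet n (jump N i) → A) :
    f.hom v = ∑ S, v S * W.value f S := by
  have h : v = ∑ S, v S • (Pi.single S 1 : CardSet n (jump N i) → A) := by
    ext T
    rw [Finset.sum_apply, Finset.sum_eq_single T]
    · simp
    · intro S _ hS
      simp [Ne.symm hS]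
    · simp
  conv_lhs => rw [h]
  rw [map_sum]
  refine Finset.sum_congr rfl fun S _ => ?_
  rw [map_smul]
  rfl

lemma cochain_ext {i : ℕ} {f g : W.Cochain hN i} (h : ∀ S, W.value f S = W.value g S) : f = g := by
  refine ModuleCat.hom_ext (LinearMap.ext fun v => ?_)
  rw [W.hom_apply, W.hom_apply]
  simp only [h]

lemma value_add {i : ℕ} (f g : W.Cochain hN i) (S) :
    W.value (f + g) S = W.value f S + W.value g S := rfl

lemma value_sub {i : ℕ} (f g : W.Cochain hN i) (S) :
    W.value (f - g) S = W.value f S - W.value g S := rfl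

lemma value_comp {i : ℕ} (f : W.Cochain hN i) (a : A) (S) :
    W.value (f ≫ rightMul a) S = W.value f S * a := by
  change LinearMap.toSpanSingleton A A a (W.value f S) = _
  rw [LinearMap.toSpanSingleton_apply, smul_eq_mul]

variable (hN) in
/-- The cochain with the given values. -/
def cochainOfValue (i : ℕ) (v : CardSet n (jump N i) → A) : W.Cochain hN i :=
  ModuleCat.ofHom (∑ S, LinearMap.toSpanSingleton A A (v S) ∘ₗ LinearMap.proj S)

lemma value_cochainOfValue {i : ℕ} (v : CardSet n (jump N i) → A) (S) :
    W.value (W.cochainOfValue hN i v) S = v S := by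
  change (∑ S, LinearMap.toSpanSingleton A A (v S) ∘ₗ LinearMap.proj S) (Pi.single S (1 : A)) = _
  rw [LinearMap.sum_apply, Finset.sum_eq_single S]
  · simp
  · intro T _ hT
    simp [hT]
  · simp

variable (hN) in
/-- The cochain given by pairing with `h`. -/
def pairCochain (i : ℕ) (h : Finset (Fin n) → A) : W.Cochain hN i :=
  ModuleCat.ofHom (dualPairing h ∘ₗ extendZero A A (jump N i))

lemma value_pairCochain {i : ℕ} (h : Finset (Fin n) → A) (S : CardSet n (jump N i)) :
    W.value (W.pairCochain hN i h) S = dualSign S.1 • h S.1ᶜ := by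
  change dualPairing h (extendZero A A (jump N i) (Pi.single S 1)) = _
  rw [extendZero_single, dualPairing_single]

/-- Under complementation the coboundary becomes a power of left contraction, with the exponent of
step `i`. For this to be a differential of the right Koszul complex, that exponent must match at the
mirrored position. -/
lemma koszulHom_pairCochain (i : ℕ) (h : Finset (Fin n) → A) :
    (W.trivialWordModule hN).koszulHom i ≫ W.pairCochain hN i h =
      W.pairCochain hN (i + 1) ((contrLeft k W.x ^ stepLen N i) h) := by
  refine ModuleCat.hom_ext (LinearMap.ext fun v => ?_)
  change dualPairing h (extendZero A A _ ((W.trivialWordModule hN).koszulMap i v)) =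
    dualPairing _ (extendZero A A _ v)
  rw [WordModule.extendZero_koszulMap _ hN, W.trivial_d, dualPairing_contr_pow (k := k)]

lemma pairCochain_eq_zero_iff {i m : ℕ} (hm : jump N i + m = n) {h : Finset (Fin n) → A}
    (hh : h ∈ cardSupp n k A m) : W.pairCochain hN i h = 0 ↔ h = 0 := by
  constructor
  · intro e
    ext T
    by_cases hT : T.card = m
    · have hc : Tᶜ.card = jump N i := by
        rw [Finset.card_compl, Fintype.card_fin]
        omega
      have h1 := W.value_pairCochain (hN := hN) h ⟨Tᶜ, hc⟩
      rw [e, compl_compl] at h1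
      have h2 : dualSign Tᶜ • h T = 0 := h1.symm
      have h3 := congrArg (dualSign Tᶜ • ·) h2
      simp only [smul_smul, dualSign_mul_self, one_smul, smul_zero] at h3
      exact h3
    · exact hh T hT
  · rintro rfl
    refine W.cochain_ext fun S => ?_
    rw [value_pairCochain, Pi.zero_apply, smul_zero]
    rfl

lemma exists_pairCochain {i m : ℕ} (hm : jump N i + m = n) (f : W.Cochain hN i) :
    ∃ h ∈ cardSupp n k A m, W.pairCochain hN i h = f := by
  let h : Finset (Fin n) → A := fun T =>
    if hT : Tᶜ.card = jump N i then dualSign Tᶜ • W.value f ⟨Tᶜ, hT⟩ else 0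
  refine ⟨h, fun T hT => ?_, W.cochain_ext fun S => ?_⟩
  · have : ¬ Tᶜ.card = jump N i := by
      have := T.card_compl_add_card
      rw [Fintype.card_fin] at this
      omega
    simp [h, this]
  · rw [value_pairCochain]
    simp only [h, compl_compl, S.2, dite_true, smul_smul, dualSign_mul_self, one_smul]

/-! ### Cocycles and coboundaries -/

lemma dvd_coboundary {Q : Type*} [CommRing Q] (ψ : A →+* Q) {c : Q} (hc : ∀ s, ψ (W.x s) = c)
    {i : ℕ} (g : W.Cochain hN i) (S) :
    c ^ stepLen N i ∣ ψ (W.value ((W.trivialWordModule hN).koszulHom i ≫ g) S) := by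
  change _ ∣ ψ (g.hom ((W.trivialWordModule hN).koszulMap i (Pi.single S 1)))
  rw [W.hom_apply, map_sum]
  refine Finset.dvd_sum fun T _ => ?_
  rw [map_mul]
  refine Dvd.dvd.mul_right ?_ _
  have := contrRight_pow_dvd W.x ψ hc (stepLen N i) (Pi.single S.1 1) T.1
  rw [← W.trivial_d hN, ← extendZero_single (R := A), ← WordModule.extendZero_koszulMap _ hN,
    extendZero_apply] at this
  exact this

lemma stepLen_ne_zero (hN : 2 ≤ N) (i : ℕ) : stepLen N i ≠ 0 := by
  unfold stepLen
  split_ifs <;> omega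

lemma augmentation_coboundary {i : ℕ} (g : W.Cochain hN i) (S) :
    W.ε (W.value ((W.trivialWordModule hN).koszulHom i ≫ g) S) = 0 := by
  have := W.dvd_coboundary (W.ε : A →+* k) (c := 0) W.ε_x g S
  rw [zero_pow (stepLen_ne_zero hN i)] at this
  exact zero_dvd_iff.1 this

lemma cls_surjective {i : ℕ} (e : Abelian.Ext (trivialModule W.ε) (ModuleCat.of A A) i) :
    ∃ (f : W.Cochain hN i) (hf : (W.trivialWordModule hN).koszulHom i ≫ f = 0),
      W.cls hN f hf = e :=
  extClass_surjective e

lemma cls_eq_zero_iff {i : ℕ} (f : W.Cochain hN (i + 1))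
    (hf : (W.trivialWordModule hN).koszulHom (i + 1) ≫ f = 0) :
    W.cls hN f hf = 0 ↔
      ∃ g : W.Cochain hN i, (W.trivialWordModule hN).koszulHom i ≫ g = f :=
  extClass_eq_zero_iff f hf

variable {W} in
lemma koszulHom_comp_eq_zero {T : ℕ} (hT : n < jump N (T + 1)) (f : W.Cochain hN T) :
    (W.trivialWordModule hN).koszulHom T ≫ f = 0 :=
  WordModule.koszulObj_hom_eq_zero _ hT _

variable (hN) in
/-- The classes of the cochains in the top degree. -/
def topClass (T : ℕ) (hT : n < jump N (T + 1)) :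
    W.Cochain hN T →+ Abelian.Ext (trivialModule W.ε) (ModuleCat.of A A) T :=
  AddMonoidHom.mk' (fun f => W.cls hN f (koszulHom_comp_eq_zero hT f))
    fun f g => extClass_add f g (koszulHom_comp_eq_zero hT f) (koszulHom_comp_eq_zero hT g)

lemma topClass_surjective {T : ℕ} (hT : n < jump N (T + 1)) :
    Function.Surjective (W.topClass hN T hT) := fun e => by
  obtain ⟨f, hf, rfl⟩ := W.cls_surjective (hN := hN) e
  exact ⟨f, rfl⟩

lemma topClass_comp {T : ℕ} (hT : n < jump N (T + 1)) (f : W.Cochain hN T) (a : A) :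
    W.topClass hN T hT (f ≫ rightMul a) = extRightAct W.ε a (W.topClass hN T hT f) :=
  (extClass_comp f (koszulHom_comp_eq_zero hT f) (rightMul a)).symm

lemma topClass_eq_zero_iff {T : ℕ} (hT : n < jump N (T + 1 + 1)) (f : W.Cochain hN (T + 1)) :
    W.topClass hN (T + 1) hT f = 0 ↔
      ∃ g : W.Cochain hN T, (W.trivialWordModule hN).koszulHom T ≫ g = f :=
  W.cls_eq_zero_iff f (koszulHom_comp_eq_zero hT f)

lemma augmentation_value_of_topClass_eq_zero {T : ℕ} (hT0 : T ≠ 0) (hT : n < jump N (T + 1))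
    {f : W.Cochain hN T} (h : W.topClass hN T hT f = 0) (S) : W.ε (W.value f S) = 0 := by
  obtain ⟨T, rfl⟩ := Nat.exists_eq_succ_of_ne_zero hT0
  obtain ⟨g, rfl⟩ := (W.topClass_eq_zero_iff hT f).1 h
  exact W.augmentation_coboundary g S

variable (hN) in
/-- The dual of a basis element. -/
def dualBasis (i : ℕ) (S : CardSet n (jump N i)) : W.Cochain hN i :=
  W.cochainOfValue hN i (Pi.single S 1)

lemma value_dualBasis {i : ℕ} (S : CardSet n (jump N i)) :
    W.value (W.dualBasis hN i S) S = 1 := by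
  rw [dualBasis, value_cochainOfValue, Pi.single_eq_same]

lemma value_dualBasis_of_ne {i : ℕ} {S T : CardSet n (jump N i)} (h : T ≠ S) :
    W.value (W.dualBasis hN i S) T = 0 := by
  rw [dualBasis, value_cochainOfValue, Pi.single_eq_of_ne h]

lemma topClass_dualBasis_ne_zero {T : ℕ} (hT0 : T ≠ 0) (hT : n < jump N (T + 1))
    (S : CardSet n (jump N T)) : W.topClass hN T hT (W.dualBasis hN T S) ≠ 0 := by
  intro h
  have := W.augmentation_value_of_topClass_eq_zero hT0 hT h S
  rw [value_dualBasis, map_one] at this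
  exact one_ne_zero this

end WordAlgebra

/-! ### The Gorenstein property -/

namespace WordAlgebra

variable {k A : Type u} [Field k] [CharZero k] [Ring A] [Algebra k A] {n N : ℕ}
  (W : WordAlgebra k A n N)

-- For the lower bound, a dual basis cochain takes the value `1`, whereas values of coboundaries lie
-- in the augmentation ideal; so the top `Ext` of the trivial module is nonzero.
include W in
lemma leftGlobalDimension_eq (hN : 2 ≤ N) {T : ℕ} (hT0 : T ≠ 0) (hTn : jump N T ≤ n)
    (hT : n < jump N (T + 1)) : leftGlobalDimension A = (T : WithBot ℕ∞) := by
  refine le_antisymm (W.leftGlobalDimension_le hN hT) ?_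
  refine le_trans ?_ (le_iSup (fun M : ModuleCat.{u} A => projectiveDimension M)
    (trivialModule W.ε))
  rw [projectiveDimension_ge_iff]
  intro h
  obtain ⟨S, -, hS⟩ := Finset.exists_subset_card_eq (s := (Finset.univ : Finset (Fin n)))
    (by simpa using hTn)
  exact W.topClass_dualBasis_ne_zero (hN := hN) hT0 hT ⟨S, hS⟩
    (Abelian.Ext.eq_zero_of_hasProjectiveDimensionLT _ T le_rfl)

/-- If the Koszul complex is self-dual, the algebra is AS-Gorenstein. -/
lemma isASGorenstein_of_jump_add_jump (hN : 2 ≤ N) {D : ℕ} (hD0 : D ≠ 0)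
    (hsym : ∀ i ≤ D, jump N i + jump N (D - i) = n) (hD : n < jump N (D + 1)) :
    IsASGorenstein W.ε := by
  have hj0 : jump N 0 = 0 := by simp [jump]
  have hDn : jump N D = n := by simpa [hj0] using hsym D le_rfl
  -- Taking differences in `hsym` matches the exponents at mirrored positions, which makes the dual
  -- complex the right Koszul complex.
  have hstep : ∀ i j, i + j + 1 = D → stepLen N i = stepLen N j := by
    intro i j hij
    have h1 := hsym i (by omega)
    have h2 := hsym (i + 1) (by omega)
    rw [show D - i = j + 1 by omega, jump_succ (by omega)] at h1
    rw [show D - (i + 1) = j by omega, jump_succ (by omega)] at h2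
    omega
  have hpair : ∀ i j, i + j + 1 = D → ∀ h, (W.trivialWordModule hN).koszulHom i ≫
      W.pairCochain hN i h = W.pairCochain hN (i + 1) ((W.rightWordModule hN).d j h) := by
    intro i j hij h
    rw [W.koszulHom_pairCochain, W.right_d, hstep i j hij]
  refine ⟨D, W.leftGlobalDimension_eq hN hD0 hDn.le hD, fun i hi => ?_, ?_⟩
  · rcases hi.lt_or_gt with hlt | hgt
    · refine subsingleton_of_forall_eq 0 fun e => ?_
      obtain ⟨f, hf, rfl⟩ := W.cls_surjective (hN := hN) e
      obtain ⟨j, rfl⟩ : ∃ j, D = i + j + 1 := ⟨D - i - 1, by omega⟩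
      obtain ⟨h, hh, rfl⟩ := W.exists_pairCochain (m := jump N (j + 1))
        (by rw [← hsym i hlt.le, show i + j + 1 - i = j + 1 by omega]) f
      have h0 : (W.rightWordModule hN).d j h = 0 := by
        rw [hpair i j rfl] at hf
        refine (W.pairCochain_eq_zero_iff (m := jump N j) ?_
          ((W.rightWordModule hN).d_mem hN j hh)).1 hf
        rw [← hsym (i + 1) (by omega), show i + j + 1 - (i + 1) = j by omega]
      obtain ⟨g, hg, rfl⟩ := (W.rightWordModule hN).exact_succ hN j hh h0
      cases i with
      | zero =>
        -- Here `g` lives on sets of size `jump N (D + 1) > n`, of which there are none.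
        have hg0 : g = 0 := eq_zero_of_mem_cardSupp hg (by simpa using hD)
        subst hg0
        have : W.pairCochain hN 0 ((W.rightWordModule hN).d (j + 1) 0) = 0 := by
          rw [map_zero, W.pairCochain_eq_zero_iff (m := n) (by rw [hj0, zero_add])
            (Submodule.zero_mem _)]
        simp only [this]
        exact extClass_zero
      | succ i =>
        rw [W.cls_eq_zero_iff]
        exact ⟨W.pairCochain hN i g, hpair i (j + 1) (by omega) g⟩
    · refine (W.trivialWordModule hN).subsingleton_ext (μ := augLinear W.ε) hN
        (augLinear_surjective W.ε) ?_ ?_ (hD.trans_le ?_) _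
      · exact W.augLinear_mul_x
      · exact fun _ => W.eq_zero_of_augmentation_smul_one
      · rcases (Nat.succ_le_of_lt hgt).eq_or_lt with rfl | h
        · exact le_rfl
        · exact (jump_lt_jump hN h).le
  · let U : CardSet n (jump N D) := ⟨Finset.univ, by rw [hDn, Finset.card_univ, Fintype.card_fin]⟩
    let χ : W.Cochain hN D →+ k :=
      AddMonoidHom.mk' (fun f => W.ε (W.value f U)) fun f g => by rw [W.value_add, map_add]
    have hχ : Function.Surjective χ := fun c => ⟨W.cochainOfValue hN D fun _ => algebraMap k A c, by
      change W.ε (W.value _ U) = c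
      rw [W.value_cochainOfValue]
      exact W.ε.commutes c⟩
    have hker : ∀ f, W.topClass hN D hD f = 0 ↔ χ f = 0 := by
      intro f
      refine ⟨fun h => W.augmentation_value_of_topClass_eq_zero hD0 hD h U, fun hf => ?_⟩
      obtain ⟨h, hh, rfl⟩ := W.exists_pairCochain (m := 0) (by rw [hDn, add_zero]) f
      have h1 : W.ε (h ∅) = 0 := by
        have h2 : W.ε (W.value (W.pairCochain hN D h) U) = 0 := hf
        rw [W.value_pairCochain, map_zsmul, Finset.compl_univ] at h2
        have h3 := congrArg (dualSign (Finset.univ : Finset (Fin n)) • ·) h2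
        simp only [U, smul_smul, dualSign_mul_self, one_smul, smul_zero] at h3
        exact h3
      -- In the top degree a cochain is a single element of `A`; exactness of the right complex at
      -- its augmented end makes it a coboundary once its constant term vanishes.
      obtain ⟨g, -, rfl⟩ := (W.rightWordModule hN).exact_zero (by omega) (W.ε : A →+ k)
        (fun s b => by
          change W.ε (W.x s * b) = W.ε 0
          rw [map_mul, W.ε_x, zero_mul, map_zero])
        (fun _ => W.eq_zero_of_augmentation_smul_one) hh h1
      obtain ⟨D, rfl⟩ := Nat.exists_eq_succ_of_ne_zero hD0
      rw [W.topClass_eq_zero_iff]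
      exact ⟨W.pairCochain hN D g, hpair D 0 rfl g⟩
    obtain ⟨φ, hφ⟩ := exists_addEquiv_of_ker_eq (W.topClass hN D hD) χ
      (W.topClass_surjective hD) hχ hker
    refine ⟨φ, fun a e => ?_⟩
    obtain ⟨f, rfl⟩ := W.topClass_surjective (hN := hN) hD e
    rw [← W.topClass_comp, hφ, hφ]
    change W.ε (W.value (f ≫ rightMul a) U) = W.ε (W.value f U) * W.ε a
    rw [W.value_comp, map_mul]

/-- In an AS-Gorenstein algebra the top class spans the top component of the Koszul complex. -/
lemma eq_of_isASGorenstein (hN : 2 ≤ N) {T : ℕ} (hT0 : T ≠ 0) (hTn : jump N T ≤ n)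
    (hT : n < jump N (T + 1)) (hG : IsASGorenstein W.ε) :
    jump N T = n ∧ (N = 2 ∨ ¬ Even T) := by
  obtain ⟨D, hD, -, φ, hφ⟩ := hG
  rw [W.leftGlobalDimension_eq hN hT0 hTn hT] at hD
  obtain rfl : T = D := by exact_mod_cast hD
  let G : W.Cochain hN T →+ k := φ.toAddMonoidHom.comp (W.topClass hN T hT)
  have hGcomp : ∀ f a, G (f ≫ rightMul a) = G f * W.ε a := fun f a => by
    change φ (W.topClass hN T hT (f ≫ rightMul a)) = _
    rw [W.topClass_comp, hφ]
    rfl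
  have hG0 : ∀ f, G f = 0 → W.topClass hN T hT f = 0 := fun f h => by
    have h : φ (W.topClass hN T hT f) = 0 := h
    exact (map_eq_zero_iff φ φ.injective).1 h
  have hG1 : ∀ S, G (W.dualBasis hN T S) ≠ 0 := fun S h =>
    W.topClass_dualBasis_ne_zero hT0 hT S (hG0 _ h)
  have huniq : ∀ S S' : CardSet n (jump N T), S = S' := by
    intro S S'
    by_contra hne
    -- Since `Ext` is one-dimensional, this combination of two nonzero classes vanishes; yet its
    -- value at `S` is a nonzero scalar, outside the augmentation ideal.
    let f := W.dualBasis hN T S ≫ rightMul (algebraMap k A (G (W.dualBasis hN T S'))) -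
      W.dualBasis hN T S' ≫ rightMul (algebraMap k A (G (W.dualBasis hN T S)))
    have hf : G f = 0 := by
      rw [map_sub, hGcomp, hGcomp, AlgHom.commutes, AlgHom.commutes]
      change _ * G (W.dualBasis hN T S') - _ * G (W.dualBasis hN T S) = 0
      ring
    have h1 := W.augmentation_value_of_topClass_eq_zero hT0 hT (hG0 f hf) S
    rw [W.value_sub, W.value_comp, W.value_comp, W.value_dualBasis, W.value_dualBasis_of_ne hne,
      one_mul, zero_mul, sub_zero, AlgHom.commutes] at h1
    exact hG1 S' h1
  have hn : jump N T = n := by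
    by_contra hne
    obtain ⟨S, -, hS⟩ := Finset.exists_subset_card_eq (s := (Finset.univ : Finset (Fin n)))
      (by simpa using hTn)
    have hpos : 0 < S.card := by
      rw [hS]
      exact (Nat.pos_of_ne_zero hT0).trans_le (le_jump hN T)
    obtain ⟨s, hs⟩ := Finset.card_pos.1 hpos
    obtain ⟨t, ht⟩ : ∃ t, t ∉ S := by
      by_contra! hall
      have : S = Finset.univ := Finset.eq_univ_iff_forall.2 hall
      rw [this, Finset.card_univ, Fintype.card_fin] at hS
      exact hne hS.symm
    have hS' : (insert t (S.erase s)).card = jump N T := by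
      rw [Finset.card_insert_of_notMem (by simp [ht]), Finset.card_erase_of_mem hs]
      omega
    -- A nonempty proper subset is never the only one of its size: exchange one of its letters for
    -- an outside one.
    have : S = insert t (S.erase s) := congrArg Subtype.val (huniq ⟨S, hS⟩ ⟨_, hS'⟩)
    rw [this] at ht
    exact ht (Finset.mem_insert_self _ _)
  refine ⟨hn, ?_⟩
  by_contra! hcon
  obtain ⟨hN2, hev⟩ := hcon
  obtain ⟨T, rfl⟩ := Nat.exists_eq_succ_of_ne_zero hT0
  have hodd : ¬ Even T := by simpa [Nat.even_add_one] using hev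
  let U : CardSet n (jump N (T + 1)) :=
    ⟨Finset.univ, by rw [hn, Finset.card_univ, Fintype.card_fin]⟩
  have hnpos : 0 < n := by
    rw [← hn]
    exact (Nat.succ_pos T).trans_le (le_jump hN _)
  let s : Fin n := ⟨0, hnpos⟩
  -- A generator acts by zero on the top class, so the cochain with value `x s` is a coboundary. For
  -- odd `T` and `N > 2` the last differential has degree `N - 1 ≥ 2`, which excludes linear values.
  have h0 : W.topClass hN (T + 1) hT (W.dualBasis hN (T + 1) U ≫ rightMul (W.x s)) = 0 :=
    hG0 _ (by rw [hGcomp, W.ε_x, mul_zero])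
  obtain ⟨g, hg⟩ := (W.topClass_eq_zero_iff hT _).1 h0
  have h1 := W.dvd_coboundary (W.dual : A →+* DualNumber k) W.dual_x g U
  rw [hg, W.value_comp, W.value_dualBasis, one_mul] at h1
  have h2 : (DualNumber.eps : DualNumber k) ^ stepLen N T = 0 := by
    rw [stepLen, if_neg hodd, show N - 1 = (N - 3) + 2 by omega, pow_add, pow_two,
      DualNumber.eps_mul_eps, mul_zero]
  rw [h2, zero_dvd_iff] at h1
  have h3 : (DualNumber.eps : DualNumber k) = 0 := (W.dual_x s).symm.trans h1
  have h4 := congrArg TrivSqZeroExt.snd h3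
  simp at h4

lemma isASGorenstein_iff (hN : 2 ≤ N) (hn : N ≤ n) :
    IsASGorenstein W.ε ↔ N = 2 ∨ (2 < N ∧ ∃ q : ℕ, 1 ≤ q ∧ n = N * q + 1) := by
  constructor
  · intro hG
    obtain ⟨T, hT0, hTn, hT⟩ := exists_jump_le hN (by omega : 1 ≤ n)
    obtain ⟨h1, h2⟩ := W.eq_of_isASGorenstein hN hT0 hTn hT hG
    by_cases h : N = 2
    · exact Or.inl h
    · refine Or.inr ⟨by omega, T / 2, ?_, ?_⟩
      · by_contra h0
        have : T < 2 := by omega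
        have h3 : T / 2 = 0 := by omega
        rw [jump, h3] at h1
        omega
      · have h3 : T % 2 = 1 := Nat.odd_iff.1 (Nat.not_even_iff_odd.1 (h2.resolve_left h))
        rw [jump, h3, mul_comm] at h1
        exact h1.symm
  · rintro (rfl | ⟨h, q, hq, rfl⟩)
    · have hj : ∀ i, jump 2 i = i := fun i => Nat.div_add_mod' i 2
      refine W.isASGorenstein_of_jump_add_jump hN (D := n) (by omega) (fun i hi => ?_) ?_
      · rw [hj, hj]
        omega
      · rw [hj]
        omega
    -- With `D` odd, `i` and `D - i` have opposite parities: the remainders in `jump` add up to `1`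
    -- and the quotients to `q`.
    · refine W.isASGorenstein_of_jump_add_jump hN (D := 2 * q + 1) (by omega) (fun i hi => ?_) ?_
      · unfold jump
        have h1 : i / 2 + (2 * q + 1 - i) / 2 = q := by omega
        have h2 : i % 2 + (2 * q + 1 - i) % 2 = 1 := by omega
        have h3 : i / 2 * N + (2 * q + 1 - i) / 2 * N = N * q := by rw [← add_mul, h1, mul_comm]
        omega
      · unfold jump
        have h1 : (2 * q + 1 + 1) / 2 = q + 1 := by omega
        rw [h1, add_mul, mul_comm q]
        omega

end WordAlgebra

/-! ### The generalized Koszul property -/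

namespace WordAlgebra

variable {k A : Type u} [Field k] [CharZero k] [Ring A] [Algebra k A] {n N : ℕ}
  (W : WordAlgebra k A n N) (hN : 2 ≤ N)

variable (A n) in
/-- Functions on the sets of `j` letters as finitely supported functions. -/
def finsuppCardSet (j : ℕ) : (ULift.{u} (CardSet n j) →₀ A) ≃ₗ[A] (CardSet n j → A) :=
  Finsupp.domLCongr Equiv.ulift ≪≫ₗ Finsupp.linearEquivFunOnFinite A A _

lemma finsuppCardSet_single {j : ℕ} (S : ULift.{u} (CardSet n j)) (a : A) :
    finsuppCardSet A n j (Finsupp.single S a) = Pi.single S.down a := by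
  rw [finsuppCardSet, LinearEquiv.trans_apply, Finsupp.domLCongr_single]
  exact Finsupp.linearEquivFunOnFinite_single A A _ S.down a

lemma finsuppCardSet_symm_apply {j : ℕ} (f : CardSet n j → A) (S : ULift.{u} (CardSet n j)) :
    (finsuppCardSet A n j).symm f S = f S.down := rfl

lemma koszulMap_single_mem {V : Submodule k A} (hV : ∀ s, W.x s ∈ V) (i : ℕ) (S T) :
    (W.trivialWordModule hN).koszulMap i (Pi.single S 1) T ∈ V ^ stepLen N i := by
  rw [← extendZero_apply (R := A) ((W.trivialWordModule hN).koszulMap i _) T, WordModule.extendZero_koszulMap _ hN, extendZero_single,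
    W.trivial_d]
  refine contrRight_pow_mem W.x hV _ (fun U => ?_) _
  rw [pow_zero]
  by_cases h : U = S.1
  · subst h
    rw [Pi.single_eq_same]
    exact Submodule.one_le.1 le_rfl
  · rw [Pi.single_eq_of_ne h]
    exact Submodule.zero_mem _

/-- The Koszul resolution of the trivial module. -/
def gradedFreeResolution {V : Submodule k A} (hV : ∀ s, W.x s ∈ V) :
    GradedFreeResolution (fun m => V ^ m) W.ε where
  basis i := ULift.{u} (CardSet n (jump N i))
  deg i _ := jump N i
  d i := (finsuppCardSet A n _).symm.toLinearMap ∘ₗ (W.trivialWordModule hN).koszulMap i ∘ₗ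
    (finsuppCardSet A n _).toLinearMap
  aug :=
    { toFun := fun f => W.ε (f ⟨WordModule.emptyCard⟩)
      map_add' := fun f g => by rw [Finsupp.add_apply, map_add]
      map_smul' := fun a f => by
        rw [Finsupp.smul_apply, smul_eq_mul, map_mul]
        rfl }
  d_homogeneous i b c := by
    refine Or.inr ⟨stepLen N i, (jump_succ (by omega) i).symm, ?_⟩
    rw [LinearMap.comp_apply, LinearMap.comp_apply, LinearEquiv.coe_coe, LinearEquiv.coe_coe,
      finsuppCardSet_symm_apply, finsuppCardSet_single]
    exact W.koszulMap_single_mem hN hV i _ _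
  aug_homogeneous _ := Or.inr (by simp [jump])
  aug_surjective c := ⟨Finsupp.single ⟨WordModule.emptyCard⟩ (algebraMap k A c), by
    change W.ε (Finsupp.single (⟨WordModule.emptyCard⟩ : ULift.{u} (CardSet n (jump N 0))) _ _) = c
    rw [Finsupp.single_eq_same]
    exact W.ε.commutes c⟩
  exact_zero f := by
    have h := (W.trivialWordModule hN).koszulMap_exact_zero hN (W.ε : A →+ k)
      (fun s b => by
        change W.ε (b * W.x s) = W.ε 0
        rw [map_mul, W.ε_x, mul_zero, map_zero])
      (fun _ => W.eq_zero_of_augmentation_smul_one) (finsuppCardSet A n _ f)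
    refine h.trans ⟨fun ⟨g, hg⟩ => ⟨(finsuppCardSet A n _).symm g, ?_⟩, fun ⟨g, hg⟩ =>
      ⟨finsuppCardSet A n _ g, ?_⟩⟩
    · simp [hg]
    · simp [← hg]
  exact_succ i f := by
    have h := (W.trivialWordModule hN).koszulMap_exact hN i (finsuppCardSet A n _ f)
    refine Iff.trans ?_ (h.trans ⟨fun ⟨g, hg⟩ => ⟨(finsuppCardSet A n _).symm g, ?_⟩,
      fun ⟨g, hg⟩ => ⟨finsuppCardSet A n _ g, ?_⟩⟩)
    · simp
    · simp [hg]
    · simp [← hg]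

-- All generators in homological degree `i` sit in internal degree `jump N i`, so there are no
-- cycles in any other degree.
include hN in
lemma isGeneralizedKoszul {V : Submodule k A} (hV : ∀ s, W.x s ∈ V) :
    IsGeneralizedKoszul N (fun m => V ^ m) W.ε := by
  refine ⟨W.gradedFreeResolution hN hV, fun i _ j hj => ?_⟩
  have h : (W.gradedFreeResolution hN hV).gradedCycles i j = ⊥ := by
    rw [eq_bot_iff]
    refine inf_le_right.trans ?_
    have hempty : {b | (W.gradedFreeResolution hN hV).deg i b = j} = ∅ :=
      Set.eq_empty_of_forall_notMem fun _ h => hj h.symm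
    rw [hempty, Finsupp.supported_empty]
  rw [GradedFreeResolution.Tor, h, Submodule.map_bot]

end WordAlgebra

end

theorem corollary5p10 {k : Type u} [Field k] [CharZero k] (n N : ℕ) (hN : 2 ≤ N) (hn : N ≤ n) :
    IsGeneralizedKoszul N (AntisymmetrizerAlgebra.component k n N)
        (AntisymmetrizerAlgebra.augmentation k n hN) ∧
      HasFiniteGlobalDimension (AntisymmetrizerAlgebra k n N) ∧
      (IsASGorenstein (AntisymmetrizerAlgebra.augmentation k n hN) ↔
        N = 2 ∨ (2 < N ∧ ∃ q : ℕ, 1 ≤ q ∧ n = N * q + 1)) := by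
  let W := AntisymmetrizerAlgebra.wordAlgebra k n N hN
  obtain ⟨T, hT0, hTn, hT⟩ := exists_jump_le hN (by omega : 1 ≤ n)
  exact ⟨W.isGeneralizedKoszul hN fun s => Submodule.subset_span (Set.mem_range_self s),
    ⟨T, W.leftGlobalDimension_eq hN hT0 hTn hT⟩, W.isASGorenstein_iff hN hn⟩
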